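/- Let $p,q,r,s\ge 0$ be integers. Write $\theta=(\gamma,\delta)$ with $\gamma=(\mu,\phi_1,\dots,\phi_p,\psi_1,\dots,\psi_q)\in\mathbb R^{p+q+1}$ and $\delta=(\alpha_0,\dots,\alpha_r,\beta_1,\dots,\beta_s)\in[0,\infty)^{r+s+1}$. Let $\Theta=\Theta_\gamma\times\Theta_\delta$ with $\Theta_\gamma\subset\mathbb R^{p+q+1}$ and $\Theta_\delta\subset(0,\infty)\times[0,\infty)^{r+s}$ compact (so $\alpha_0>0$ on $\Theta$), and let $\theta_0$ be an interior point of $\Theta$ in $\mathbb R^{p+q+1}\times\mathbb R^{r+s+1}$. Let $(\eta_t)_{t\in\mathbb Z}$ be i.i.d. real random variables, and let $(y_t,\varepsilon_t,h_t)_{t\in\mathbb Z}$ be a strictly stationary solution, with $h_t\ge 0$, of the ARMA–GARCH model with parameter $\theta=\theta_0$, $$y_t=\mu+\sum_{i=1}^p\phi_iy_{t-i}+\sum_{i=1}^q\psi_i\varepsilon_{t-i}+\varepsilon_t,\qquad \varepsilon_t=\eta_t\sqrt{h_t},\qquad h_t=\alpha_0+\sum_{i=1}^r\alpha_i\varepsilon_{t-i}^2+\sum_{i=1}^s\beta_ih_{t-i},$$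 that is causal: with $\mathcal F_t=\sigma(\eta_k:k\le t)$, $y_t$ is $\mathcal F_t$-measurable and $h_t$ is $\mathcal F_{t-1}$-measurable, up to null sets. For $\theta\in\Theta$ let $\varepsilon_t(\gamma)$ and $h_t(\theta)$ be computed from the infinite past of $y$ by $$\varepsilon_t(\gamma)=y_t-\mu-\sum_{i=1}^p\phi_iy_{t-i}-\sum_{i=1}^q\psi_i\varepsilon_{t-i}(\gamma),\qquad h_t(\theta)=\alpha_0+\sum_{i=1}^r\alpha_i\varepsilon_{t-i}(\gamma)^2+\sum_{i=1}^s\beta_ih_{t-i}(\theta),$$ solved by expanding the inverse lag polynomials $\psi^{-1}$ and $\beta^{-1}$ as one-sided power series in the backshift operator, where $\phi(z)=1-\sum_{i=1}^p\phi_iz^i$, $\psi(z)=1+\sum_{i=1}^q\psi_iz^i$, $\alpha(z)=\sum_{i=1}^r\alpha_iz^i$, $\beta(z)=1-\sum_{i=1}^s\beta_iz^i$. Let $w:\mathbb R^{\{0,1,2,\dots\}}\to(0,\infty)$ be measurable and bounded, $w_t=w(y_{t-1},y_{t-2},\dots)$, and $$L_{sn}(\theta)=\frac1n\sum_{t=1}^nw_t\,l_t(\theta),\qquad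 l_t(\theta)=\log\sqrt{h_t(\theta)}+\frac{|\varepsilon_t(\gamma)|}{\sqrt{h_t(\theta)}} .$$ Suppose that $0$ is a median of $\eta_t$, that $E|\eta_t|=1$, and that: 1. for each $\theta\in\Theta$, $\phi(z)\ne0$ and $\psi(z)\ne0$ for all complex $|z|\le1$, $\phi$ and $\psi$ have no common root in $\mathbb C$, and $\phi_p\ne0$ or $\psi_q\ne0$ (this last condition is void if $p=q=0$; the coefficient of an absent lag is read as $0$); 2. for each $\theta\in\Theta$, $\alpha(z)$ and $\beta(z)$ have no common root in $\mathbb C$, $\alpha(1)\ne1$, $\alpha_r+\beta_s\ne0$ (for $r=0$ or $s=0$ the absent coefficient is read as $0$), and $\sum_{i=1}^s\beta_i<1$; 3. $\eta_t^2$ is not almost surely constant and $E\eta_t^2<\infty$; 4. $E[(w_t+w_t^2)\xi_{\rho,t-1}^3]<\infty$ for every $\rho\in(0,1)$, where $\xi_{\rho,t}=1+\sum_{i=0}^\infty\rho^i|y_{t-i}|$; 5. $E|\varepsilon_t|^{2\iota}<\infty$ for some $\iota>0$. Then almost surely $L_{sn}$ attains its minimum over $\Theta$ for every $n\ge1$,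 and if $\hat\theta_{sn}$ is, for each $n\ge 1$, almost surely a minimiser of $L_{sn}$ over $\Theta$ (the self-weighted quasi-maximum exponential likelihood estimator), then $\hat\theta_{sn}\to\theta_0$ almost surely as $n\to\infty$. -/

import Mathlib

open MeasureTheory ProbabilityTheory Filter Topology

noncomputable section

/-- ARMA parameter `γ = (μ, φ₁, …, φ_p, ψ₁, …, ψ_q)`. The entry with index `i : Fin p` (or `Fin q`)
is the coefficient of lag `i + 1`. -/
abbrev ARMAParam (p q : ℕ) : Type := ℝ × (Fin p → ℝ) × (Fin q → ℝ)

/-- GARCH parameter `δ = (α₀, α₁, …, α_r, β₁, …, β_s)`. The entry with index `i : Fin r` (or `Fin s`)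
is the coefficient of lag `i + 1`. -/
abbrev GARCHParam (r s : ℕ) : Type := ℝ × (Fin r → ℝ) × (Fin s → ℝ)

/-- The full parameter `θ = (γ, δ)`, a point of `ℝ^(p+q+1) × ℝ^(r+s+1)`. -/
abbrev ARMAGARCHParam (p q r s : ℕ) : Type := ARMAParam p q × GARCHParam r s

namespace ARMAParam

variable {p q : ℕ}

/-- The intercept `μ`. -/
abbrev mu (γ : ARMAParam p q) : ℝ := γ.1

/-- The autoregressive coefficients. -/
abbrev ar (γ : ARMAParam p q) : Fin p → ℝ := γ.2.1

/-- The moving-average coefficients. -/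
abbrev ma (γ : ARMAParam p q) : Fin q → ℝ := γ.2.2

end ARMAParam

namespace GARCHParam

variable {r s : ℕ}

/-- The intercept `α₀`. -/
abbrev const (δ : GARCHParam r s) : ℝ := δ.1

/-- The coefficients `α₁, …, α_r` of the lagged squared errors. -/
abbrev arch (δ : GARCHParam r s) : Fin r → ℝ := δ.2.1

/-- The coefficients `β₁, …, β_s` of the lagged volatilities. -/
abbrev garch (δ : GARCHParam r s) : Fin s → ℝ := δ.2.2

end GARCHParam

/-- The polynomial `∑_{i=1}^d c_i z^i`, where `c_i` is the entry of `c` with index `i - 1`. -/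
def lagPoly {d : ℕ} (c : Fin d → ℝ) : Polynomial ℝ :=
  ∑ i : Fin d, Polynomial.C (c i) * Polynomial.X ^ ((i : ℕ) + 1)

/-- `φ(z) = 1 - ∑ φ_i z^i`. -/
def ARMAParam.arPoly {p q : ℕ} (γ : ARMAParam p q) : Polynomial ℝ := 1 - lagPoly γ.ar

/-- `ψ(z) = 1 + ∑ ψ_i z^i`. -/
def ARMAParam.maPoly {p q : ℕ} (γ : ARMAParam p q) : Polynomial ℝ := 1 + lagPoly γ.ma

/-- `α(z) = ∑ α_i z^i` (the intercept `α₀` does not enter). -/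
def GARCHParam.archPoly {r s : ℕ} (δ : GARCHParam r s) : Polynomial ℝ := lagPoly δ.arch

/-- `β(z) = 1 - ∑ β_i z^i`. -/
def GARCHParam.garchPoly {r s : ℕ} (δ : GARCHParam r s) : Polynomial ℝ := 1 - lagPoly δ.garch

/-- The coefficient of the highest lag, read as `0` if there is no lag at all. -/
def lastCoeff : {d : ℕ} → (Fin d → ℝ) → ℝ
  | 0, _ => 0
  | d + 1, c => c (Fin.last d)

/-- The polynomials have no common root in `ℂ`. -/
def NoCommonRoot (A B : Polynomial ℝ) : Prop :=
  ∀ z : ℂ, ¬ (Polynomial.aeval z A = 0 ∧ Polynomial.aeval z B = 0)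

/-- Causality, invertibility and identifiability of the ARMA part: `φ(z) ≠ 0` and `ψ(z) ≠ 0` for
`|z| ≤ 1`, no common root, and `φ_p ≠ 0` or `ψ_q ≠ 0` (void when there is no ARMA lag,
`p = q = 0`). -/
structure ARMAParam.Admissible {p q : ℕ} (γ : ARMAParam p q) : Prop where
  ar_ne_zero : ∀ z : ℂ, ‖z‖ ≤ 1 → Polynomial.aeval z γ.arPoly ≠ 0
  ma_ne_zero : ∀ z : ℂ, ‖z‖ ≤ 1 → Polynomial.aeval z γ.maPoly ≠ 0
  noCommonRoot : NoCommonRoot γ.arPoly γ.maPoly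
  last_ne_zero : p + q ≠ 0 → lastCoeff γ.ar ≠ 0 ∨ lastCoeff γ.ma ≠ 0

/-- The sign constraints of the GARCH equation: `α₀ > 0`, `α_i ≥ 0`, `β_j ≥ 0`. -/
structure GARCHParam.Positive {r s : ℕ} (δ : GARCHParam r s) : Prop where
  const_pos : 0 < δ.const
  arch_nonneg : ∀ i, 0 ≤ δ.arch i
  garch_nonneg : ∀ j, 0 ≤ δ.garch j

/-- Identifiability of the GARCH part: `α(z)` and `β(z)` have no common root, `α(1) ≠ 1`,
`α_r + β_s ≠ 0` and `∑ β_i < 1`. -/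
structure GARCHParam.Admissible {r s : ℕ} (δ : GARCHParam r s) : Prop where
  noCommonRoot : NoCommonRoot δ.archPoly δ.garchPoly
  arch_one_ne : δ.archPoly.eval 1 ≠ 1
  last_ne_zero : lastCoeff δ.arch + lastCoeff δ.garch ≠ 0
  garch_sum_lt_one : ∑ j, δ.garch j < 1

/-- The one-sided filter `∑_{k ≥ 0} b_k u_{t-k}`, where `b_k` are the coefficients of `B`. -/
def causalFilter (B : PowerSeries ℝ) (u : ℤ → ℝ) (t : ℤ) : ℝ :=
  ∑' k : ℕ, PowerSeries.coeff k B * u (t - k)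

/-- The residual `ε_t(γ)` computed from the path `y`: the solution of
`ε_t = y_t - μ - ∑ φ_i y_{t-i} - ∑ ψ_i ε_{t-i}` obtained by inverting `ψ(B)`, `B` the backshift
(see `armaResidual_eq` below). -/
def armaResidual {p q : ℕ} (γ : ARMAParam p q) (y : ℤ → ℝ) (t : ℤ) : ℝ :=
  causalFilter (γ.maPoly : PowerSeries ℝ)⁻¹
    (fun u => y u - γ.mu - ∑ i : Fin p, γ.ar i * y (u - ((i : ℤ) + 1))) t

/-- The conditional scale `h_t(θ)` computed from the path `y`: the solution of
`h_t = α₀ + ∑ α_i ε_{t-i}(γ)² + ∑ β_i h_{t-i}` obtained by inverting `β(B)`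
(see `condScale_eq` below). -/
def condScale {p q r s : ℕ} (θ : ARMAGARCHParam p q r s) (y : ℤ → ℝ) (t : ℤ) : ℝ :=
  causalFilter (θ.2.garchPoly : PowerSeries ℝ)⁻¹
    (fun u => θ.2.const + ∑ i : Fin r, θ.2.arch i * armaResidual θ.1 y (u - ((i : ℤ) + 1)) ^ 2) t

/-- `l_t(θ) = log √h_t(θ) + |ε_t(γ)| / √h_t(θ)`. -/
def laplaceLoss {p q r s : ℕ} (θ : ARMAGARCHParam p q r s) (y : ℤ → ℝ) (t : ℤ) : ℝ :=
  Real.log (√(condScale θ y t)) + |armaResidual θ.1 y t| / √(condScale θ y t)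

/-- The weight `w_t = w(y_{t-1}, y_{t-2}, …)`. -/
def weightAt (w : (ℕ → ℝ) → ℝ) (y : ℤ → ℝ) (t : ℤ) : ℝ :=
  w (fun i : ℕ => y (t - 1 - i))

/-- `L_{sn}(θ) = (1/n) ∑_{t=1}^n w_t l_t(θ)`. -/
def quasiLik {p q r s : ℕ} (w : (ℕ → ℝ) → ℝ) (n : ℕ) (y : ℤ → ℝ)
    (θ : ARMAGARCHParam p q r s) : ℝ :=
  (1 / (n : ℝ)) * ∑ t ∈ Finset.Icc 1 n, weightAt w y t * laplaceLoss θ y t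

/-- `θhat` minimises `L_{sn}` over the parameter space `Θ`. -/
def IsQMELE {p q r s : ℕ} (w : (ℕ → ℝ) → ℝ) (n : ℕ) (y : ℤ → ℝ)
    (Θ : Set (ARMAGARCHParam p q r s)) (θhat : ARMAGARCHParam p q r s) : Prop :=
  θhat ∈ Θ ∧ ∀ θ ∈ Θ, quasiLik w n y θhat ≤ quasiLik w n y θ

/-- `ξ_{ρt} = 1 + ∑_{i ≥ 0} ρ^i |y_{t-i}|`, with values in `[0, ∞]`. -/
def xiEnvelope (ρ : ℝ) (y : ℤ → ℝ) (t : ℤ) : ENNReal :=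
  1 + ∑' i : ℕ, ENNReal.ofReal (ρ ^ i * |y (t - i)|)

section Model

variable {Ω : Type*} [MeasurableSpace Ω]

/-- `F_t = σ(η_k : k ≤ t)`. -/
abbrev pastSigma (η : ℤ → Ω → ℝ) (t : ℤ) : MeasurableSpace Ω :=
  ⨆ (k : ℤ) (_ : k ≤ t), MeasurableSpace.comap (η k) inferInstance

/-- Strict stationarity: the law of the whole process is invariant under time shifts. -/
def IsStrictlyStationary {E : Type*} [MeasurableSpace E] (X : ℤ → Ω → E) (P : Measure Ω) : Prop :=
  ∀ k : ℤ, IdentDistrib (fun ω t => X (t + k) ω) (fun ω t => X t ω) P P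

/-- `(η_t)` is a sequence of i.i.d. real random variables. -/
structure IsIIDSequence (η : ℤ → Ω → ℝ) (P : Measure Ω) : Prop where
  measurable : ∀ t, Measurable (η t)
  indep : iIndepFun η P
  identDistrib : ∀ t, IdentDistrib (η t) (η 0) P P

/-- `(y_t, ε_t, h_t)` is a strictly stationary causal solution of the ARMA--GARCH equations with
parameter `θ` and innovations `η`. -/
structure IsARMAGARCH {p q r s : ℕ} (θ : ARMAGARCHParam p q r s) (η y ε h : ℤ → Ω → ℝ)
    (P : Measure Ω) : Prop where
  arma_eq : ∀ t, ∀ᵐ ω ∂P, y t ω = θ.1.mu + ∑ i : Fin p, θ.1.ar i * y (t - ((i : ℤ) + 1)) ω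
    + ∑ i : Fin q, θ.1.ma i * ε (t - ((i : ℤ) + 1)) ω + ε t ω
  error_eq : ∀ t, ∀ᵐ ω ∂P, ε t ω = η t ω * √(h t ω)
  scale_nonneg : ∀ t, ∀ᵐ ω ∂P, 0 ≤ h t ω
  scale_eq : ∀ t, ∀ᵐ ω ∂P, h t ω = θ.2.const
    + ∑ i : Fin r, θ.2.arch i * ε (t - ((i : ℤ) + 1)) ω ^ 2
    + ∑ i : Fin s, θ.2.garch i * h (t - ((i : ℤ) + 1)) ω
  stationary : IsStrictlyStationary (fun t ω => (y t ω, ε t ω, h t ω)) P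
  causal_obs : ∀ t, AEStronglyMeasurable[pastSigma η t] (y t) P
  causal_scale : ∀ t, AEStronglyMeasurable[pastSigma η (t - 1)] (h t) P

/-- Zero is a median of `X`. -/
def HasMedianZero (X : Ω → ℝ) (P : Measure Ω) : Prop :=
  1 / 2 ≤ P.real {ω | X ω ≤ 0} ∧ 1 / 2 ≤ P.real {ω | 0 ≤ X ω}

/-- `X` is almost surely equal to a constant. -/
def IsDegenerate (X : Ω → ℝ) (P : Measure Ω) : Prop :=
  ∃ c : ℝ, ∀ᵐ ω ∂P, X ω = c

end Model

/-! The residuals and conditional scales satisfy their defining recursions whenever the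
filters converge. -/

theorem causalFilter_inv_eq {d : ℕ} (c : Fin d → ℝ) (Q : Polynomial ℝ) (hQ : Q = 1 + lagPoly c)
    (u : ℤ → ℝ)
    (hu : ∀ t, Summable fun k : ℕ => PowerSeries.coeff k (Q : PowerSeries ℝ)⁻¹ * u (t - k))
    (t : ℤ) :
    causalFilter (Q : PowerSeries ℝ)⁻¹ u t
      = u t - ∑ i : Fin d, c i * causalFilter (Q : PowerSeries ℝ)⁻¹ u (t - ((i : ℤ) + 1)) := by
  set A : PowerSeries ℝ := (Q : PowerSeries ℝ) with hA
  have hA' : A = 1 + ∑ i : Fin d, PowerSeries.C (c i) * PowerSeries.X ^ ((i : ℕ) + 1) := by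
    rw [hA, hQ, lagPoly, ← Polynomial.coeToPowerSeries.ringHom_apply]
    simp only [map_add, map_one, map_sum, map_mul, map_pow,
      Polynomial.coeToPowerSeries.ringHom_apply, Polynomial.coe_C, Polynomial.coe_X]
  have hA0 : PowerSeries.constantCoeff A ≠ 0 := by
    rw [hA']; simp
  have hmul : A * A⁻¹ = 1 := PowerSeries.mul_inv_cancel A hA0
  have hcoef : ∀ n : ℕ, PowerSeries.coeff n A⁻¹ + ∑ i : Fin d, c i *
      (if (i : ℕ) + 1 ≤ n then PowerSeries.coeff (n - ((i : ℕ) + 1)) A⁻¹ else 0)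
      = if n = 0 then 1 else 0 := by
    intro n
    have h1 := congrArg (PowerSeries.coeff n) hmul
    rw [PowerSeries.coeff_one] at h1
    rw [← h1]
    have h2 : A * A⁻¹ = (1 + ∑ i : Fin d, PowerSeries.C (c i) * PowerSeries.X ^ ((i : ℕ) + 1)) * A⁻¹ :=
      congrArg (· * A⁻¹) hA'
    rw [h2]
    simp only [add_mul, one_mul, Finset.sum_mul, map_add, map_sum, mul_assoc,
      PowerSeries.coeff_C_mul, PowerSeries.coeff_X_pow_mul']
  have hshift : ∀ i : Fin d, HasSum (fun n : ℕ =>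
      (if (i : ℕ) + 1 ≤ n then PowerSeries.coeff (n - ((i : ℕ) + 1)) A⁻¹ else 0) * u (t - n))
      (causalFilter A⁻¹ u (t - ((i : ℤ) + 1))) := by
    intro i
    have h2 := (hu (t - ((i : ℤ) + 1))).hasSum
    rw [← hasSum_nat_add_iff' ((i : ℕ) + 1)]
    rw [Finset.sum_eq_zero, sub_zero]
    · refine h2.congr_fun ?_
      intro k
      have : t - ((k + ((i : ℕ) + 1) : ℕ) : ℤ) = t - ((i : ℤ) + 1) - k := by push_cast; ring
      simp only [this]
      simp
    · intro n hn
      have : ¬ ((i : ℕ) + 1 ≤ n) := by simpa using hn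
      simp [this]
  have htot := (hu t).hasSum.add (hasSum_sum fun i (_ : i ∈ Finset.univ) => (hshift i).mul_left (c i))
  have hone : HasSum (fun n : ℕ => (if n = 0 then (1 : ℝ) else 0) * u (t - n)) (u t) := by
    have := hasSum_single (f := fun n : ℕ => (if n = 0 then (1 : ℝ) else 0) * u (t - n)) 0
      (fun n hn => by simp [hn])
    simpa using this
  have hEq := htot.unique (hone.congr_fun fun n => by
    rw [← hcoef n, add_mul, Finset.sum_mul]
    simp only [mul_assoc])
  have : causalFilter A⁻¹ u t = ∑' k : ℕ, PowerSeries.coeff k A⁻¹ * u (t - k) := rfl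
  rw [this]
  linarith

theorem armaResidual_eq {p q : ℕ} (γ : ARMAParam p q) (y : ℤ → ℝ)
    (hy : ∀ t, Summable fun k : ℕ => PowerSeries.coeff k (γ.maPoly : PowerSeries ℝ)⁻¹ *
      (y (t - k) - γ.mu - ∑ i : Fin p, γ.ar i * y (t - k - ((i : ℤ) + 1)))) (t : ℤ) :
    armaResidual γ y t = y t - γ.mu - ∑ i : Fin p, γ.ar i * y (t - ((i : ℤ) + 1))
      - ∑ i : Fin q, γ.ma i * armaResidual γ y (t - ((i : ℤ) + 1)) := by
  have key := causalFilter_inv_eq γ.ma γ.maPoly rfl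
    (fun u => y u - γ.mu - ∑ i : Fin p, γ.ar i * y (u - ((i : ℤ) + 1))) hy t
  exact key

theorem condScale_eq {p q r s : ℕ} (θ : ARMAGARCHParam p q r s) (y : ℤ → ℝ)
    (hy : ∀ t, Summable fun k : ℕ => PowerSeries.coeff k (θ.2.garchPoly : PowerSeries ℝ)⁻¹ *
      (θ.2.const + ∑ i : Fin r, θ.2.arch i * armaResidual θ.1 y (t - k - ((i : ℤ) + 1)) ^ 2)) (t : ℤ) :
    condScale θ y t = θ.2.const
      + ∑ i : Fin r, θ.2.arch i * armaResidual θ.1 y (t - ((i : ℤ) + 1)) ^ 2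
      + ∑ i : Fin s, θ.2.garch i * condScale θ y (t - ((i : ℤ) + 1)) := by
  have hpoly : θ.2.garchPoly = 1 + lagPoly (fun i => -θ.2.garch i) := by
    simp [GARCHParam.garchPoly, lagPoly, sub_eq_add_neg]
  have key := causalFilter_inv_eq (fun i => -θ.2.garch i) θ.2.garchPoly hpoly
    (fun u => θ.2.const + ∑ i : Fin r, θ.2.arch i * armaResidual θ.1 y (u - ((i : ℤ) + 1)) ^ 2) hy t
  simp only [neg_mul, Finset.sum_neg_distrib, sub_neg_eq_add] at key
  exact key

end

/-!
Strong consistency of the self-weighted quasi-maximum exponential likelihood estimator is an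
instance of Wald's argument. The loss `w_t l_t(θ)` is a continuous function of `θ` on the compact
parameter set and is bounded below, because the weights are bounded and `h_t(θ) ≥ α₀` stays away
from zero. If its averages obey the strong law of large numbers, and if its expectation has a strict
minimum at `θ₀`, then minimisers of the averages converge to `θ₀` (`tendsto_argmin`).

*Strong law.* Causality makes every functional of the observations a functional of the i.i.d.
innovations, so the strong law is the ergodic theorem for an i.i.d. shift. It is proved directly: for
a function of finitely many innovations the average splits into averages of independent identically
distributed terms along residue classes, and a maximal inequality extends the convergence to all
integrable functions (`tendsto_birkhoffSum_of_iid`).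

*Regularity.* The coefficients of `ψ⁻¹` and `β⁻¹` decay geometrically, uniformly on compact parameter
sets (`exists_abs_invCoeff_le`). On paths that grow subexponentially into the past (`Tempered`),
which almost all paths do by the moment condition on the weights, the residuals and scales converge,
are continuous in `θ`, and are dominated by the envelope `ξ_ρ`. A stationary solution of a
homogeneous recursion with no roots in the closed disc vanishes
(`stationary_homogeneous_eq_zero`), so at `θ₀` the filters return the true errors and scales.

*Strict minimum.* Given the past, the residual at `θ` is `η_t √h_t + D_t(γ)`. Since `0` is a median
of `η_t` and `E|η_t| = 1`, its conditional absolute mean is at least `√h_t`, and `log σ + τ / σ ≥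
log τ + 1` shows that the conditional expected loss is minimal at `θ₀`
(`ShiftModel.lintegral_loss_lt`). Equality forces `h_t(θ) = h_t` almost surely. Read as a relation
in the most recent innovation, this is a quadratic identity. Either `D_t` vanishes, or the
innovation takes two values only and the scale obeys a multiplicative recursion that no stationary
positive process can satisfy; here `α₁ > 0` at the interior point `θ₀` enters. Once `D_t = 0`, the
lag polynomials of `θ` and of `θ₀` relate the same observed and driving sequences. No driving term
is a function of its own past, so cross-multiplied lag polynomials agree (`lag_polynomials_unique`),
and coprimality gives `θ = θ₀` (`ShiftModel.eq_of_scale_eq`).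

*Path space.* The argument needs a measure-preserving shift, which the given probability space need
not carry. Everything is therefore transferred to the law of `(y_t, ε_t, h_t)` on sequence space,
where the innovation is recovered as `ε_t / √h_t` (`IsARMAGARCH.shiftModel`).
-/

/-! ### Coefficients of inverse lag polynomials -/

theorem coeff_zero_lagPoly {d : ℕ} (c : Fin d → ℝ) : (lagPoly c).coeff 0 = 0 := by
  simp [lagPoly]

theorem coeff_succ_lagPoly {d : ℕ} (c : Fin d → ℝ) (i : Fin d) :
    (lagPoly c).coeff ((i : ℕ) + 1) = c i := by
  simp only [lagPoly, Polynomial.finsetSum_coeff, Polynomial.coeff_C_mul_X_pow]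
  rw [Finset.sum_eq_single i]
  · simp
  · intro b _ hb
    have : (i : ℕ) ≠ b := fun h => hb (Fin.ext h.symm)
    simp [this]
  · simp

theorem lagPoly_injective {d : ℕ} : Function.Injective (lagPoly (d := d)) := by
  intro c c' h
  funext i
  rw [← coeff_succ_lagPoly c i, h, coeff_succ_lagPoly]

theorem natDegree_lagPoly_le {d : ℕ} (c : Fin d → ℝ) : (lagPoly c).natDegree ≤ d := by
  refine Polynomial.natDegree_sum_le_of_forall_le _ _ fun i _ => ?_
  exact (Polynomial.natDegree_C_mul_X_pow_le _ _).trans i.2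

theorem lagPoly_neg {d : ℕ} (c : Fin d → ℝ) : lagPoly (-c) = -lagPoly c := by
  simp [lagPoly]

theorem aeval_lagPoly {d : ℕ} (c : Fin d → ℝ) (z : ℂ) :
    Polynomial.aeval z (lagPoly c) = ∑ i, (c i : ℂ) * z ^ ((i : ℕ) + 1) := by
  simp [lagPoly, map_sum]

theorem GARCHParam.garchPoly_eq {r s : ℕ} (δ : GARCHParam r s) :
    δ.garchPoly = 1 + lagPoly (-δ.garch) := by
  rw [GARCHParam.garchPoly, lagPoly_neg, sub_eq_add_neg]

/-- The coefficient of `z ^ k` in the power series `(1 + ∑ c_i z^i)⁻¹`. -/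
noncomputable def invCoeff {d : ℕ} (c : Fin d → ℝ) (k : ℕ) : ℝ :=
  PowerSeries.coeff k ((1 + lagPoly c : Polynomial ℝ) : PowerSeries ℝ)⁻¹

theorem coe_one_add_lagPoly {d : ℕ} (c : Fin d → ℝ) :
    ((1 + lagPoly c : Polynomial ℝ) : PowerSeries ℝ)
      = 1 + ∑ i : Fin d, PowerSeries.C (c i) * PowerSeries.X ^ ((i : ℕ) + 1) := by
  rw [lagPoly, ← Polynomial.coeToPowerSeries.ringHom_apply]
  simp only [map_add, map_one, map_sum, map_mul, map_pow,
      Polynomial.coeToPowerSeries.ringHom_apply, Polynomial.coe_C, Polynomial.coe_X]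

theorem constantCoeff_one_add_lagPoly {d : ℕ} (c : Fin d → ℝ) :
    PowerSeries.constantCoeff ((1 + lagPoly c : Polynomial ℝ) : PowerSeries ℝ) = 1 := by
  rw [coe_one_add_lagPoly]; simp

theorem invCoeff_eq {d : ℕ} (c : Fin d → ℝ) (n : ℕ) :
    invCoeff c n = (if n = 0 then 1 else 0) - ∑ i : Fin d, c i *
      (if (i : ℕ) + 1 ≤ n then invCoeff c (n - ((i : ℕ) + 1)) else 0) := by
  have h := PowerSeries.mul_inv_cancel ((1 + lagPoly c : Polynomial ℝ) : PowerSeries ℝ)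
    (by rw [constantCoeff_one_add_lagPoly]; exact one_ne_zero)
  have h1 := congrArg (PowerSeries.coeff n) h
  rw [PowerSeries.coeff_one] at h1
  rw [← h1, invCoeff]
  nth_rewrite 2 [coe_one_add_lagPoly]
  simp only [add_mul, one_mul, Finset.sum_mul, map_add, map_sum, mul_assoc,
      PowerSeries.coeff_C_mul, PowerSeries.coeff_X_pow_mul', invCoeff]
  ring

theorem invCoeff_zero {d : ℕ} (c : Fin d → ℝ) : invCoeff c 0 = 1 := by
  rw [invCoeff_eq]; simp

theorem continuous_invCoeff {d : ℕ} (k : ℕ) : Continuous fun c : Fin d → ℝ => invCoeff c k := by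
  induction k using Nat.strong_induction_on with
  | _ n ih =>
    have : (fun c : Fin d → ℝ => invCoeff c n) = fun c => (if n = 0 then 1 else 0) -
        ∑ i : Fin d, c i * (if (i : ℕ) + 1 ≤ n then invCoeff c (n - ((i : ℕ) + 1)) else 0) :=
      funext fun c => invCoeff_eq c n
    rw [this]
    refine continuous_const.sub (continuous_finsetSum _ fun i _ => (continuous_apply i).mul ?_)
    split_ifs with h
    · exact ih _ (by omega)
    · exact continuous_const

theorem invCoeff_nonneg {d : ℕ} {c : Fin d → ℝ} (hc : ∀ i, c i ≤ 0) (k : ℕ) :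
    0 ≤ invCoeff c k := by
  induction k using Nat.strong_induction_on with
  | _ n ih =>
    rw [invCoeff_eq, sub_nonneg]
    refine (Finset.sum_nonpos fun i _ => mul_nonpos_of_nonpos_of_nonneg (hc i) ?_).trans ?_
    · split_ifs with h
      · exact ih _ (by omega)
      · exact le_rfl
    · split_ifs <;> norm_num

/-- A polynomial with constant term `1`, whose roots `z` all satisfy `ρ ‖z‖ ≥ 1`, has an inverse
power series with coefficients `O(k^n ρ^k)`. The linear factors are split off one at a time. -/
theorem norm_coeff_inv_le {ρ : ℝ} (hρ : 0 ≤ ρ) (n : ℕ) : ∀ A : Polynomial ℂ, A.natDegree ≤ n →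
    A.coeff 0 = 1 → (∀ z, A.IsRoot z → 1 ≤ ρ * ‖z‖) → ∀ k : ℕ,
    ‖PowerSeries.coeff k (A : PowerSeries ℂ)⁻¹‖ ≤ ((k : ℝ) + 1) ^ n * ρ ^ k := by
  have hconst : ∀ (m : ℕ) (A : Polynomial ℂ), A.natDegree = 0 → A.coeff 0 = 1 → ∀ k : ℕ,
      ‖PowerSeries.coeff k (A : PowerSeries ℂ)⁻¹‖ ≤ ((k : ℝ) + 1) ^ m * ρ ^ k := by
    intro m A hd h0 k
    rw [Polynomial.eq_C_of_natDegree_eq_zero hd, h0]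
    have h1 : ((Polynomial.C (1 : ℂ) : Polynomial ℂ) : PowerSeries ℂ)⁻¹ = 1 := by
      rw [PowerSeries.inv_eq_iff_mul_eq_one] <;> simp
    rw [h1, PowerSeries.coeff_one]
    split_ifs with hk
    · subst hk; simp
    · rw [norm_zero]; positivity
  induction n with
  | zero => exact fun A hd h0 _ => hconst 0 A (by omega) h0
  | succ n ih =>
    intro A hd h0 hroot
    by_cases hdeg : A.natDegree = 0
    · exact hconst _ A hdeg h0
    obtain ⟨z, hz⟩ := IsAlgClosed.exists_root A (by
      intro h; exact hdeg (Polynomial.natDegree_eq_of_degree_eq_some h))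
    have hz1 := hroot z hz
    have hz0 : z ≠ 0 := by
      rintro rfl; simp at hz1; linarith
    obtain ⟨Q, hQ⟩ := Polynomial.dvd_iff_isRoot.2 hz
    set A' : Polynomial ℂ := Polynomial.C (-z) * Q with hA'
    have hAA' : A = (1 - Polynomial.C z⁻¹ * Polynomial.X) * A' := by
      have hc : (Polynomial.C z⁻¹ : Polynomial ℂ) * Polynomial.C z = 1 := by
        rw [← Polynomial.C_mul, inv_mul_cancel₀ hz0, Polynomial.C_1]
      rw [hQ, hA', Polynomial.C_neg]
      linear_combination (-Polynomial.X * Q) * hc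
    have hA0 : A'.coeff 0 = 1 := by
      have := h0
      rw [hAA', Polynomial.mul_coeff_zero] at this
      simpa using this
    have hQ0 : Q ≠ 0 := by
      rintro rfl; simp [hA'] at hA0
    have hdA' : A'.natDegree ≤ n := by
      have h1 : A.natDegree = 1 + Q.natDegree := by
        rw [hQ, Polynomial.natDegree_mul (Polynomial.X_sub_C_ne_zero z) hQ0,
          Polynomial.natDegree_X_sub_C]
      have h2 : A'.natDegree ≤ Q.natDegree := Polynomial.natDegree_C_mul_le _ _
      omega
    have hb' := ih A' hdA' hA0 fun x hx => hroot x (by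
      rw [hAA', Polynomial.IsRoot, Polynomial.eval_mul, hx.eq_zero, mul_zero])
    have hcA : PowerSeries.constantCoeff (A : PowerSeries ℂ) ≠ 0 := by
      rw [← PowerSeries.coeff_zero_eq_constantCoeff_apply, Polynomial.coeff_coe, h0]
      exact one_ne_zero
    have hcA' : PowerSeries.constantCoeff (A' : PowerSeries ℂ) ≠ 0 := by
      rw [← PowerSeries.coeff_zero_eq_constantCoeff_apply, Polynomial.coeff_coe, hA0]
      exact one_ne_zero
    have hrec : (1 - PowerSeries.C z⁻¹ * PowerSeries.X) * (A : PowerSeries ℂ)⁻¹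
        = (A' : PowerSeries ℂ)⁻¹ := by
      symm
      rw [PowerSeries.inv_eq_iff_mul_eq_one hcA']
      have hcoe : (A : PowerSeries ℂ)
          = (1 - PowerSeries.C z⁻¹ * PowerSeries.X) * (A' : PowerSeries ℂ) := by
        conv_lhs => rw [hAA']
        rw [Polynomial.coe_mul, Polynomial.coe_sub, Polynomial.coe_mul, Polynomial.coe_one,
          Polynomial.coe_C, Polynomial.coe_X]
      calc _ = ((1 - PowerSeries.C z⁻¹ * PowerSeries.X) * (A' : PowerSeries ℂ))
              * (A : PowerSeries ℂ)⁻¹ := by ring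
        _ = 1 := by rw [← hcoe, PowerSeries.mul_inv_cancel _ hcA]
    have hzn : ‖z⁻¹‖ ≤ ρ := by
      rw [norm_inv, inv_le_iff_one_le_mul₀ (norm_pos_iff.2 hz0)]; exact hz1
    intro k
    induction k with
    | zero =>
      have := hb' 0
      rw [← hrec, sub_mul, one_mul, map_sub, mul_assoc, PowerSeries.coeff_C_mul,
        PowerSeries.coeff_zero_X_mul, mul_zero, sub_zero] at this
      simpa using this
    | succ k ihk =>
      have h1 := hb' (k + 1)
      rw [← hrec, sub_mul, one_mul, map_sub, mul_assoc, PowerSeries.coeff_C_mul,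
        PowerSeries.coeff_succ_X_mul] at h1
      set b1 := PowerSeries.coeff (k + 1) (A : PowerSeries ℂ)⁻¹
      set b0 := PowerSeries.coeff k (A : PowerSeries ℂ)⁻¹
      have h2 : ‖b1‖ ≤ ‖b1 - z⁻¹ * b0‖ + ‖z⁻¹ * b0‖ := by
        simpa using norm_add_le (b1 - z⁻¹ * b0) (z⁻¹ * b0)
      have h3 : ‖z⁻¹ * b0‖ ≤ ρ * (((k : ℝ) + 1) ^ (n + 1) * ρ ^ k) := by
        rw [norm_mul]; exact mul_le_mul hzn ihk (norm_nonneg _) hρ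
      have h4 : ((k : ℝ) + 1) ^ (n + 1) ≤ ((k : ℝ) + 1) * ((k + 1 : ℕ) + 1 : ℝ) ^ n := by
        rw [pow_succ']; push_cast; gcongr; linarith
      calc ‖b1‖ ≤ ((k + 1 : ℕ) + 1 : ℝ) ^ n * ρ ^ (k + 1)
            + ρ * (((k : ℝ) + 1) ^ (n + 1) * ρ ^ k) := h2.trans (add_le_add h1 h3)
        _ ≤ ((k + 1 : ℕ) + 1 : ℝ) ^ n * ρ ^ (k + 1)
            + ρ * ((((k : ℝ) + 1) * ((k + 1 : ℕ) + 1 : ℝ) ^ n) * ρ ^ k) := by gcongr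
        _ = ((k + 1 : ℕ) + 1 : ℝ) ^ (n + 1) * ρ ^ (k + 1) := by push_cast; ring

theorem abs_invCoeff_le {d : ℕ} (c : Fin d → ℝ) {ρ : ℝ} (hρ : 0 ≤ ρ)
    (hroot : ∀ z : ℂ, Polynomial.aeval z (1 + lagPoly c) = 0 → 1 ≤ ρ * ‖z‖) (k : ℕ) :
    |invCoeff c k| ≤ ((k : ℝ) + 1) ^ d * ρ ^ k := by
  set Q : Polynomial ℝ := 1 + lagPoly c with hQ
  set A : Polynomial ℂ := Q.map (algebraMap ℝ ℂ) with hA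
  have hQd : Q.natDegree ≤ d := by
    refine (Polynomial.natDegree_add_le _ _).trans ?_
    simp [natDegree_lagPoly_le c]
  have hA0 : A.coeff 0 = 1 := by
    rw [hA, Polynomial.coeff_map, hQ, Polynomial.coeff_add, coeff_zero_lagPoly]; simp
  have h := norm_coeff_inv_le hρ d A ((Polynomial.natDegree_map_le).trans hQd) hA0
    (fun z hz => hroot z (by
      rw [Polynomial.IsRoot, hA, Polynomial.eval_map_algebraMap] at hz; exact hz)) k
  have hmap : (A : PowerSeries ℂ)⁻¹
      = PowerSeries.map (algebraMap ℝ ℂ) ((Q : PowerSeries ℝ)⁻¹) := by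
    rw [PowerSeries.inv_eq_iff_mul_eq_one]
    · have : (A : PowerSeries ℂ) = PowerSeries.map (algebraMap ℝ ℂ) (Q : PowerSeries ℝ) := by
        ext n; simp [hA]
      rw [this, ← map_mul, PowerSeries.inv_mul_cancel, map_one]
      rw [constantCoeff_one_add_lagPoly]; exact one_ne_zero
    · rw [← PowerSeries.coeff_zero_eq_constantCoeff_apply, Polynomial.coeff_coe, hA0]
      exact one_ne_zero
  rw [hmap, PowerSeries.coeff_map] at h
  rw [invCoeff, ← hQ]
  simpa using h

/-- On a compact set of coefficient vectors whose polynomials have no zero in the closed unit disc,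
the coefficients of the inverse power series decay geometrically, uniformly. -/
theorem exists_abs_invCoeff_le {d : ℕ} {K : Set (Fin d → ℝ)} (hK : IsCompact K)
    (hroot : ∀ c ∈ K, ∀ z : ℂ, ‖z‖ ≤ 1 → Polynomial.aeval z (1 + lagPoly c) ≠ 0) :
    ∃ C ρ : ℝ, 0 < C ∧ 0 < ρ ∧ ρ < 1 ∧ ∀ c ∈ K, ∀ k, |invCoeff c k| ≤ C * ρ ^ k := by
  -- the roots stay uniformly away from the closed unit disc
  obtain ⟨R, hR1, hR⟩ : ∃ R : ℝ, 1 < R ∧ ∀ c ∈ K, ∀ z : ℂ,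
      Polynomial.aeval z (1 + lagPoly c) = 0 → R ≤ ‖z‖ := by
    set Z : Set ((Fin d → ℝ) × ℂ) := (K ×ˢ Metric.closedBall (0 : ℂ) 2) ∩
      {x | Polynomial.aeval x.2 (1 + lagPoly x.1) = 0} with hZ
    have hZc : IsCompact Z := by
      refine (hK.prod (isCompact_closedBall _ _)).inter_right ?_
      simp only [map_add, map_one, aeval_lagPoly]
      exact isClosed_eq (by fun_prop) continuous_const
    by_cases hne : Z.Nonempty
    · obtain ⟨x, hx, hmin⟩ := hZc.exists_isMinOn hne (f := fun x => ‖x.2‖) (by fun_prop)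
      have hx1 : 1 < ‖x.2‖ := by
        by_contra! hle
        exact hroot x.1 hx.1.1 x.2 hle hx.2
      refine ⟨‖x.2‖, hx1, fun c hc z hz => ?_⟩
      have hx2 : ‖x.2‖ ≤ 2 := by simpa using hx.1.2
      by_cases hz2 : ‖z‖ ≤ 2
      · exact hmin (show (c, z) ∈ Z from ⟨⟨hc, by simpa using hz2⟩, hz⟩)
      · linarith
    · refine ⟨2, by norm_num, fun c hc z hz => ?_⟩
      by_contra! hlt
      exact hne ⟨(c, z), ⟨hc, by simpa using hlt.le⟩, hz⟩
  have hRi : R⁻¹ < 1 := inv_lt_one_of_one_lt₀ hR1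
  have hR0 : 0 < R⁻¹ := by positivity
  obtain ⟨ρ, hρ1, hρ2⟩ := exists_between hRi
  have hρ0 : 0 < ρ := hR0.trans hρ1
  have hlim : Tendsto (fun k : ℕ => ((k : ℝ) + 1) ^ d * (R⁻¹ / ρ) ^ k) atTop (𝓝 0) := by
    have hq : |R⁻¹ / ρ| < 1 := by
      rw [abs_of_pos (by positivity), div_lt_one hρ0]; exact hρ1
    have h1 := (tendsto_pow_const_mul_const_pow_of_abs_lt_one d hq).comp (tendsto_add_atTop_nat 1)
    have h2 := h1.mul_const (R⁻¹ / ρ)⁻¹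
    rw [zero_mul] at h2
    refine h2.congr fun k => ?_
    simp only [Function.comp, pow_succ]
    push_cast
    field_simp
  obtain ⟨C, hC⟩ := hlim.bddAbove_range
  have hC' : ∀ k : ℕ, ((k : ℝ) + 1) ^ d * (R⁻¹ / ρ) ^ k ≤ C := fun k => hC ⟨k, rfl⟩
  have hCpos : 0 < C := by
    have := hC' 0
    simp at this; linarith
  refine ⟨C, ρ, hCpos, hρ0, hρ2, fun c hc k => ?_⟩
  refine (abs_invCoeff_le c hR0.le (fun z hz => ?_) k).trans ?_
  · have := hR c hc z hz
    rw [inv_mul_eq_div, le_div_iff₀ (by positivity)]; linarith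
  · have := mul_le_mul_of_nonneg_right (hC' k) (pow_nonneg hρ0.le k)
    rwa [mul_assoc, ← mul_pow, div_mul_cancel₀ _ hρ0.ne'] at this

/-! ### Residuals and conditional scales of a tempered path -/

/-- The past of the path grows subexponentially, in the summed form that makes all filters with
geometrically decaying coefficients converge. -/
def Tempered (y : ℤ → ℝ) : Prop :=
  ∀ ρ : ℝ, 0 < ρ → ρ < 1 → ∀ t : ℤ, Summable fun i : ℕ => ρ ^ i * |y (t - i)|

/-- The real-valued version of `xiEnvelope`. -/
noncomputable def envelope (ρ : ℝ) (y : ℤ → ℝ) (t : ℤ) : ℝ := 1 + ∑' i : ℕ, ρ ^ i * |y (t - i)|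

theorem one_le_envelope {ρ : ℝ} (hρ : 0 ≤ ρ) (y : ℤ → ℝ) (t : ℤ) : 1 ≤ envelope ρ y t := by
  rw [envelope, le_add_iff_nonneg_right]
  exact tsum_nonneg fun i => by positivity

theorem Tempered.pow_mul_abs_le {y : ℤ → ℝ} (hy : Tempered y) {ρ : ℝ} (h0 : 0 < ρ) (h1 : ρ < 1)
    (t : ℤ) (k : ℕ) : ρ ^ k * |y (t - k)| ≤ envelope ρ y t := by
  have := (hy ρ h0 h1 t).le_tsum k fun i _ => by positivity
  rw [envelope]; linarith

theorem Tempered.pow_mul_envelope_le {y : ℤ → ℝ} (hy : Tempered y) {ρ : ℝ} (h0 : 0 < ρ)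
    (h1 : ρ < 1) (t : ℤ) (k : ℕ) : ρ ^ k * envelope ρ y (t - k) ≤ envelope ρ y t := by
  have hs := hy ρ h0 h1 t
  have h2 : ∑' i : ℕ, ρ ^ (i + k) * |y (t - (i + k : ℕ))| ≤ ∑' i : ℕ, ρ ^ i * |y (t - i)| := by
    rw [← hs.sum_add_tsum_nat_add k, le_add_iff_nonneg_left]
    exact Finset.sum_nonneg fun i _ => by positivity
  have h3 : ρ ^ k * ∑' i : ℕ, ρ ^ i * |y (t - k - i)|
      = ∑' i : ℕ, ρ ^ (i + k) * |y (t - (i + k : ℕ))| := by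
    rw [← tsum_mul_left]
    refine tsum_congr fun i => ?_
    rw [pow_add, show t - (i + k : ℕ) = t - k - i by push_cast; ring]; ring
  have h4 : ρ ^ k ≤ 1 := pow_le_one₀ h0.le h1.le
  rw [envelope, envelope, mul_add, h3]
  linarith

/-- The input `y_t - μ - ∑ φ_i y_{t-i}` of the residual filter. -/
noncomputable def armaInput {p q : ℕ} (γ : ARMAParam p q) (y : ℤ → ℝ) (u : ℤ) : ℝ :=
  y u - γ.mu - ∑ i : Fin p, γ.ar i * y (u - ((i : ℤ) + 1))

/-- The input `α₀ + ∑ α_i ε_{t-i}(γ)²` of the scale filter. -/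
noncomputable def garchInput {p q r s : ℕ} (θ : ARMAGARCHParam p q r s) (y : ℤ → ℝ) (u : ℤ) : ℝ :=
  θ.2.const + ∑ i : Fin r, θ.2.arch i * armaResidual θ.1 y (u - ((i : ℤ) + 1)) ^ 2

theorem armaResidual_eq_tsum {p q : ℕ} (γ : ARMAParam p q) (y : ℤ → ℝ) (t : ℤ) :
    armaResidual γ y t = ∑' k : ℕ, invCoeff γ.ma k * armaInput γ y (t - k) := rfl

theorem condScale_eq_tsum {p q r s : ℕ} (θ : ARMAGARCHParam p q r s) (y : ℤ → ℝ) (t : ℤ) :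
    condScale θ y t = ∑' k : ℕ, invCoeff (-θ.2.garch) k * garchInput θ y (t - k) := by
  simp only [condScale, causalFilter, GARCHParam.garchPoly_eq]
  rfl

theorem abs_mul_le_geometric {b v C M a σ : ℝ} {k : ℕ}
    (hb : |b| ≤ C * a ^ k) (hv : |v| ≤ M * (σ ^ k)⁻¹) : |b * v| ≤ C * M * (a / σ) ^ k := by
  rw [abs_mul, div_pow]
  calc |b| * |v| ≤ (C * a ^ k) * (M * (σ ^ k)⁻¹) :=
        mul_le_mul hb hv (abs_nonneg _) ((abs_nonneg _).trans hb)
    _ = _ := by rw [div_eq_mul_inv]; ring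

/-- A compact parameter set on which the moving-average and the GARCH polynomials are invertible. -/
structure InvertibleParams {p q r s : ℕ} (Θγ : Set (ARMAParam p q)) (Θδ : Set (GARCHParam r s)) :
    Prop where
  compact_arma : IsCompact Θγ
  compact_garch : IsCompact Θδ
  ma_ne_zero : ∀ γ ∈ Θγ, ∀ z : ℂ, ‖z‖ ≤ 1 → Polynomial.aeval z γ.maPoly ≠ 0
  positive : ∀ δ ∈ Θδ, δ.Positive
  garch_sum_lt_one : ∀ δ ∈ Θδ, ∑ j, δ.garch j < 1

theorem garchPoly_aeval_ne_zero {r s : ℕ} {δ : GARCHParam r s} (hδ : δ.Positive)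
    (hsum : ∑ j, δ.garch j < 1) (z : ℂ) (hz : ‖z‖ ≤ 1) :
    Polynomial.aeval z (1 + lagPoly (-δ.garch)) ≠ 0 := by
  intro h
  rw [map_add, map_one, lagPoly_neg, map_neg, aeval_lagPoly, add_neg_eq_zero] at h
  have h1 : ‖∑ i, (δ.garch i : ℂ) * z ^ ((i : ℕ) + 1)‖ ≤ ∑ j, δ.garch j := by
    refine norm_sum_le_of_le _ fun i _ => ?_
    rw [norm_mul, norm_pow, Complex.norm_real, Real.norm_of_nonneg (hδ.garch_nonneg i)]
    exact mul_le_of_le_one_right (hδ.garch_nonneg i) (pow_le_one₀ (norm_nonneg _) hz)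
  rw [← h, norm_one] at h1
  linarith

namespace InvertibleParams

variable {p q r s : ℕ} {Θγ : Set (ARMAParam p q)} {Θδ : Set (GARCHParam r s)}

theorem exists_ma_bound (H : InvertibleParams Θγ Θδ) :
    ∃ C ρ : ℝ, 0 < C ∧ 0 < ρ ∧ ρ < 1 ∧ ∀ γ ∈ Θγ, ∀ k, |invCoeff γ.ma k| ≤ C * ρ ^ k := by
  obtain ⟨C, ρ, hC, h0, h1, hb⟩ := exists_abs_invCoeff_le
    (H.compact_arma.image (f := fun γ : ARMAParam p q => γ.ma) (by fun_prop)) (by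
      rintro _ ⟨γ, hγ, rfl⟩ z hz
      exact H.ma_ne_zero γ hγ z hz)
  exact ⟨C, ρ, hC, h0, h1, fun γ hγ k => hb _ ⟨γ, hγ, rfl⟩ k⟩

theorem exists_garch_bound (H : InvertibleParams Θγ Θδ) :
    ∃ C ρ : ℝ, 0 < C ∧ 0 < ρ ∧ ρ < 1 ∧ ∀ δ ∈ Θδ, ∀ k, |invCoeff (-δ.garch) k| ≤ C * ρ ^ k := by
  obtain ⟨C, ρ, hC, h0, h1, hb⟩ := exists_abs_invCoeff_le
    (H.compact_garch.image (f := fun δ : GARCHParam r s => -δ.garch) (by fun_prop)) (by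
      rintro _ ⟨δ, hδ, rfl⟩ z hz
      exact garchPoly_aeval_ne_zero (H.positive δ hδ) (H.garch_sum_lt_one δ hδ) z hz)
  exact ⟨C, ρ, hC, h0, h1, fun γ hγ k => hb _ ⟨γ, hγ, rfl⟩ k⟩

theorem exists_armaInput_bound (H : InvertibleParams Θγ Θδ) {ρ : ℝ} (h0 : 0 < ρ) (h1 : ρ < 1) :
    ∃ M : ℝ, 0 < M ∧ ∀ γ ∈ Θγ, ∀ y, Tempered y → ∀ t (k : ℕ),
      |armaInput γ y (t - k)| ≤ M * envelope ρ y t * (ρ ^ k)⁻¹ := by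
  obtain ⟨B, hB⟩ := (H.compact_arma.image (f := fun γ : ARMAParam p q =>
    1 + |γ.mu| + ∑ i, |γ.ar i|) (by fun_prop)).bddAbove
  have hB' : ∀ γ ∈ Θγ, 1 + |γ.mu| + ∑ i, |γ.ar i| ≤ B := fun γ hγ => hB ⟨γ, hγ, rfl⟩
  refine ⟨max B 1 * (ρ ^ p)⁻¹, by positivity, fun γ hγ y hy t k => ?_⟩
  have hE := one_le_envelope h0.le y t
  have hpk : 0 < ρ ^ p := pow_pos h0 p
  have hkk : 0 < ρ ^ k := pow_pos h0 k
  have hp1 : 1 ≤ (ρ ^ p)⁻¹ := (one_le_inv₀ hpk).2 (pow_le_one₀ h0.le h1.le)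
  have hk1 : 1 ≤ (ρ ^ k)⁻¹ := (one_le_inv₀ hkk).2 (pow_le_one₀ h0.le h1.le)
  set E := envelope ρ y t
  -- `W` dominates every value of the path entering the input
  set W := E * (ρ ^ p)⁻¹ * (ρ ^ k)⁻¹ with hW
  have hW1 : 1 ≤ W := one_le_mul_of_one_le_of_one_le (one_le_mul_of_one_le_of_one_le hE hp1) hk1
  have hval : ∀ j ≤ p, |y (t - k - (j : ℤ))| ≤ W := by
    intro j hj
    have h2 := hy.pow_mul_abs_le h0 h1 t (k + j)
    rw [show t - ((k + j : ℕ) : ℤ) = t - k - j by push_cast; ring] at h2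
    have h3 : ρ ^ p * ρ ^ k ≤ ρ ^ (k + j) := by
      rw [← pow_add]; exact pow_le_pow_of_le_one h0.le h1.le (by omega)
    have h4 : ρ ^ p * ρ ^ k * |y (t - k - (j : ℤ))| ≤ E :=
      (mul_le_mul_of_nonneg_right h3 (abs_nonneg _)).trans h2
    rw [hW, mul_assoc, ← mul_inv, ← div_eq_mul_inv, le_div_iff₀ (by positivity)]
    linarith
  have hsum : |∑ i : Fin p, γ.ar i * y (t - k - ((i : ℤ) + 1))| ≤ (∑ i, |γ.ar i|) * W := by
    rw [Finset.sum_mul]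
    refine (Finset.abs_sum_le_sum_abs _ _).trans (Finset.sum_le_sum fun i _ => ?_)
    rw [abs_mul]
    have := hval (i + 1) i.2
    push_cast at this
    exact mul_le_mul_of_nonneg_left this (abs_nonneg _)
  have hy0 : |y (t - k)| ≤ W := by simpa using hval 0 (Nat.zero_le _)
  have hmu : |γ.mu| ≤ |γ.mu| * W := le_mul_of_one_le_right (abs_nonneg _) hW1
  have htri : |armaInput γ y (t - k)| ≤ |y (t - k)| + |γ.mu|
      + |∑ i : Fin p, γ.ar i * y (t - k - ((i : ℤ) + 1))| :=
    (abs_sub _ _).trans (add_le_add (abs_sub _ _) le_rfl)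
  calc |armaInput γ y (t - k)| ≤ (1 + |γ.mu| + ∑ i, |γ.ar i|) * W := by linarith
    _ ≤ max B 1 * W := by
        gcongr
        exact (hB' γ hγ).trans (le_max_left _ _)
    _ = _ := by rw [hW]; ring

/-- The residuals are dominated by the envelope, uniformly on the parameter set, and the defining
filters converge. -/
theorem exists_residual_bound (H : InvertibleParams Θγ Θδ) {ρ₁ : ℝ} (hρ₁ : ρ₁ < 1) :
    ∃ ρ C : ℝ, ρ₁ < ρ ∧ 0 < ρ ∧ ρ < 1 ∧ 0 < C ∧ ∃ u : ℕ → ℝ, Summable u ∧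
      (∀ γ ∈ Θγ, ∀ y, Tempered y → ∀ t (k : ℕ),
        |invCoeff γ.ma k * armaInput γ y (t - k)| ≤ u k * envelope ρ y t) ∧
      ∀ γ ∈ Θγ, ∀ y, Tempered y → ∀ t, |armaResidual γ y t| ≤ C * envelope ρ y t := by
  obtain ⟨C, a, hC, ha0, ha1, hb⟩ := H.exists_ma_bound
  obtain ⟨ρ, hρ, hρ1⟩ := exists_between (max_lt ha1 hρ₁)
  have haρ : a < ρ := (le_max_left _ _).trans_lt hρ
  have h0 : 0 < ρ := ha0.trans haρ
  obtain ⟨M, hM, hin⟩ := H.exists_armaInput_bound h0 hρ1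
  have hgeo := summable_geometric_of_lt_one (r := a / ρ) (by positivity) ((div_lt_one h0).2 haρ)
  have hpos : 0 < ∑' k : ℕ, C * M * (a / ρ) ^ k := by
    refine (hgeo.mul_left (C * M)).tsum_pos (fun k => by positivity) 0 (by simp; positivity)
  have hterm : ∀ γ ∈ Θγ, ∀ y, Tempered y → ∀ t (k : ℕ),
        |invCoeff γ.ma k * armaInput γ y (t - k)| ≤ C * M * (a / ρ) ^ k * envelope ρ y t := by
    intro γ hγ y hy t k
    have := abs_mul_le_geometric (hb γ hγ k) (hin γ hγ y hy t k)
    linarith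
  refine ⟨ρ, ∑' k : ℕ, C * M * (a / ρ) ^ k, (le_max_right _ _).trans_lt hρ, h0, hρ1, hpos, _,
    hgeo.mul_left (C * M), hterm, fun γ hγ y hy t => ?_⟩
  rw [armaResidual_eq_tsum, ← Real.norm_eq_abs, ← tsum_mul_right]
  exact tsum_of_norm_bounded ((hgeo.mul_left (C * M)).mul_right _).hasSum
    fun k => hterm γ hγ y hy t k

/-- Uniform domination of the residuals and of the conditional scales by the envelope. -/
theorem exists_scale_bound (H : InvertibleParams Θγ Θδ) :
    ∃ ρ C : ℝ, 0 < ρ ∧ ρ < 1 ∧ 0 < C ∧ (∃ u : ℕ → ℝ, Summable u ∧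
      ∀ γ ∈ Θγ, ∀ δ ∈ Θδ, ∀ y, Tempered y → ∀ t (k : ℕ),
        |invCoeff (-δ.garch) k * garchInput (γ, δ) y (t - k)| ≤ u k * envelope ρ y (t - 1) ^ 2) ∧
      (∀ γ ∈ Θγ, ∀ y, Tempered y → ∀ t, |armaResidual γ y t| ≤ C * envelope ρ y t) ∧
      ∀ γ ∈ Θγ, ∀ δ ∈ Θδ, ∀ y, Tempered y → ∀ t,
        |condScale (γ, δ) y t| ≤ C * envelope ρ y (t - 1) ^ 2 := by
  obtain ⟨C, a, hC, ha0, ha1, hb⟩ := H.exists_garch_bound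
  -- the residuals enter squared, hence the square root of the decay rate
  obtain ⟨ρ, A, haρ, h0, hρ1, hA, -, -, -, hres⟩ := H.exists_residual_bound
    (ρ₁ := √a) (by rw [Real.sqrt_lt' one_pos]; simpa using ha1)
  have haρ2 : a < ρ ^ 2 := (Real.sqrt_lt' h0).1 haρ
  obtain ⟨B, hB⟩ := (H.compact_garch.image (f := fun δ : GARCHParam r s =>
    δ.const + ∑ i, δ.arch i) (by fun_prop)).bddAbove
  have hB' : ∀ δ ∈ Θδ, δ.const + ∑ i, δ.arch i ≤ B := fun δ hδ => hB ⟨δ, hδ, rfl⟩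
  set D : ℝ := max B 1 * (max 1 A ^ 2 * (ρ ^ (2 * r))⁻¹) with hD
  have hDpos : 0 < D := by positivity
  have hin : ∀ γ ∈ Θγ, ∀ δ ∈ Θδ, ∀ y, Tempered y → ∀ t (k : ℕ),
      |garchInput (γ, δ) y (t - k)| ≤ D * envelope ρ y (t - 1) ^ 2 * ((ρ ^ 2) ^ k)⁻¹ := by
    intro γ hγ δ hδ y hy t k
    have hP := H.positive δ hδ
    have hE := one_le_envelope h0.le y (t - 1)
    set E := envelope ρ y (t - 1) with hEdef
    set V := max 1 A ^ 2 * (ρ ^ (2 * r))⁻¹ * E ^ 2 * ((ρ ^ 2) ^ k)⁻¹ with hV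
    have hi1 : 1 ≤ (ρ ^ (2 * r))⁻¹ := (one_le_inv₀ (by positivity)).2 (pow_le_one₀ h0.le hρ1.le)
    have hi2 : 1 ≤ ((ρ ^ 2) ^ k)⁻¹ := (one_le_inv₀ (by positivity)).2
      (pow_le_one₀ (by positivity) (pow_le_one₀ h0.le hρ1.le))
    have hV1 : 1 ≤ V := one_le_mul_of_one_le_of_one_le (one_le_mul_of_one_le_of_one_le
      (one_le_mul_of_one_le_of_one_le (one_le_pow₀ (le_max_left _ _)) hi1) (one_le_pow₀ hE)) hi2
    have hsq : ∀ i : Fin r, armaResidual γ y (t - k - ((i : ℤ) + 1)) ^ 2 ≤ V := by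
      intro i
      have h2 := hres γ hγ y hy (t - k - ((i : ℤ) + 1))
      have h3 := hy.pow_mul_envelope_le h0 hρ1 (t - 1) (k + i)
      rw [show t - 1 - ((k + i : ℕ) : ℤ) = t - k - ((i : ℤ) + 1) by push_cast; ring] at h3
      set e := envelope ρ y (t - k - ((i : ℤ) + 1))
      have he : 1 ≤ e := one_le_envelope h0.le _ _
      have h4 : ρ ^ r * ρ ^ k * e ≤ E := by
        refine le_trans (mul_le_mul_of_nonneg_right ?_ (by positivity)) h3
        rw [← pow_add]; exact pow_le_pow_of_le_one h0.le hρ1.le (by omega)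
      have h5 : e ≤ E * (ρ ^ r * ρ ^ k)⁻¹ := by
        rw [← div_eq_mul_inv, le_div_iff₀ (by positivity)]; linarith
      have h6 : |armaResidual γ y (t - k - ((i : ℤ) + 1))|
          ≤ max 1 A * (E * (ρ ^ r * ρ ^ k)⁻¹) := by
        refine h2.trans ?_
        gcongr
        exact le_max_right _ _
      rw [← sq_abs]
      refine (pow_le_pow_left₀ (abs_nonneg _) h6 2).trans_eq ?_
      rw [hV, mul_pow, mul_pow, inv_pow, mul_pow, ← pow_mul, ← pow_mul, ← pow_mul, mul_inv,
        mul_comm r 2, mul_comm k 2]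
      ring
    have hnn : 0 ≤ garchInput (γ, δ) y (t - k) :=
      add_nonneg hP.const_pos.le (Finset.sum_nonneg fun i _ =>
        mul_nonneg (hP.arch_nonneg i) (sq_nonneg _))
    rw [abs_of_nonneg hnn]
    have hsum : ∑ i : Fin r, δ.arch i * armaResidual γ y (t - k - ((i : ℤ) + 1)) ^ 2
        ≤ (∑ i, δ.arch i) * V := by
      rw [Finset.sum_mul]
      exact Finset.sum_le_sum fun i _ => mul_le_mul_of_nonneg_left (hsq i) (hP.arch_nonneg i)
    have hc : δ.const ≤ δ.const * V := le_mul_of_one_le_right hP.const_pos.le hV1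
    calc garchInput (γ, δ) y (t - k) ≤ (δ.const + ∑ i, δ.arch i) * V := by
          simp only [garchInput]; linarith
      _ ≤ max B 1 * V := by
          gcongr
          exact (hB' δ hδ).trans (le_max_left _ _)
      _ = _ := by rw [hV, hD]; ring
  have hgeo := summable_geometric_of_lt_one (r := a / ρ ^ 2) (by positivity)
    ((div_lt_one (by positivity)).2 haρ2)
  have hterm : ∀ γ ∈ Θγ, ∀ δ ∈ Θδ, ∀ y, Tempered y → ∀ t (k : ℕ),
      |invCoeff (-δ.garch) k * garchInput (γ, δ) y (t - k)|
        ≤ C * D * (a / ρ ^ 2) ^ k * envelope ρ y (t - 1) ^ 2 := by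
    intro γ hγ δ hδ y hy t k
    have := abs_mul_le_geometric (σ := ρ ^ 2) (hb δ hδ k) (hin γ hγ δ hδ y hy t k)
    linarith
  refine ⟨ρ, max A (∑' k : ℕ, C * D * (a / ρ ^ 2) ^ k), h0, hρ1, lt_max_of_lt_left hA,
    ⟨_, hgeo.mul_left (C * D), hterm⟩, fun γ hγ y hy t => (hres γ hγ y hy t).trans ?_,
    fun γ hγ δ hδ y hy t => ?_⟩
  · have := one_le_envelope h0.le y t
    gcongr
    exact le_max_left _ _
  · have h2 : |condScale (γ, δ) y t|
        ≤ (∑' k : ℕ, C * D * (a / ρ ^ 2) ^ k) * envelope ρ y (t - 1) ^ 2 := by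
      rw [condScale_eq_tsum, ← Real.norm_eq_abs, ← tsum_mul_right]
      exact tsum_of_norm_bounded ((hgeo.mul_left (C * D)).mul_right _).hasSum
        fun k => hterm γ hγ δ hδ y hy t k
    refine h2.trans ?_
    gcongr
    exact le_max_right _ _

theorem summable_residual (H : InvertibleParams Θγ Θδ) {γ : ARMAParam p q} (hγ : γ ∈ Θγ)
    {y : ℤ → ℝ} (hy : Tempered y) (t : ℤ) :
    Summable fun k : ℕ => invCoeff γ.ma k * armaInput γ y (t - k) := by
  obtain ⟨ρ, C, -, -, -, -, u, hu, hb, -⟩ := H.exists_residual_bound zero_lt_one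
  exact Summable.of_norm_bounded (hu.mul_right (envelope ρ y t)) fun k => hb γ hγ y hy t k

theorem summable_scale (H : InvertibleParams Θγ Θδ) {θ : ARMAGARCHParam p q r s}
    (hθ : θ ∈ Θγ ×ˢ Θδ) {y : ℤ → ℝ} (hy : Tempered y) (t : ℤ) :
    Summable fun k : ℕ => invCoeff (-θ.2.garch) k * garchInput θ y (t - k) := by
  obtain ⟨ρ, C, -, -, -, ⟨u, hu, hb⟩, -⟩ := H.exists_scale_bound
  exact Summable.of_norm_bounded (hu.mul_right (envelope ρ y (t - 1) ^ 2))
    fun k => hb θ.1 hθ.1 θ.2 hθ.2 y hy t k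

theorem residual_recursion (H : InvertibleParams Θγ Θδ) {γ : ARMAParam p q} (hγ : γ ∈ Θγ)
    {y : ℤ → ℝ} (hy : Tempered y) (t : ℤ) :
    armaResidual γ y t = y t - γ.mu - ∑ i : Fin p, γ.ar i * y (t - ((i : ℤ) + 1))
      - ∑ i : Fin q, γ.ma i * armaResidual γ y (t - ((i : ℤ) + 1)) :=
  armaResidual_eq γ y (fun t => H.summable_residual hγ hy t) t

theorem scale_recursion (H : InvertibleParams Θγ Θδ) {θ : ARMAGARCHParam p q r s}
    (hθ : θ ∈ Θγ ×ˢ Θδ) {y : ℤ → ℝ} (hy : Tempered y) (t : ℤ) :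
    condScale θ y t = θ.2.const
      + ∑ i : Fin r, θ.2.arch i * armaResidual θ.1 y (t - ((i : ℤ) + 1)) ^ 2
      + ∑ i : Fin s, θ.2.garch i * condScale θ y (t - ((i : ℤ) + 1)) :=
  condScale_eq θ y (fun t => by
    rw [GARCHParam.garchPoly_eq]; exact H.summable_scale hθ hy t) t

theorem const_le_condScale (H : InvertibleParams Θγ Θδ) {θ : ARMAGARCHParam p q r s}
    (hθ : θ ∈ Θγ ×ˢ Θδ) {y : ℤ → ℝ} (hy : Tempered y) (t : ℤ) :
    θ.2.const ≤ condScale θ y t := by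
  have hP := H.positive θ.2 hθ.2
  have hc : ∀ k, 0 ≤ invCoeff (-θ.2.garch) k := invCoeff_nonneg fun i => by
    simpa using hP.garch_nonneg i
  have hin : ∀ u, θ.2.const ≤ garchInput θ y u := fun u =>
    le_add_of_nonneg_right (Finset.sum_nonneg fun i _ =>
        mul_nonneg (hP.arch_nonneg i) (sq_nonneg _))
  rw [condScale_eq_tsum]
  have h0 := (H.summable_scale hθ hy t).le_tsum 0 fun k _ =>
    mul_nonneg (hc k) (hP.const_pos.le.trans (hin _))
  rw [invCoeff_zero, one_mul] at h0
  exact (hin _).trans h0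

theorem condScale_pos (H : InvertibleParams Θγ Θδ) {θ : ARMAGARCHParam p q r s}
    (hθ : θ ∈ Θγ ×ˢ Θδ) {y : ℤ → ℝ} (hy : Tempered y) (t : ℤ) : 0 < condScale θ y t :=
  (H.positive θ.2 hθ.2).const_pos.trans_le (H.const_le_condScale hθ hy t)

theorem continuousOn_armaResidual (H : InvertibleParams Θγ Θδ) {y : ℤ → ℝ} (hy : Tempered y)
    (t : ℤ) : ContinuousOn (fun γ => armaResidual γ y t) Θγ := by
  obtain ⟨ρ, C, -, -, -, -, u, hu, hb, -⟩ := H.exists_residual_bound zero_lt_one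
  simp only [armaResidual_eq_tsum]
  refine continuousOn_tsum (fun k => Continuous.continuousOn ?_) (hu.mul_right (envelope ρ y t))
    fun k γ hγ => hb γ hγ y hy t k
  refine ((continuous_invCoeff k).comp (by fun_prop)).mul ?_
  simp only [armaInput]
  fun_prop

theorem continuousOn_condScale (H : InvertibleParams Θγ Θδ) {y : ℤ → ℝ} (hy : Tempered y)
    (t : ℤ) : ContinuousOn (fun θ => condScale θ y t) (Θγ ×ˢ Θδ) := by
  obtain ⟨ρ, C, -, -, -, ⟨u, hu, hb⟩, -⟩ := H.exists_scale_bound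
  simp only [condScale_eq_tsum]
  refine continuousOn_tsum (fun k => ?_) (hu.mul_right (envelope ρ y (t - 1) ^ 2))
    fun k θ hθ => hb θ.1 hθ.1 θ.2 hθ.2 y hy t k
  refine ContinuousOn.mul ((continuous_invCoeff k).comp (by fun_prop)).continuousOn ?_
  simp only [garchInput]
  refine ContinuousOn.add (by fun_prop) (continuousOn_finsetSum _ fun i _ => ContinuousOn.mul
    (by fun_prop) (ContinuousOn.pow ?_ 2))
  exact (H.continuousOn_armaResidual hy _).comp (by fun_prop) fun θ hθ => hθ.1

theorem continuousOn_laplaceLoss (H : InvertibleParams Θγ Θδ) {y : ℤ → ℝ} (hy : Tempered y)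
    (t : ℤ) : ContinuousOn (fun θ => laplaceLoss θ y t) (Θγ ×ˢ Θδ) := by
  have hs := (H.continuousOn_condScale hy t).sqrt
  have hne : ∀ θ ∈ Θγ ×ˢ Θδ, √(condScale θ y t) ≠ 0 := fun θ hθ =>
    (Real.sqrt_pos.2 (H.condScale_pos hθ hy t)).ne'
  exact (hs.log hne).add
    ((((H.continuousOn_armaResidual hy t).comp (by fun_prop) fun θ hθ => hθ.1).abs).div hs hne)

end InvertibleParams

/-! ### The strong law for functionals of an i.i.d. sequence -/

section Ergodic

variable {S : Type*} {T : S → S}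

/-- `max (0, S_1 f, …, S_n f)` for the Birkhoff sums `S_k f`, defined by the recursion that it
satisfies. -/
noncomputable def birkhoffMax (T : S → S) (f : S → ℝ) : ℕ → S → ℝ
  | 0, _ => 0
  | n + 1, x => max 0 (f x + birkhoffMax T f n (T x))

theorem birkhoffMax_nonneg (f : S → ℝ) (n : ℕ) (x : S) : 0 ≤ birkhoffMax T f n x := by
  cases n with
  | zero => exact le_rfl
  | succ n => exact le_max_left _ _

theorem birkhoffMax_le_succ (f : S → ℝ) (n : ℕ) (x : S) :
    birkhoffMax T f n x ≤ birkhoffMax T f (n + 1) x := by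
  induction n generalizing x with
  | zero => exact birkhoffMax_nonneg f 1 x
  | succ n ih => exact max_le_max le_rfl (add_le_add le_rfl (ih (T x)))

theorem birkhoffSum_le_birkhoffMax (f : S → ℝ) (n : ℕ) (x : S) :
    birkhoffSum T f n x ≤ birkhoffMax T f n x := by
  induction n generalizing x with
  | zero => simp [birkhoffSum, birkhoffMax]
  | succ n ih =>
    rw [birkhoffSum_succ']
    exact (add_le_add le_rfl (ih (T x))).trans (le_max_right _ _)

/-- The `σ`-algebra of the coordinates with index in `I`. -/
abbrev windowSigma (X : ℤ → S → ℝ) (I : Set ℤ) : MeasurableSpace S :=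
  ⨆ (k : ℤ) (_ : k ∈ I), MeasurableSpace.comap (X k) inferInstance

theorem windowSigma_mono (X : ℤ → S → ℝ) {I J : Set ℤ} (h : I ⊆ J) :
    windowSigma X I ≤ windowSigma X J :=
  biSup_mono h

theorem measurable_iterate_windowSigma {X : ℤ → S → ℝ} (hXT : ∀ k x, X k (T x) = X (k + 1) x)
    (I : Set ℤ) (n : ℕ) {g : S → ℝ} (hg : Measurable[windowSigma X I] g) :
    Measurable[windowSigma X ((· + (n : ℤ)) '' I)] (g ∘ T^[n]) := by
  have hiter : ∀ (n : ℕ) k x, X k (T^[n] x) = X (k + n) x := by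
    intro n
    induction n with
    | zero => intro k x; simp
    | succ n ih =>
      intro k x
      rw [Function.iterate_succ_apply, ih, hXT]; congr 1; push_cast; ring
  refine hg.comp ?_
  rw [measurable_iff_comap_le]
  simp only [windowSigma, MeasurableSpace.comap_iSup, MeasurableSpace.comap_comp]
  refine iSup₂_le fun k hk => ?_
  have : X k ∘ T^[n] = X (k + n) := funext fun x => hiter n k x
  rw [this]
  exact le_iSup₂_of_le (k + (n : ℤ)) ⟨k, hk, rfl⟩ le_rfl

variable [MeasurableSpace S] {μ : Measure S}

theorem measurable_birkhoffMax (hT : Measurable T) {f : S → ℝ} (hf : Measurable f) (n : ℕ) :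
    Measurable (birkhoffMax T f n) := by
  induction n with
  | zero => exact measurable_const
  | succ n ih => exact measurable_const.max (hf.add (ih.comp hT))

theorem integrable_birkhoffMax [IsFiniteMeasure μ] (hT : MeasurePreserving T μ μ) {f : S → ℝ}
    (hfi : Integrable f μ) (n : ℕ) : Integrable (birkhoffMax T f n) μ := by
  induction n with
  | zero => exact integrable_const _
  | succ n ih => exact (integrable_const (0 : ℝ)).sup (hfi.add (hT.integrable_comp_of_integrable ih))

/-- The maximal ergodic inequality, by Garsia's argument. -/
theorem setIntegral_birkhoffMax_pos_nonneg [IsFiniteMeasure μ] (hT : MeasurePreserving T μ μ)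
    {f : S → ℝ} (hf : Measurable f) (hfi : Integrable f μ) (n : ℕ) :
    0 ≤ ∫ x in {x | 0 < birkhoffMax T f n x}, f x ∂μ := by
  set M := birkhoffMax T f n
  have hMm : Measurable M := measurable_birkhoffMax hT.measurable hf n
  have hMi : Integrable M μ := integrable_birkhoffMax hT hfi n
  have hMTi : Integrable (M ∘ T) μ := hT.integrable_comp_of_integrable hMi
  set A := {x | 0 < M x}
  have hA : MeasurableSet A := measurableSet_lt measurable_const hMm
  have h1 : ∫ x, M x ∂μ = ∫ x in A, M x ∂μ := by
    refine (setIntegral_eq_integral_of_forall_compl_eq_zero fun x hx => ?_).symm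
    exact le_antisymm (not_lt.1 hx) (birkhoffMax_nonneg f n x)
  have h2 : ∫ x in A, (M ∘ T) x ∂μ ≤ ∫ x, M x ∂μ := by
    calc ∫ x in A, (M ∘ T) x ∂μ ≤ ∫ x, (M ∘ T) x ∂μ :=
          setIntegral_le_integral hMTi (ae_of_all _ fun x => birkhoffMax_nonneg f n (T x))
      _ = ∫ x, M x ∂μ := by
          have := integral_map (μ := μ) hT.measurable.aemeasurable (f := M)
            hMm.aestronglyMeasurable
          rw [hT.map_eq] at this
          exact this.symm
  have h3 : ∫ x in A, (M x - (M ∘ T) x) ∂μ ≤ ∫ x in A, f x ∂μ := by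
    refine setIntegral_mono_on (hMi.sub hMTi).integrableOn hfi.integrableOn hA fun x hx => ?_
    have hx' : 0 < birkhoffMax T f n x := hx
    cases n with
    | zero => exact absurd hx' (lt_irrefl _)
    | succ n =>
      have h4 : birkhoffMax T f (n + 1) x = f x + birkhoffMax T f n (T x) := by
        have : birkhoffMax T f (n + 1) x = max 0 (f x + birkhoffMax T f n (T x)) := rfl
        rw [this] at hx' ⊢
        exact max_eq_right (by
          by_contra! hlt
          rw [max_eq_left hlt.le] at hx'
          exact lt_irrefl _ hx')
      have h5 := birkhoffMax_le_succ (T := T) f n (T x)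
      simp only [M, Function.comp]
      linarith
  rw [integral_sub hMi.integrableOn hMTi.integrableOn] at h3
  linarith

/-- Weak-type maximal inequality for the averages of a nonnegative function. -/
theorem measure_exists_birkhoffSum_gt_le [IsProbabilityMeasure μ] (hT : MeasurePreserving T μ μ)
    {f : S → ℝ} (hf : Measurable f) (hfi : Integrable f μ) (hf0 : ∀ x, 0 ≤ f x) {l : ℝ}
    (hl : 0 < l) :
    μ {x | ∃ n : ℕ, l * n < birkhoffSum T f n x} ≤ ENNReal.ofReal ((∫ x, f x ∂μ) / l) := by
  set g : S → ℝ := fun x => f x - l with hg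
  have hgm : Measurable g := hf.sub measurable_const
  have hgi : Integrable g μ := hfi.sub (integrable_const _)
  have hsub : {x | ∃ n : ℕ, l * n < birkhoffSum T f n x}
      ⊆ ⋃ n : ℕ, {x | 0 < birkhoffMax T g n x} := by
    rintro x ⟨n, hn⟩
    refine Set.mem_iUnion.2 ⟨n, ?_⟩
    refine lt_of_lt_of_le ?_ (birkhoffSum_le_birkhoffMax g n x)
    have : birkhoffSum T g n x = birkhoffSum T f n x - l * n := by
      simp only [birkhoffSum, hg, Finset.sum_sub_distrib, Finset.sum_const, Finset.card_range,
        nsmul_eq_mul]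
      ring
    rw [this]; linarith
  have hmono : Monotone fun n : ℕ => {x | 0 < birkhoffMax T g n x} :=
    monotone_nat_of_le_succ fun n x hx => lt_of_lt_of_le hx (birkhoffMax_le_succ g n x)
  refine (measure_mono hsub).trans ?_
  rw [hmono.measure_iUnion]
  refine iSup_le fun n => ?_
  set A := {x | 0 < birkhoffMax T g n x}
  have h1 := setIntegral_birkhoffMax_pos_nonneg hT hgm hgi n
  have h2 : ∫ x in A, g x ∂μ = ∫ x in A, f x ∂μ - l * μ.real A := by
    rw [hg, integral_sub hfi.integrableOn (integrable_const _).integrableOn, setIntegral_const,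
      smul_eq_mul, mul_comm]
  have h3 : ∫ x in A, f x ∂μ ≤ ∫ x, f x ∂μ := setIntegral_le_integral hfi (ae_of_all _ hf0)
  rw [← ofReal_measureReal (measure_ne_top μ A)]
  refine ENNReal.ofReal_le_ofReal ?_
  rw [le_div_iff₀ hl]
  linarith

/-- The class of integrable functions whose ergodic averages converge to the mean is closed
in `L¹`. -/
theorem tendsto_birkhoffSum_of_approx [IsProbabilityMeasure μ] (hT : MeasurePreserving T μ μ)
    {f : S → ℝ} (hf : Measurable f) (hfi : Integrable f μ)
    (happrox : ∀ e : ℝ, 0 < e → ∃ g : S → ℝ, Measurable g ∧ Integrable g μ ∧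
      ∫ x, |f x - g x| ∂μ ≤ e ∧
      ∀ᵐ x ∂μ, Tendsto (fun n : ℕ => birkhoffSum T g n x / n) atTop (𝓝 (∫ x, g x ∂μ))) :
    ∀ᵐ x ∂μ, Tendsto (fun n : ℕ => birkhoffSum T f n x / n) atTop (𝓝 (∫ x, f x ∂μ)) := by
  have hpow : ∀ k : ℕ, (0 : ℝ) < (1 / 4) ^ k := fun k => by positivity
  choose g hgm hgi hfg hlim using fun k => happrox _ (hpow k)
  set A : ℕ → Set S := fun k =>
    {x | ∃ n : ℕ, (1 / 2 : ℝ) ^ k * n < birkhoffSum T (fun x => |f x - g k x|) n x}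
  have hA : ∀ k, μ (A k) ≤ ENNReal.ofReal ((1 / 2 : ℝ) ^ k) := by
    intro k
    refine (measure_exists_birkhoffSum_gt_le hT (hf.sub (hgm k)).abs (hfi.sub (hgi k)).abs
      (fun x => abs_nonneg _) (by positivity)).trans (ENNReal.ofReal_le_ofReal ?_)
    rw [div_le_iff₀ (by positivity), ← mul_pow]
    exact (hfg k).trans (by norm_num)
  have hsum : ∑' k, μ (A k) ≠ ⊤ := by
    refine ne_top_of_le_ne_top ?_ (ENNReal.tsum_le_tsum hA)
    rw [← ENNReal.ofReal_tsum_of_nonneg (fun k => by positivity) summable_geometric_two]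
    exact ENNReal.ofReal_ne_top
  filter_upwards [ae_all_iff.2 hlim, ae_eventually_notMem hsum] with x hx hev
  rw [Metric.tendsto_atTop]
  intro e he
  have hhalf : Tendsto (fun k : ℕ => (1 / 2 : ℝ) ^ k) atTop (𝓝 0) :=
    tendsto_pow_atTop_nhds_zero_of_lt_one (by norm_num) (by norm_num)
  obtain ⟨k, hk, hke⟩ := (hev.and (hhalf.eventually_lt_const (show (0 : ℝ) < e / 3 by linarith))).exists
  obtain ⟨N, hN⟩ := Metric.tendsto_atTop.1 (hx k) (e / 3) (by linarith)
  refine ⟨max N 1, fun n hn => ?_⟩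
  have hn1 : (0 : ℝ) < n := by
    have : 1 ≤ n := (le_max_right _ _).trans hn
    positivity
  have h1 := hN n ((le_max_left _ _).trans hn)
  have h2 : |birkhoffSum T f n x - birkhoffSum T (g k) n x| ≤ (1 / 2 : ℝ) ^ k * n := by
    have h3 : ¬ (1 / 2 : ℝ) ^ k * n < birkhoffSum T (fun x => |f x - g k x|) n x :=
      fun h => hk ⟨n, h⟩
    refine le_trans ?_ (not_lt.1 h3)
    simp only [birkhoffSum, ← Finset.sum_sub_distrib]
    exact Finset.abs_sum_le_sum_abs _ _
  have h4 : |birkhoffSum T f n x / n - birkhoffSum T (g k) n x / n| ≤ (1 / 2 : ℝ) ^ k := by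
    rw [← sub_div, abs_div, abs_of_pos hn1, div_le_iff₀ hn1]; exact h2
  have h5 : |∫ x, g k x ∂μ - ∫ x, f x ∂μ| ≤ (1 / 2 : ℝ) ^ k := by
    rw [abs_sub_comm, ← integral_sub hfi (hgi k)]
    refine abs_integral_le_integral_abs.trans ((hfg k).trans ?_)
    exact pow_le_pow_left₀ (by norm_num) (by norm_num) k
  rw [Real.dist_eq] at h1 ⊢
  rw [abs_lt] at h1 ⊢
  rw [abs_le] at h4 h5
  constructor <;> linarith [h1.1, h1.2, h4.1, h4.2, h5.1, h5.2]

/-- A sum over `range n` split into residue classes modulo `N`; the class of `j` has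
`(n + (N - 1 - j)) / N` members below `n`. -/
theorem sum_range_eq_sum_residues (a : ℕ → ℝ) {N : ℕ} (hN : 0 < N) (n : ℕ) :
    ∑ i ∈ Finset.range n, a i
      = ∑ j ∈ Finset.range N, ∑ i ∈ Finset.range ((n + (N - 1 - j)) / N), a (j + N * i) := by
  induction n with
  | zero =>
    rw [Finset.range_zero, Finset.sum_empty]
    refine (Finset.sum_eq_zero fun j _ => ?_).symm
    rw [Nat.div_eq_of_lt (by omega), Finset.range_zero, Finset.sum_empty]
  | succ n ih =>
    rw [Finset.sum_range_succ, ih]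
    have hstep : ∀ j ∈ Finset.range N,
        ∑ i ∈ Finset.range ((n + 1 + (N - 1 - j)) / N), a (j + N * i)
        = ∑ i ∈ Finset.range ((n + (N - 1 - j)) / N), a (j + N * i)
          + if j = n % N then a n else 0 := by
      intro j hj
      have hj' := Finset.mem_range.1 hj
      have hdm := Nat.div_add_mod n N
      have hlt := Nat.mod_lt n hN
      by_cases h : j = n % N
      · have e1 : (n + (N - 1 - j)) / N = n / N := by
          rw [Nat.div_eq_iff hN]
          rw [mul_comm (n / N) N]
          constructor <;> omega
        have e2 : (n + 1 + (N - 1 - j)) / N = n / N + 1 := by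
          rw [show n + 1 + (N - 1 - j) = N * (n / N) + N by omega, Nat.add_div_right _ hN,
            Nat.mul_div_cancel_left _ hN]
        rw [e1, e2, Finset.sum_range_succ, if_pos h]
        congr 2
        omega
      · rw [if_neg h, add_zero]
        congr 2
        rw [show n + 1 + (N - 1 - j) = n + (N - 1 - j) + 1 by ring, Nat.succ_div, if_neg, add_zero]
        rintro ⟨m, hm⟩
        apply h
        have : n = j + N * (m - 1) := by
          have hm1 : 1 ≤ m := by
            by_contra! h0
            have : m = 0 := by omega
            rw [this] at hm; omega
          obtain ⟨m', rfl⟩ := Nat.exists_eq_add_of_le' hm1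
          rw [Nat.add_sub_cancel]
          rw [mul_add] at hm
          omega
        rw [this, Nat.add_mul_mod_self_left, Nat.mod_eq_of_lt hj']
    rw [Finset.sum_congr rfl hstep, Finset.sum_add_distrib, Finset.sum_ite_eq',
      if_pos (Finset.mem_range.2 (Nat.mod_lt n hN))]

theorem tendsto_average_of_residues {a : ℕ → ℝ} {N : ℕ} (hN : 0 < N) {c : ℝ}
    (h : ∀ j < N, Tendsto (fun n : ℕ => (∑ i ∈ Finset.range n, a (j + N * i)) / n) atTop (𝓝 c)) :
    Tendsto (fun n : ℕ => (∑ i ∈ Finset.range n, a i) / n) atTop (𝓝 c) := by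
  have hNr : (0 : ℝ) < N := by exact_mod_cast hN
  have hcnt : ∀ j < N, Tendsto (fun n : ℕ => (((n + (N - 1 - j)) / N : ℕ) : ℝ) / n) atTop
      (𝓝 (1 / N)) := by
    intro j hj
    have hup : Tendsto (fun n : ℕ => 1 / (N : ℝ) + 1 / (n : ℝ)) atTop (𝓝 (1 / N)) := by
      simpa using (tendsto_const_nhds (x := 1 / (N : ℝ))).add tendsto_one_div_atTop_nhds_zero_nat
    have hlo : Tendsto (fun n : ℕ => 1 / (N : ℝ) - 1 / (n : ℝ)) atTop (𝓝 (1 / N)) := by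
      simpa using (tendsto_const_nhds (x := 1 / (N : ℝ))).sub tendsto_one_div_atTop_nhds_zero_nat
    refine tendsto_of_tendsto_of_tendsto_of_le_of_le' hlo hup ?_ ?_
    · filter_upwards [eventually_ge_atTop 1] with n hn
      have hn' : (0 : ℝ) < n := by exact_mod_cast hn
      have h1 : n ≤ N * ((n + (N - 1 - j)) / N) + N := by
        have := Nat.div_add_mod (n + (N - 1 - j)) N
        have := Nat.mod_lt (n + (N - 1 - j)) hN
        omega
      have h2 : (n : ℝ) ≤ N * (((n + (N - 1 - j)) / N : ℕ) : ℝ) + N := by exact_mod_cast h1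
      rw [le_div_iff₀ hn', sub_mul, one_div_mul_cancel hn'.ne', one_div_mul_eq_div, sub_le_iff_le_add,
        div_le_iff₀ hNr]
      linarith
    · filter_upwards [eventually_ge_atTop 1] with n hn
      have hn' : (0 : ℝ) < n := by exact_mod_cast hn
      have h1 : N * ((n + (N - 1 - j)) / N) ≤ n + N := by
        have := Nat.div_add_mod (n + (N - 1 - j)) N
        omega
      have h2 : N * (((n + (N - 1 - j)) / N : ℕ) : ℝ) ≤ (n : ℝ) + N := by exact_mod_cast h1
      rw [div_le_iff₀ hn', add_mul, one_div_mul_cancel hn'.ne', one_div_mul_eq_div,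
        ← sub_le_iff_le_add, le_div_iff₀ hNr]
      linarith
  have hcntT : ∀ j < N, Tendsto (fun n : ℕ => (n + (N - 1 - j)) / N) atTop atTop := by
    intro j _
    exact (Nat.tendsto_div_const_atTop hN.ne').comp (tendsto_add_atTop_nat _)
  have hmain : Tendsto (fun n : ℕ => ∑ j ∈ Finset.range N,
      ((∑ i ∈ Finset.range ((n + (N - 1 - j)) / N), a (j + N * i))
        / (((n + (N - 1 - j)) / N : ℕ) : ℝ)) * ((((n + (N - 1 - j)) / N : ℕ) : ℝ) / n))
      atTop (𝓝 (∑ j ∈ Finset.range N, c * (1 / N))) :=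
    tendsto_finsetSum _ fun j hj =>
      ((h j (Finset.mem_range.1 hj)).comp (hcntT j (Finset.mem_range.1 hj))).mul
        (hcnt j (Finset.mem_range.1 hj))
  have hc : ∑ j ∈ Finset.range N, c * (1 / (N : ℝ)) = c := by
    rw [Finset.sum_const, Finset.card_range, nsmul_eq_mul]; field_simp
  rw [hc] at hmain
  refine hmain.congr fun n => ?_
  rw [sum_range_eq_sum_residues a hN n, Finset.sum_div]
  refine Finset.sum_congr rfl fun j _ => ?_
  by_cases h0 : (n + (N - 1 - j)) / N = 0
  · simp [h0]
  · have : (((n + (N - 1 - j)) / N : ℕ) : ℝ) ≠ 0 := by exact_mod_cast h0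
    field_simp

theorem windowSigma_le {X : ℤ → S → ℝ} (hX : ∀ k, Measurable (X k)) (I : Set ℤ) :
    windowSigma X I ≤ (inferInstance : MeasurableSpace S) :=
  iSup₂_le fun k _ => (hX k).comap_le

/-- The strong law for functions of finitely many coordinates: along each residue class modulo the
window length the summands are i.i.d. -/
theorem tendsto_birkhoffSum_of_window [IsProbabilityMeasure μ] (hT : MeasurePreserving T μ μ)
    {X : ℤ → S → ℝ} (hX : ∀ k, Measurable (X k)) (hind : iIndepFun X μ)
    (hXT : ∀ k x, X k (T x) = X (k + 1) x) (m : ℕ) {g : S → ℝ}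
    (hg : Measurable[windowSigma X (Set.Icc (-(m : ℤ)) m)] g) (hgi : Integrable g μ) :
    ∀ᵐ x ∂μ, Tendsto (fun n : ℕ => birkhoffSum T g n x / n) atTop (𝓝 (∫ x, g x ∂μ)) := by
  set N := 2 * m + 1 with hN
  have hgm : Measurable g := hg.mono (windowSigma_le hX _) le_rfl
  have hTn : ∀ n, MeasurePreserving (T^[n]) μ μ := fun n => hT.iterate n
  have hid : ∀ n, IdentDistrib (g ∘ T^[n]) g μ μ := fun n =>
    ⟨(hgm.comp (hTn n).measurable).aemeasurable, hgm.aemeasurable, by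
      rw [← Measure.map_map hgm (hTn n).measurable, (hTn n).map_eq]⟩
  have hlaw : ∀ j < N, ∀ᵐ x ∂μ, Tendsto
      (fun n : ℕ => (∑ i ∈ Finset.range n, g (T^[j + N * i] x)) / n) atTop (𝓝 (∫ x, g x ∂μ)) := by
    intro j _
    have h := strong_law_ae_real (μ := μ) (fun i : ℕ => g ∘ T^[j + N * i])
      ((hid _).symm.integrable_snd hgi |> fun h => h) ?_ (fun i => (hid _).trans (hid _).symm)
    · have he : ∫ x, (g ∘ T^[j + N * 0]) x ∂μ = ∫ x, g x ∂μ := (hid _).integral_eq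
      rw [he] at h
      exact h
    · intro a b hab
      have hdisj : Disjoint ((· + ((j + N * a : ℕ) : ℤ)) '' Set.Icc (-(m : ℤ)) m)
          ((· + ((j + N * b : ℕ) : ℤ)) '' Set.Icc (-(m : ℤ)) m) := by
        rw [Set.disjoint_left]
        rintro _ ⟨u, hu, rfl⟩ ⟨v, hv, huv⟩
        simp only [Set.mem_Icc] at hu hv
        simp only at huv
        push_cast at huv
        have hNz : (N : ℤ) = 2 * m + 1 := by rw [hN]; push_cast; ring
        have hab' : (a : ℤ) ≠ b := by exact_mod_cast hab
        rcases lt_or_gt_of_ne hab' with hlt | hlt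
        · nlinarith
        · nlinarith
      have hindep := indep_iSup_of_disjoint (m := fun k => MeasurableSpace.comap (X k) inferInstance)
        (fun k => (hX k).comap_le) hind hdisj
      exact (IndepFun_iff_Indep _ _ _).2 (indep_of_indep_of_le_left
        (indep_of_indep_of_le_right hindep
          (measurable_iterate_windowSigma hXT _ _ hg).comap_le)
          (measurable_iterate_windowSigma hXT _ _ hg).comap_le)
  have hall : ∀ᵐ x ∂μ, ∀ j : ℕ, j < N → Tendsto
      (fun n : ℕ => (∑ i ∈ Finset.range n, g (T^[j + N * i] x)) / n) atTop (𝓝 (∫ x, g x ∂μ)) := by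
    rw [ae_all_iff]
    intro j
    by_cases hj : j < N
    · filter_upwards [hlaw j hj] with x hx _ using hx
    · exact ae_of_all _ fun x h => absurd h hj
  filter_upwards [hall] with x hx
  exact tendsto_average_of_residues (a := fun i => g (T^[i] x)) (by omega) hx

/-- The strong law of large numbers along a measure-preserving map that shifts an i.i.d. sequence
`X`, for integrable functionals of `X`. -/
theorem tendsto_birkhoffSum_of_iid [IsProbabilityMeasure μ] (hT : MeasurePreserving T μ μ)
    {X : ℤ → S → ℝ} (hX : ∀ k, Measurable (X k)) (hind : iIndepFun X μ)
    (hXT : ∀ k x, X k (T x) = X (k + 1) x) {f : S → ℝ} (hf : Measurable f)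
    (hfi : Integrable f μ) (hfX : AEStronglyMeasurable[windowSigma X Set.univ] f μ) :
    ∀ᵐ x ∂μ, Tendsto (fun n : ℕ => birkhoffSum T f n x / n) atTop (𝓝 (∫ x, f x ∂μ)) := by
  refine tendsto_birkhoffSum_of_approx hT hf hfi fun e he => ?_
  set F : Filtration ℕ (inferInstance : MeasurableSpace S) :=
    { seq := fun m => windowSigma X (Set.Icc (-(m : ℤ)) m)
      mono' := fun m n hmn => windowSigma_mono X (Set.Icc_subset_Icc (by omega) (by omega))
      le' := fun m => windowSigma_le hX _ } with hF
  have hsup : (⨆ m, F m : MeasurableSpace S) = windowSigma X Set.univ := by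
    refine le_antisymm (iSup_le fun m => windowSigma_mono X (Set.subset_univ _))
      (iSup₂_le fun k _ => ?_)
    refine le_iSup_of_le k.natAbs (le_iSup₂_of_le k ?_ le_rfl)
    simp only [Set.mem_Icc]; omega
  have hlim := tendsto_eLpNorm_condExp (μ := μ) (ℱ := F) f
  have hcond : μ[f|⨆ m, F m] =ᵐ[μ] f := by
    rw [hsup]
    exact condExp_of_aestronglyMeasurable' (windowSigma_le hX _) hfX hfi
  obtain ⟨m, hm⟩ := (hlim.eventually_lt_const (show (0 : ENNReal) < ENNReal.ofReal e by simpa)).exists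
  refine ⟨μ[f|F m], (stronglyMeasurable_condExp.mono (F.le m)).measurable, integrable_condExp, ?_,
    tendsto_birkhoffSum_of_window hT hX hind hXT m stronglyMeasurable_condExp.measurable
      integrable_condExp⟩
  have h1 : eLpNorm (μ[f|F m] - μ[f|⨆ m, F m]) 1 μ = ENNReal.ofReal (∫ x, |f x - (μ[f|F m]) x| ∂μ) := by
    rw [eLpNorm_one_eq_lintegral_enorm, ofReal_integral_eq_lintegral_ofReal
      (f := fun x => |f x - (μ[f|F m]) x|) (hfi.sub integrable_condExp).abs
      (ae_of_all _ fun x => abs_nonneg _)]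
    refine lintegral_congr_ae ?_
    filter_upwards [hcond] with x hx
    rw [Pi.sub_apply, hx, enorm_sub_rev, Real.enorm_eq_ofReal_abs]
  rw [h1] at hm
  exact (ENNReal.ofReal_lt_ofReal_iff he).1 hm |>.le

end Ergodic

/-! ### Measurability of the filters -/

theorem measurable_armaResidual {p q : ℕ} (γ : ARMAParam p q) (t : ℤ) :
    Measurable fun y : ℤ → ℝ => armaResidual γ y t := by
  simp only [armaResidual_eq_tsum, armaInput]
  exact Measurable.tsum fun k => by fun_prop

theorem measurable_condScale {p q r s : ℕ} (θ : ARMAGARCHParam p q r s) (t : ℤ) :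
    Measurable fun y : ℤ → ℝ => condScale θ y t := by
  simp only [condScale_eq_tsum, garchInput]
  refine Measurable.tsum fun k => Measurable.const_mul (Measurable.const_add
    (Finset.measurable_fun_sum _ fun i _ => ?_) _) _
  exact ((measurable_armaResidual θ.1 _).pow_const 2).const_mul _

theorem measurable_laplaceLoss {p q r s : ℕ} (θ : ARMAGARCHParam p q r s) (t : ℤ) :
    Measurable fun y : ℤ → ℝ => laplaceLoss θ y t :=
  (measurable_condScale θ t).sqrt.log.add
    ((measurable_armaResidual θ.1 t).abs.div (measurable_condScale θ t).sqrt)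

theorem measurable_weightAt {w : (ℕ → ℝ) → ℝ} (hw : Measurable w) (t : ℤ) :
    Measurable fun y : ℤ → ℝ => weightAt w y t :=
  hw.comp (measurable_pi_lambda _ fun _ => measurable_pi_apply _)

theorem armaResidual_shift {p q : ℕ} (γ : ARMAParam p q) (y : ℤ → ℝ) (k t : ℤ) :
    armaResidual γ (fun u => y (u + k)) t = armaResidual γ y (t + k) := by
  simp only [armaResidual_eq_tsum, armaInput]
  refine tsum_congr fun n => ?_
  simp only [sub_add_eq_add_sub]

theorem condScale_shift {p q r s : ℕ} (θ : ARMAGARCHParam p q r s) (y : ℤ → ℝ) (k t : ℤ) :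
    condScale θ (fun u => y (u + k)) t = condScale θ y (t + k) := by
  simp only [condScale_eq_tsum, garchInput, armaResidual_shift]
  refine tsum_congr fun n => ?_
  simp only [sub_add_eq_add_sub]

theorem laplaceLoss_shift {p q r s : ℕ} (θ : ARMAGARCHParam p q r s) (y : ℤ → ℝ) (k t : ℤ) :
    laplaceLoss θ (fun u => y (u + k)) t = laplaceLoss θ y (t + k) := by
  simp only [laplaceLoss, armaResidual_shift, condScale_shift]

theorem weightAt_shift (w : (ℕ → ℝ) → ℝ) (y : ℤ → ℝ) (k t : ℤ) :
    weightAt w (fun u => y (u + k)) t = weightAt w y (t + k) := by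
  simp only [weightAt]
  congr 1
  funext i
  congr 1
  ring

/-- Residuals and scales depend only on the past of the path. -/
theorem armaResidual_congr {p q : ℕ} (γ : ARMAParam p q) {y y' : ℤ → ℝ} {t : ℤ}
    (h : ∀ u ≤ t, y u = y' u) : armaResidual γ y t = armaResidual γ y' t := by
  simp only [armaResidual_eq_tsum, armaInput]
  refine tsum_congr fun n => ?_
  rw [h _ (by omega), Finset.sum_congr rfl fun i _ => by rw [h _ (by omega)]]

theorem condScale_congr {p q r s : ℕ} (θ : ARMAGARCHParam p q r s) {y y' : ℤ → ℝ} {t : ℤ}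
    (h : ∀ u ≤ t - 1, y u = y' u) : condScale θ y t = condScale θ y' t := by
  simp only [condScale_eq_tsum, garchInput]
  refine tsum_congr fun n => ?_
  rw [Finset.sum_congr rfl fun i _ => by
    rw [armaResidual_congr θ.1 fun u hu => h u (by omega)]]

theorem weightAt_congr (w : (ℕ → ℝ) → ℝ) {y y' : ℤ → ℝ} {t : ℤ}
    (h : ∀ u ≤ t - 1, y u = y' u) : weightAt w y t = weightAt w y' t := by
  simp only [weightAt]
  congr 1
  funext i
  exact h _ (by omega)

/-! ### The model on a space with a measure-preserving shift -/

section Past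

variable {S : Type*} [MeasurableSpace S] {μ : Measure S} {η : ℤ → S → ℝ}
  {E F : Type*} [MeasurableSpace E] [MeasurableSpace F]

/-- `U` agrees almost everywhere with a function of the innovations up to time `t`. -/
def IsPastMeasurable (η : ℤ → S → ℝ) (μ : Measure S) (t : ℤ) (U : S → E) : Prop :=
  ∃ U' : S → E, Measurable[pastSigma η t] U' ∧ U =ᵐ[μ] U'

namespace IsPastMeasurable

theorem const (t : ℤ) (c : E) : IsPastMeasurable η μ t fun _ => c :=
  ⟨fun _ => c, measurable_const, ae_eq_rfl⟩

theorem congr {t : ℤ} {U V : S → E} (hU : IsPastMeasurable η μ t U) (h : V =ᵐ[μ] U) :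
    IsPastMeasurable η μ t V := by
  obtain ⟨U', hU', he⟩ := hU
  exact ⟨U', hU', h.trans he⟩

theorem mono {t t' : ℤ} {U : S → E} (hU : IsPastMeasurable η μ t U) (h : t ≤ t') :
    IsPastMeasurable η μ t' U := by
  obtain ⟨U', hU', he⟩ := hU
  exact ⟨U', hU'.mono (biSup_mono fun k hk => hk.trans h) le_rfl, he⟩

theorem comp {t : ℤ} {U : S → E} (hU : IsPastMeasurable η μ t U) {G : E → F} (hG : Measurable G) :
    IsPastMeasurable η μ t fun x => G (U x) := by
  obtain ⟨U', hU', he⟩ := hU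
  exact ⟨fun x => G (U' x), hG.comp hU', he.fun_comp G⟩

theorem pi {ι : Type*} [Countable ι] {t : ℤ} {U : ι → S → E}
    (hU : ∀ i, IsPastMeasurable η μ t (U i)) : IsPastMeasurable η μ t fun x i => U i x := by
  choose U' hU' he using hU
  refine ⟨fun x i => U' i x, @measurable_pi_lambda _ _ _ (pastSigma η t) _ _ hU', ?_⟩
  filter_upwards [ae_all_iff.2 he] with x hx
  exact funext hx

theorem prodMk {t : ℤ} {U : S → E} {V : S → F} (hU : IsPastMeasurable η μ t U)
    (hV : IsPastMeasurable η μ t V) : IsPastMeasurable η μ t fun x => (U x, V x) := by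
  obtain ⟨U', hU', he⟩ := hU
  obtain ⟨V', hV', he'⟩ := hV
  refine ⟨fun x => (U' x, V' x), hU'.prodMk hV', ?_⟩
  filter_upwards [he, he'] with x h1 h2
  rw [h1, h2]

theorem comp₂ {t : ℤ} {U V : S → ℝ} (hU : IsPastMeasurable η μ t U)
    (hV : IsPastMeasurable η μ t V) {G : ℝ × ℝ → F} (hG : Measurable G) :
    IsPastMeasurable η μ t fun x => G (U x, V x) :=
  (hU.prodMk hV).comp hG

theorem add {t : ℤ} {U V : S → ℝ} (hU : IsPastMeasurable η μ t U)
    (hV : IsPastMeasurable η μ t V) : IsPastMeasurable η μ t fun x => U x + V x :=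
  hU.comp₂ hV measurable_add

theorem sub {t : ℤ} {U V : S → ℝ} (hU : IsPastMeasurable η μ t U)
    (hV : IsPastMeasurable η μ t V) : IsPastMeasurable η μ t fun x => U x - V x :=
  hU.comp₂ hV measurable_sub

theorem mul {t : ℤ} {U V : S → ℝ} (hU : IsPastMeasurable η μ t U)
    (hV : IsPastMeasurable η μ t V) : IsPastMeasurable η μ t fun x => U x * V x :=
  hU.comp₂ hV measurable_mul

theorem const_mul {t : ℤ} {U : S → ℝ} (c : ℝ) (hU : IsPastMeasurable η μ t U) :
    IsPastMeasurable η μ t fun x => c * U x :=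
  (const t c).mul hU

theorem finsetSum {ι : Type*} {t : ℤ} (I : Finset ι) {U : ι → S → ℝ}
    (hU : ∀ i ∈ I, IsPastMeasurable η μ t (U i)) :
    IsPastMeasurable η μ t fun x => ∑ i ∈ I, U i x := by
  classical
  induction I using Finset.induction_on with
  | empty => simpa using const (η := η) (μ := μ) t (0 : ℝ)
  | insert a I ha ih =>
    simp only [Finset.sum_insert ha]
    exact (hU a (Finset.mem_insert_self _ _)).add
      (ih fun i hi => hU i (Finset.mem_insert_of_mem hi))

theorem of_aestronglyMeasurable {t : ℤ} {U : S → ℝ}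
    (hU : AEStronglyMeasurable[pastSigma η t] U μ) : IsPastMeasurable η μ t U :=
  ⟨hU.mk U, hU.stronglyMeasurable_mk.measurable, hU.ae_eq_mk⟩

theorem innovation {t k : ℤ} (h : k ≤ t) : IsPastMeasurable η μ t (η k) :=
  ⟨η k, measurable_iff_comap_le.2 (le_iSup₂_of_le k h le_rfl), ae_eq_rfl⟩

theorem indepFun [IsProbabilityMeasure μ] (hη : IsIIDSequence η μ) {t : ℤ} {U : S → E}
    (hU : IsPastMeasurable η μ (t - 1) U) : IndepFun U (η t) μ := by
  obtain ⟨U', hU', he⟩ := hU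
  refine IndepFun.congr ?_ he.symm ae_eq_rfl
  have hdisj : Disjoint {k : ℤ | k ≤ t - 1} {t} := by
    rw [Set.disjoint_singleton_right, Set.mem_ofPred_eq]; omega
  have h := indep_iSup_of_disjoint (m := fun k => MeasurableSpace.comap (η k) inferInstance)
    (fun k => (hη.measurable k).comap_le) hη.indep hdisj
  refine (IndepFun_iff_Indep _ _ _).2 (indep_of_indep_of_le_left
    (indep_of_indep_of_le_right h ?_) hU'.comap_le)
  exact le_iSup₂_of_le t rfl le_rfl

theorem aemeasurable (hη : ∀ k, Measurable (η k)) {t : ℤ} {U : S → E}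
    (hU : IsPastMeasurable η μ t U) : AEMeasurable U μ := by
  obtain ⟨U', hU', he⟩ := hU
  exact ⟨U', hU'.mono (iSup₂_le fun k _ => (hη k).comap_le) le_rfl, he⟩

theorem map_prodMk [IsProbabilityMeasure μ] (hη : IsIIDSequence η μ) {t : ℤ} {U : S → E}
    (hU : IsPastMeasurable η μ (t - 1) U) :
    μ.map (fun x => (U x, η t x)) = (μ.map U).prod (μ.map (η 0)) := by
  rw [(indepFun_iff_map_prod_eq_prod_map_map (hU.aemeasurable hη.measurable)
    (hη.measurable t).aemeasurable).1 (hU.indepFun hη), (hη.identDistrib t).map_eq]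

/-- Conditioning on the past: a relation between the past and the present innovation that holds
almost surely holds, for almost every past, for almost every value of the innovation. -/
theorem ae_ae [IsProbabilityMeasure μ] (hη : IsIIDSequence η μ) {t : ℤ} {U : S → E}
    (hU : IsPastMeasurable η μ (t - 1) U) {R : E × ℝ → Prop} (hR : MeasurableSet {z | R z})
    (h : ∀ᵐ x ∂μ, R (U x, η t x)) : ∀ᵐ x ∂μ, ∀ᵐ e ∂(μ.map (η 0)), R (U x, e) := by
  have hUm := hU.aemeasurable hη.measurable
  have h1 : ∀ᵐ z ∂(μ.map fun x => (U x, η t x)), R z :=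
    (ae_map_iff (hUm.prodMk (hη.measurable t).aemeasurable) hR).2 h
  rw [hU.map_prodMk hη] at h1
  have : IsProbabilityMeasure (μ.map (η 0)) :=
    Measure.isProbabilityMeasure_map (hη.measurable 0).aemeasurable
  exact ae_of_ae_map hUm (Measure.ae_ae_of_ae_prod h1)

theorem lintegral_eq [IsProbabilityMeasure μ] (hη : IsIIDSequence η μ) {t : ℤ} {U : S → E}
    (hU : IsPastMeasurable η μ (t - 1) U) {f : E × ℝ → ENNReal} (hf : Measurable f) :
    ∫⁻ x, f (U x, η t x) ∂μ = ∫⁻ x, ∫⁻ e, f (U x, e) ∂(μ.map (η 0)) ∂μ := by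
  have hUm := hU.aemeasurable hη.measurable
  have : IsProbabilityMeasure (μ.map (η 0)) :=
    Measure.isProbabilityMeasure_map (hη.measurable 0).aemeasurable
  rw [← lintegral_map' hf.aemeasurable (hUm.prodMk (hη.measurable t).aemeasurable),
    hU.map_prodMk hη, lintegral_prod _ hf.aemeasurable,
    lintegral_map' hf.lintegral_prod_right'.aemeasurable hUm]

end IsPastMeasurable

end Past

/-- The ARMA--GARCH model on a probability space with measure-preserving shifts `T k` under which
all four processes are exactly equivariant. The canonical path space is the example that matters. -/
structure ShiftModel {S : Type*} [MeasurableSpace S] (μ : Measure S) (T : ℤ → S → S) {p q r s : ℕ}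
    (θ₀ : ARMAGARCHParam p q r s) (η y ε h : ℤ → S → ℝ) : Prop where
  shift : ∀ k, MeasurePreserving (T k) μ μ
  iid : IsIIDSequence η μ
  measurable_obs : ∀ t, Measurable (y t)
  measurable_error : ∀ t, Measurable (ε t)
  measurable_scale : ∀ t, Measurable (h t)
  shift_innov : ∀ k t x, η t (T k x) = η (t + k) x
  shift_obs : ∀ k t x, y t (T k x) = y (t + k) x
  shift_error : ∀ k t x, ε t (T k x) = ε (t + k) x
  shift_scale : ∀ k t x, h t (T k x) = h (t + k) x
  arma_eq : ∀ᵐ x ∂μ, ∀ t, y t x = θ₀.1.mu + ∑ i : Fin p, θ₀.1.ar i * y (t - ((i : ℤ) + 1)) x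
    + ∑ i : Fin q, θ₀.1.ma i * ε (t - ((i : ℤ) + 1)) x + ε t x
  error_eq : ∀ᵐ x ∂μ, ∀ t, ε t x = η t x * √(h t x)
  scale_nonneg : ∀ᵐ x ∂μ, ∀ t, 0 ≤ h t x
  scale_eq : ∀ᵐ x ∂μ, ∀ t, h t x = θ₀.2.const
    + ∑ i : Fin r, θ₀.2.arch i * ε (t - ((i : ℤ) + 1)) x ^ 2
    + ∑ i : Fin s, θ₀.2.garch i * h (t - ((i : ℤ) + 1)) x
  causal_obs : ∀ t, IsPastMeasurable η μ t (y t)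
  causal_scale : ∀ t, IsPastMeasurable η μ (t - 1) (h t)
  tempered : ∀ᵐ x ∂μ, Tempered fun t => y t x

/-- A property of `e_0` that holds almost everywhere holds for the whole stationary process. -/
theorem ae_all_of_shift {S E : Type*} [MeasurableSpace S] {μ : Measure S} {T : ℤ → S → S}
    (hT : ∀ k, MeasurePreserving (T k) μ μ) {e : ℤ → S → E} (he : ∀ k t x, e t (T k x) = e (t + k) x)
    {R : E → Prop} {t₀ : ℤ} (h : ∀ᵐ x ∂μ, R (e t₀ x)) : ∀ᵐ x ∂μ, ∀ t, R (e t x) := by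
  rw [ae_all_iff]
  intro t
  have h1 := (hT (t - t₀)).quasiMeasurePreserving.tendsto_ae.eventually h
  filter_upwards [h1] with x hx
  rw [he] at hx
  simpa using hx

theorem sum_range_shift (F : ℕ → ℝ) (n k : ℕ) :
    ∑ l ∈ Finset.range (k + 1), (if n ≤ l then F (l - n) else 0)
      = ∑ l ∈ Finset.range (k + 1), if l + n ≤ k then F l else 0 := by
  rw [← Finset.sum_filter, ← Finset.sum_filter]
  refine Finset.sum_bij' (fun l _ => l - n) (fun l _ => l + n) ?_ ?_ ?_ ?_ ?_ <;>
  simp only [Finset.mem_filter, Finset.mem_range] <;> intros <;> first | omega | rfl | simp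

/-- Applying the first `k + 1` terms of the inverse power series to `u_t + ∑ c_i u_{t-i}` recovers
`u_t` up to a remainder that only involves the far past and late coefficients. -/
theorem sum_invCoeff_mul {d : ℕ} (c : Fin d → ℝ) (u : ℤ → ℝ) (t : ℤ) (k : ℕ) :
    ∑ l ∈ Finset.range (k + 1), invCoeff c l *
        (u (t - l) + ∑ i : Fin d, c i * u (t - l - ((i : ℤ) + 1)))
      = u t + ∑ i : Fin d, ∑ l ∈ Finset.range (k + 1),
        if l + ((i : ℕ) + 1) ≤ k then 0 else c i * invCoeff c l * u (t - l - ((i : ℤ) + 1)) := by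
  have h1 : ∑ l ∈ Finset.range (k + 1), invCoeff c l * u (t - l)
      = u t - ∑ i : Fin d, ∑ l ∈ Finset.range (k + 1),
        if l + ((i : ℕ) + 1) ≤ k then c i * invCoeff c l * u (t - l - ((i : ℤ) + 1)) else 0 := by
    have h2 : ∀ l ∈ Finset.range (k + 1), invCoeff c l * u (t - l)
        = (if l = 0 then u t else 0) - ∑ i : Fin d, if (i : ℕ) + 1 ≤ l then
          c i * invCoeff c (l - ((i : ℕ) + 1)) *
            u (t - (l - ((i : ℕ) + 1) : ℕ) - ((i : ℤ) + 1)) else 0 := by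
      intro l _
      rw [invCoeff_eq, sub_mul, Finset.sum_mul]
      congr 1
      · split_ifs with h <;> simp [h]
      · refine Finset.sum_congr rfl fun i _ => ?_
        split_ifs with h
        · congr 2
          push_cast [Nat.cast_sub h]
          ring
        · simp
    rw [Finset.sum_congr rfl h2, Finset.sum_sub_distrib, Finset.sum_ite_eq',
      if_pos (by simp), Finset.sum_comm]
    congr 1
    refine Finset.sum_congr rfl fun i _ => ?_
    exact sum_range_shift (fun l => c i * invCoeff c l * u (t - l - ((i : ℤ) + 1))) _ _
  simp only [mul_add, Finset.sum_add_distrib, h1, Finset.mul_sum]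
  rw [Finset.sum_comm (s := Finset.range (k + 1)), sub_add_eq_add_sub, add_sub_assoc,
    ← Finset.sum_sub_distrib]
  congr 1
  refine Finset.sum_congr rfl fun i _ => ?_
  rw [← Finset.sum_sub_distrib]
  refine Finset.sum_congr rfl fun l _ => ?_
  split_ifs <;> ring

theorem min_one_abs_add_le (a b : ℝ) : min 1 |a + b| ≤ min 1 |a| + min 1 |b| := by
  rcases le_total 1 |a| with ha | ha
  · rw [min_eq_left ha]
    exact (min_le_left _ _).trans (le_add_of_nonneg_right (by positivity))
  rcases le_total 1 |b| with hb | hb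
  · rw [min_eq_left hb]
    exact (min_le_left _ _).trans (le_add_of_nonneg_left (by positivity))
  rw [min_eq_right ha, min_eq_right hb]
  exact (min_le_right _ _).trans (abs_add_le a b)

theorem min_one_abs_sum_le {ι : Type*} (I : Finset ι) (a : ι → ℝ) :
    min 1 |∑ i ∈ I, a i| ≤ ∑ i ∈ I, min 1 |a i| := by
  classical
  induction I using Finset.induction_on with
  | empty => simp
  | insert i I hi ih =>
    rw [Finset.sum_insert hi, Finset.sum_insert hi]
    exact (min_one_abs_add_le _ _).trans (add_le_add le_rfl ih)

/-- A stationary process that solves a homogeneous recursion, whose characteristic polynomial does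
not vanish in the closed unit disc, is zero: it is a geometrically small multiple of its own far
past, which has a fixed law. -/
theorem stationary_homogeneous_eq_zero {S : Type*} [MeasurableSpace S] {μ : Measure S}
    [IsProbabilityMeasure μ] {T : ℤ → S → S} (hT : ∀ k, MeasurePreserving (T k) μ μ)
    {e : ℤ → S → ℝ} (hem : ∀ t, Measurable (e t)) (he : ∀ k t x, e t (T k x) = e (t + k) x)
    {d : ℕ} (c : Fin d → ℝ)
    (hroot : ∀ z : ℂ, ‖z‖ ≤ 1 → Polynomial.aeval z (1 + lagPoly c) ≠ 0)
    (hrec : ∀ᵐ x ∂μ, ∀ t, e t x + ∑ i : Fin d, c i * e (t - ((i : ℤ) + 1)) x = 0) :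
    ∀ᵐ x ∂μ, ∀ t, e t x = 0 := by
  obtain ⟨C, ρ, hC, hρ0, hρ1, hb⟩ := exists_abs_invCoeff_le (K := {c}) isCompact_singleton
    (by rintro _ rfl; exact hroot)
  have hb := hb c rfl
  have hinv : Tendsto (fun l => invCoeff c l) atTop (𝓝 0) := by
    refine squeeze_zero_norm hb ?_
    simpa using (tendsto_pow_atTop_nhds_zero_of_lt_one hρ0.le hρ1).const_mul C
  set φ : ℝ → ℝ := fun a => min 1 |a| with hφ
  have hφm : Continuous φ := by fun_prop
  have hφ0 : ∀ a, 0 ≤ φ a := fun a => by positivity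
  have hφi : ∀ f : S → ℝ, Measurable f → Integrable (fun x => φ (f x)) μ := fun f hf =>
    Integrable.of_bound (hφm.measurable.comp hf).aestronglyMeasurable 1
      (ae_of_all _ fun x => by rw [Real.norm_of_nonneg (hφ0 _)]; exact min_le_left _ _)
  set ψ : Fin d → ℕ → ℝ := fun i l => ∫ x, φ (c i * invCoeff c l * e 0 x) ∂μ with hψ
  have hψ0 : ∀ i, Tendsto (ψ i) atTop (𝓝 0) := by
    intro i
    have h := tendsto_integral_of_dominated_convergence (μ := μ) (F := fun l x =>
      φ (c i * invCoeff c l * e 0 x)) (f := fun _ => 0) (fun _ => 1)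
      (fun l => (hφm.measurable.comp ((hem 0).const_mul _)).aestronglyMeasurable)
      (integrable_const _)
      (fun l => ae_of_all _ fun x => by
        rw [Real.norm_of_nonneg (hφ0 _)]; exact min_le_left _ _)
      (ae_of_all _ fun x => by
        have h1 : Tendsto (fun l => c i * invCoeff c l * e 0 x) atTop (𝓝 0) := by
          simpa using (hinv.const_mul (c i)).mul_const (e 0 x)
        have h2 := (hφm.tendsto 0).comp h1
        have h3 : φ 0 = 0 := by simp [hφ]
        rw [h3] at h2
        exact h2)
    simpa using h
  have hint : ∀ t i l, ∫ x, φ (c i * invCoeff c l * e t x) ∂μ = ψ i l := by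
    intro t i l
    have h1 : ∀ x, e t x = e 0 (T t x) := fun x => by rw [he, zero_add]
    simp only [h1]
    have h2 := integral_map (μ := μ) (hT t).measurable.aemeasurable
      (f := fun x => φ (c i * invCoeff c l * e 0 x))
      (hφm.measurable.comp ((hem 0).const_mul _)).aestronglyMeasurable
    rw [(hT t).map_eq] at h2
    exact h2.symm
  have hbound : ∀ k : ℕ, ∫ x, φ (e 0 x) ∂μ ≤ ∑ i : Fin d, ∑ l ∈ Finset.range (k + 1),
      if l + ((i : ℕ) + 1) ≤ k then 0 else ψ i l := by
    intro k
    have h1 : ∀ᵐ x ∂μ, φ (e 0 x) ≤ ∑ i : Fin d, ∑ l ∈ Finset.range (k + 1),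
        if l + ((i : ℕ) + 1) ≤ k then 0
        else φ (c i * invCoeff c l * e (0 - l - ((i : ℤ) + 1)) x) := by
      filter_upwards [hrec] with x hx
      have h2 := sum_invCoeff_mul c (fun t => e t x) 0 k
      simp only [hx, mul_zero, Finset.sum_const_zero] at h2
      have h3 : φ (e 0 x) = φ (∑ i : Fin d, ∑ l ∈ Finset.range (k + 1),
          if l + ((i : ℕ) + 1) ≤ k then 0
          else c i * invCoeff c l * e (0 - l - ((i : ℤ) + 1)) x) := by
        rw [eq_neg_of_add_eq_zero_left h2.symm, hφ]
        simp only [abs_neg]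
      rw [h3]
      refine (min_one_abs_sum_le _ _).trans (Finset.sum_le_sum fun i _ => ?_)
      refine (min_one_abs_sum_le _ _).trans (Finset.sum_le_sum fun l _ => ?_)
      split_ifs <;> simp [hφ]
    have hi : ∀ (i : Fin d) (l : ℕ), Integrable (fun x => if l + ((i : ℕ) + 1) ≤ k then 0
        else φ (c i * invCoeff c l * e (0 - l - ((i : ℤ) + 1)) x)) μ := by
      intro i l
      split_ifs
      · exact integrable_zero _ _ _
      · exact hφi _ ((hem _).const_mul _)
    refine (integral_mono_ae (hφi _ (hem 0)) (integrable_finsetSum _ fun i _ =>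
      integrable_finsetSum _ fun l _ => hi i l) h1).trans_eq ?_
    rw [integral_finsetSum _ fun i _ => integrable_finsetSum _ fun l _ => hi i l]
    refine Finset.sum_congr rfl fun i _ => ?_
    rw [integral_finsetSum _ fun l _ => hi i l]
    refine Finset.sum_congr rfl fun l _ => ?_
    split_ifs
    · simp
    · exact hint _ i l
  have hzero : ∫ x, φ (e 0 x) ∂μ = 0 := by
    refine le_antisymm (le_of_forall_pos_le_add fun a ha => ?_)
      (integral_nonneg fun x => hφ0 _)
    set b : ℝ := a / (d * d + 1) with hbdef
    have hbpos : 0 < b := by positivity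
    obtain ⟨L, hL⟩ := eventually_atTop.1 (eventually_all.2 fun i =>
      (hψ0 i).eventually_le_const hbpos)
    refine (hbound (L + d)).trans ?_
    have h1 : ∀ i : Fin d, (∑ l ∈ Finset.range (L + d + 1),
        if l + ((i : ℕ) + 1) ≤ L + d then 0 else ψ i l) ≤ d * b := by
      intro i
      have h2 : (∑ l ∈ Finset.range (L + d + 1),
          if l + ((i : ℕ) + 1) ≤ L + d then 0 else ψ i l)
          ≤ ∑ l ∈ Finset.range (L + d + 1), if L + 1 ≤ l then b else 0 := by
        refine Finset.sum_le_sum fun l hl => ?_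
        have hi := i.2
        split_ifs with h3 h4 h4
        · exact hbpos.le
        · exact le_rfl
        · exact hL l (by omega) i
        · omega
      refine h2.trans_eq ?_
      rw [← Finset.sum_filter, Finset.sum_const, nsmul_eq_mul]
      congr 2
      have : (Finset.range (L + d + 1)).filter (L + 1 ≤ ·) = Finset.Ico (L + 1) (L + d + 1) := by
        ext l; simp only [Finset.mem_filter, Finset.mem_range, Finset.mem_Ico]; omega
      rw [this, Nat.card_Ico]; omega
    refine (Finset.sum_le_sum fun i _ => h1 i).trans ?_
    rw [Finset.sum_const, Finset.card_univ, Fintype.card_fin, nsmul_eq_mul, zero_add, hbdef,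
      ← mul_assoc, mul_div_assoc', div_le_iff₀ (by positivity)]
    nlinarith
  have h0 : ∀ᵐ x ∂μ, e 0 x = 0 := by
    have h1 := (integral_eq_zero_iff_of_nonneg (fun x => hφ0 (e 0 x)) (hφi _ (hem 0))).1 hzero
    filter_upwards [h1] with x hx
    have hx' : min 1 |e 0 x| = 0 := hx
    by_contra hne
    have : 0 < min 1 |e 0 x| := lt_min one_pos (abs_pos.2 hne)
    linarith
  exact ae_all_of_shift hT he (R := fun a => a = 0) h0

/-! ### Lag polynomials acting on sequences -/

/-- The backshift operator `(B u)_t = u_{t-1}`. -/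
def backshift : Module.End ℝ (ℤ → ℝ) where
  toFun u t := u (t - 1)
  map_add' _ _ := rfl
  map_smul' _ _ := rfl

theorem backshift_pow_apply (k : ℕ) (u : ℤ → ℝ) (t : ℤ) : (backshift ^ k) u t = u (t - k) := by
  induction k generalizing t with
  | zero => simp
  | succ k ih =>
    rw [pow_succ', Module.End.mul_apply]
    change (backshift ^ k) u (t - 1) = _
    rw [ih]; congr 1; push_cast; ring

theorem aeval_backshift_apply (Q : Polynomial ℝ) (u : ℤ → ℝ) (t : ℤ) :
    Polynomial.aeval backshift Q u t
      = ∑ k ∈ Finset.range (Q.natDegree + 1), Q.coeff k * u (t - k) := by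
  rw [Polynomial.aeval_eq_sum_range, LinearMap.sum_apply, Finset.sum_apply]
  refine Finset.sum_congr rfl fun k _ => ?_
  rw [LinearMap.smul_apply, Pi.smul_apply, backshift_pow_apply, smul_eq_mul]

theorem aeval_backshift_lagPoly {d : ℕ} (c : Fin d → ℝ) (u : ℤ → ℝ) (t : ℤ) :
    Polynomial.aeval backshift (lagPoly c) u t = ∑ i : Fin d, c i * u (t - ((i : ℤ) + 1)) := by
  rw [lagPoly, map_sum, LinearMap.sum_apply, Finset.sum_apply]
  refine Finset.sum_congr rfl fun i _ => ?_
  rw [map_mul, Polynomial.aeval_C, map_pow, Polynomial.aeval_X, Module.End.mul_apply,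
    Module.algebraMap_end_apply, Pi.smul_apply, backshift_pow_apply, smul_eq_mul]
  push_cast
  rfl

theorem aeval_backshift_const (Q : Polynomial ℝ) (m : ℝ) :
    Polynomial.aeval backshift Q (fun _ => m) = fun _ => Q.eval 1 * m := by
  funext t
  rw [aeval_backshift_apply, Polynomial.eval_eq_sum_range, Finset.sum_mul]
  simp

theorem NoCommonRoot.isCoprime {A B : Polynomial ℝ} (h : NoCommonRoot A B) : IsCoprime A B := by
  rw [Polynomial.isCoprime_iff_aeval_ne_zero_of_isAlgClosed ℝ ℂ]
  intro z
  by_contra! hz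
  exact h z hz

theorem eq_of_coprime_fractions {A₀ A B₀ B : Polynomial ℝ} (h₀ : IsCoprime A₀ B₀)
    (h : IsCoprime A B) (hA₀ : A₀.coeff 0 = 1) (hA : A.coeff 0 = 1) (heq : A * B₀ = A₀ * B) :
    A = A₀ ∧ B = B₀ := by
  have hd1 : A₀ ∣ A := h₀.dvd_of_dvd_mul_right (Dvd.intro _ heq.symm)
  have hd2 : A ∣ A₀ := h.dvd_of_dvd_mul_right (Dvd.intro _ heq)
  have hA₀ne : A₀ ≠ 0 := by rintro rfl; simp at hA₀
  have hAeq : A = A₀ := by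
    obtain ⟨u, hu⟩ := associated_of_dvd_dvd hd1 hd2
    obtain ⟨c, -, hc⟩ := Polynomial.isUnit_iff.1 u.isUnit
    rw [← hc] at hu
    have h0 := congrArg (fun Q : Polynomial ℝ => Q.coeff 0) hu
    simp only [Polynomial.coeff_mul_C, hA₀, hA, one_mul] at h0
    rw [h0, Polynomial.C_1, mul_one] at hu
    exact hu.symm
  refine ⟨hAeq, ?_⟩
  rw [hAeq] at heq
  exact (mul_left_cancel₀ hA₀ne heq).symm

section Uniqueness

variable {S : Type*} [MeasurableSpace S] {μ : Measure S} {η : ℤ → S → ℝ}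

/-- A polynomial filter of an adapted sequence is nonconstant, unless the polynomial vanishes, as
soon as the sequence is nowhere a function of the strict past. -/
theorem poly_eq_zero_of_filter_const {v : ℤ → S → ℝ} (hv : ∀ t, IsPastMeasurable η μ t (v t))
    (hnp : ∀ t, ¬ IsPastMeasurable η μ (t - 1) (v t)) {Q : Polynomial ℝ} {κ : ℝ}
    (hQ : ∀ᵐ x ∂μ, ∀ t, Polynomial.aeval backshift Q (fun u => v u x) t = κ) : Q = 0 := by
  by_contra hne
  set n := Q.natTrailingDegree with hn
  have hc : Q.coeff n ≠ 0 := by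
    have := Polynomial.trailingCoeff_nonzero_iff_nonzero.2 hne
    exact this
  have hnle : n ≤ Q.natDegree := Polynomial.natTrailingDegree_le_natDegree Q
  apply hnp (-n)
  -- the lowest coefficient isolates the most recent value
  refine (IsPastMeasurable.const_mul (Q.coeff n)⁻¹ ((IsPastMeasurable.const _ κ).sub
    (IsPastMeasurable.finsetSum ((Finset.range (Q.natDegree + 1)).filter (n < ·))
      (U := fun k x => Q.coeff k * v (-k) x) fun k hk =>
        IsPastMeasurable.const_mul _ ((hv _).mono ?_)))).congr ?_
  · have := (Finset.mem_filter.1 hk).2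
    omega
  · filter_upwards [hQ] with x hx
    have h0 := hx 0
    rw [aeval_backshift_apply] at h0
    have h1 : ∑ k ∈ Finset.range (Q.natDegree + 1), Q.coeff k * v (0 - k) x
        = Q.coeff n * v (-n) x
          + ∑ k ∈ (Finset.range (Q.natDegree + 1)).filter (n < ·), Q.coeff k * v (-k) x := by
      rw [← Finset.sum_filter_add_sum_filter_not (Finset.range (Q.natDegree + 1)) (n < ·),
        add_comm]
      simp only [zero_sub]
      congr 1
      rw [Finset.sum_eq_single n]
      · intro k hk hkn
        have hk' := (Finset.mem_filter.1 hk).2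
        rw [Polynomial.coeff_eq_zero_of_lt_natTrailingDegree (by omega), zero_mul]
      · intro hk
        exact absurd (Finset.mem_filter.2 ⟨Finset.mem_range.2 (by omega), lt_irrefl n⟩) hk
    rw [h1] at h0
    field_simp
    linarith

/-- The coprime pair of polynomials in a linear difference equation driven by an unpredictable
sequence is unique. -/
theorem lag_polynomials_unique {Y v : ℤ → S → ℝ} (hv : ∀ t, IsPastMeasurable η μ t (v t))
    (hnp : ∀ t, ¬ IsPastMeasurable η μ (t - 1) (v t)) {A₀ A B₀ B : Polynomial ℝ} {m₀ m : ℝ}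
    (h₀ : IsCoprime A₀ B₀) (h : IsCoprime A B) (hA₀ : A₀.coeff 0 = 1) (hA : A.coeff 0 = 1)
    (he₀ : ∀ᵐ x ∂μ, Polynomial.aeval backshift A₀ (fun u => Y u x)
      = (fun _ => m₀) + Polynomial.aeval backshift B₀ (fun u => v u x))
    (he : ∀ᵐ x ∂μ, Polynomial.aeval backshift A (fun u => Y u x)
      = (fun _ => m) + Polynomial.aeval backshift B (fun u => v u x)) :
    A = A₀ ∧ B = B₀ := by
  refine eq_of_coprime_fractions h₀ h hA₀ hA (sub_eq_zero.1 ?_)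
  refine poly_eq_zero_of_filter_const hv hnp (κ := A₀.eval 1 * m - A.eval 1 * m₀) ?_
  filter_upwards [he₀, he] with x h1 h2 t
  have e1 := congrArg (fun u => Polynomial.aeval backshift A u t) h1
  have e2 := congrArg (fun u => Polynomial.aeval backshift A₀ u t) h2
  simp only [map_add, aeval_backshift_const, Pi.add_apply, ← Module.End.mul_apply, ← map_mul]
    at e1 e2
  rw [mul_comm A A₀] at e1
  rw [map_sub, LinearMap.sub_apply, Pi.sub_apply]
  linarith

end Uniqueness

/-! ### The true residuals and scales -/

namespace ShiftModel

variable {S : Type*} [MeasurableSpace S] {μ : Measure S} {T : ℤ → S → S} {p q r s : ℕ}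
  {θ₀ : ARMAGARCHParam p q r s} {η y ε h : ℤ → S → ℝ} {Θγ : Set (ARMAParam p q)}
  {Θδ : Set (GARCHParam r s)}

theorem past_obs (M : ShiftModel μ T θ₀ η y ε h) {u t : ℤ} (hut : u ≤ t) :
    IsPastMeasurable η μ t (y u) :=
  (M.causal_obs u).mono hut

theorem past_scale (M : ShiftModel μ T θ₀ η y ε h) {u t : ℤ} (hut : u ≤ t + 1) :
    IsPastMeasurable η μ t (h u) :=
  (M.causal_scale u).mono (by omega)

theorem past_error (M : ShiftModel μ T θ₀ η y ε h) {u t : ℤ} (hut : u ≤ t) :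
    IsPastMeasurable η μ t (ε u) := by
  refine ((IsPastMeasurable.innovation (μ := μ) (η := η) hut).mul
    ((M.past_scale (u := u) (t := t) (by omega)).comp Real.continuous_sqrt.measurable)).congr ?_
  filter_upwards [M.error_eq] with x hx using hx u

/-- A functional of the observations up to time `t` is measurable with respect to the past at
time `t`. -/
theorem past_functional (M : ShiftModel μ T θ₀ η y ε h) {t : ℤ} {G : (ℤ → ℝ) → ℝ}
    (hG : Measurable G) (hpast : ∀ u u' : ℤ → ℝ, (∀ k ≤ t, u k = u' k) → G u = G u') :
    IsPastMeasurable η μ t fun x => G fun u => y u x := by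
  have h1 : IsPastMeasurable η μ t fun x (k : Set.Iic t) => y k x :=
    IsPastMeasurable.pi fun k => M.past_obs k.2
  classical
  have hext : Measurable fun (v : Set.Iic t → ℝ) (u : ℤ) => if hu : u ≤ t then v ⟨u, hu⟩ else 0 := by
    refine measurable_pi_lambda _ fun u => ?_
    by_cases hu : u ≤ t
    · simp only [hu, dif_pos]; exact measurable_pi_apply _
    · simp only [hu, dif_neg, not_false_eq_true]; exact measurable_const
  refine (h1.comp (hG.comp hext)).congr (ae_of_all _ fun x => ?_)
  refine hpast _ _ fun k hk => ?_
  simp [hk]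

theorem past_residual (M : ShiftModel μ T θ₀ η y ε h) (γ : ARMAParam p q) {u t : ℤ}
    (hut : u ≤ t) : IsPastMeasurable η μ t fun x => armaResidual γ (fun k => y k x) u :=
  M.past_functional (measurable_armaResidual γ u) fun _ _ hv =>
    armaResidual_congr γ fun k hk => hv k (hk.trans hut)

theorem past_condScale (M : ShiftModel μ T θ₀ η y ε h) (θ : ARMAGARCHParam p q r s) {u t : ℤ}
    (hut : u ≤ t + 1) : IsPastMeasurable η μ t fun x => condScale θ (fun k => y k x) u :=
  M.past_functional (measurable_condScale θ u) fun _ _ hv =>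
    condScale_congr θ fun k hk => hv k (by omega)

theorem past_weight (M : ShiftModel μ T θ₀ η y ε h) {w : (ℕ → ℝ) → ℝ} (hw : Measurable w)
    {u t : ℤ} (hut : u ≤ t + 1) : IsPastMeasurable η μ t fun x => weightAt w (fun k => y k x) u :=
  M.past_functional (measurable_weightAt hw u) fun _ _ hv =>
    weightAt_congr w fun k hk => hv k (by omega)

theorem measurable_path (M : ShiftModel μ T θ₀ η y ε h) : Measurable fun x u => y u x :=
  measurable_pi_lambda _ fun t => M.measurable_obs t

theorem path_shift (M : ShiftModel μ T θ₀ η y ε h) (k : ℤ) (x : S) :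
    (fun u => y u (T k x)) = fun u => y (u + k) x :=
  funext fun u => M.shift_obs k u x

theorem error_eq_residual [IsProbabilityMeasure μ] (M : ShiftModel μ T θ₀ η y ε h)
    (H : InvertibleParams Θγ Θδ) (hθ₀ : θ₀ ∈ Θγ ×ˢ Θδ) :
    ∀ᵐ x ∂μ, ∀ t, ε t x = armaResidual θ₀.1 (fun u => y u x) t := by
  have key := stationary_homogeneous_eq_zero M.shift
    (e := fun t x => ε t x - armaResidual θ₀.1 (fun u => y u x) t)
    (fun t => (M.measurable_error t).sub ((measurable_armaResidual θ₀.1 t).comp M.measurable_path))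
    (fun k t x => by rw [M.shift_error, M.path_shift, armaResidual_shift θ₀.1 (fun u => y u x)])
    θ₀.1.ma (H.ma_ne_zero θ₀.1 hθ₀.1) (by
      filter_upwards [M.arma_eq, M.tempered] with x hx hy t
      have h1 := hx t
      have h2 := H.residual_recursion hθ₀.1 hy t
      simp only [mul_sub, Finset.sum_sub_distrib]
      linarith)
  filter_upwards [key] with x hx t
  exact sub_eq_zero.1 (hx t)

theorem scale_eq_condScale [IsProbabilityMeasure μ] (M : ShiftModel μ T θ₀ η y ε h)
    (H : InvertibleParams Θγ Θδ) (hθ₀ : θ₀ ∈ Θγ ×ˢ Θδ) :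
    ∀ᵐ x ∂μ, ∀ t, h t x = condScale θ₀ (fun u => y u x) t := by
  have key := stationary_homogeneous_eq_zero M.shift
    (e := fun t x => h t x - condScale θ₀ (fun u => y u x) t)
    (fun t => (M.measurable_scale t).sub ((measurable_condScale θ₀ t).comp M.measurable_path))
    (fun k t x => by rw [M.shift_scale, M.path_shift, condScale_shift θ₀ (fun u => y u x)])
    (-θ₀.2.garch) (garchPoly_aeval_ne_zero (H.positive θ₀.2 hθ₀.2)
      (H.garch_sum_lt_one θ₀.2 hθ₀.2)) (by
      filter_upwards [M.scale_eq, M.tempered, M.error_eq_residual H hθ₀] with x hx hy hε t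
      have h1 := hx t
      have h2 := H.scale_recursion hθ₀ hy t
      simp only [← hε] at h2
      simp only [mul_sub, Finset.sum_sub_distrib, Pi.neg_apply, neg_mul, Finset.sum_neg_distrib]
      linarith)
  filter_upwards [key] with x hx t
  exact sub_eq_zero.1 (hx t)

theorem const_le_scale (M : ShiftModel μ T θ₀ η y ε h) (hP : θ₀.2.Positive) :
    ∀ᵐ x ∂μ, ∀ t, θ₀.2.const ≤ h t x := by
  filter_upwards [M.scale_eq, M.scale_nonneg] with x hx h0 t
  rw [hx t, add_assoc, le_add_iff_nonneg_right]
  exact add_nonneg (Finset.sum_nonneg fun i _ => mul_nonneg (hP.arch_nonneg i) (sq_nonneg _))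
    (Finset.sum_nonneg fun i _ => mul_nonneg (hP.garch_nonneg i) (h0 _))

theorem scale_pos (M : ShiftModel μ T θ₀ η y ε h) (hP : θ₀.2.Positive) :
    ∀ᵐ x ∂μ, ∀ t, 0 < h t x := by
  filter_upwards [M.const_le_scale hP] with x hx t using hP.const_pos.trans_le (hx t)

end ShiftModel

/-! ### Identification -/

section Innovation

variable {S : Type*} [MeasurableSpace S] {μ : Measure S}

theorem not_ae_sq_eq_const {X : S → ℝ} (hX : Measurable X)
    (hnd : ¬ IsDegenerate (fun x => X x ^ 2) μ) (c : ℝ) : ¬ ∀ᵐ e ∂(μ.map X), e ^ 2 = c :=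
  fun h => hnd ⟨c, ae_of_ae_map hX.aemeasurable h⟩

theorem affine_eq_zero_of_ae [IsProbabilityMeasure μ] {X : S → ℝ} (hX : Measurable X)
    (hnd : ¬ IsDegenerate (fun x => X x ^ 2) μ) {a b : ℝ}
    (h : ∀ᵐ e ∂(μ.map X), a * e + b = 0) : a = 0 ∧ b = 0 := by
  have : IsProbabilityMeasure (μ.map X) := Measure.isProbabilityMeasure_map hX.aemeasurable
  have ha : a = 0 := by
    by_contra ha
    refine not_ae_sq_eq_const hX hnd ((-b / a) ^ 2) ?_
    filter_upwards [h] with e he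
    congr 1
    field_simp
    linarith
  refine ⟨ha, ?_⟩
  obtain ⟨e, he⟩ := h.exists
  rw [ha, zero_mul, zero_add] at he
  exact he

end Innovation

namespace ShiftModel

variable {S : Type*} [MeasurableSpace S] {μ : Measure S} {T : ℤ → S → S} {p q r s : ℕ}
  {θ₀ θ : ARMAGARCHParam p q r s} {η y ε h : ℤ → S → ℝ} {Θγ : Set (ARMAParam p q)}
  {Θδ : Set (GARCHParam r s)}

/-- The error is not a function of the strict past, because the innovation is not degenerate. -/
theorem not_past_error [IsProbabilityMeasure μ] (M : ShiftModel μ T θ₀ η y ε h)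
    (hP : θ₀.2.Positive) (hnd : ¬ IsDegenerate (fun x => η 0 x ^ 2) μ) (t : ℤ) :
    ¬ IsPastMeasurable η μ (t - 1) (ε t) := by
  intro hU
  have h1 := IsPastMeasurable.ae_ae M.iid (hU.prodMk (M.past_scale (u := t) (by omega)))
    (R := fun z : (ℝ × ℝ) × ℝ => z.1.1 = z.2 * √z.1.2)
    (measurableSet_eq_fun (by fun_prop) (by fun_prop)) (by
      filter_upwards [M.error_eq] with x hx using hx t)
  obtain ⟨x, hx, hpos⟩ := (h1.and (M.scale_pos hP)).exists
  have h2 := affine_eq_zero_of_ae (M.iid.measurable 0) hnd (a := √(h t x)) (b := -ε t x) (by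
    filter_upwards [hx] with e he
    have he' : ε t x = e * √(h t x) := he
    linarith)
  exact (Real.sqrt_pos.2 (hpos t)).ne' h2.1

theorem not_past_error_sq [IsProbabilityMeasure μ] (M : ShiftModel μ T θ₀ η y ε h)
    (hP : θ₀.2.Positive) (hnd : ¬ IsDegenerate (fun x => η 0 x ^ 2) μ) (t : ℤ) :
    ¬ IsPastMeasurable η μ (t - 1) fun x => ε t x ^ 2 := by
  intro hU
  have h1 := IsPastMeasurable.ae_ae M.iid (hU.prodMk (M.past_scale (u := t) (by omega)))
    (R := fun z : (ℝ × ℝ) × ℝ => z.1.1 = (z.2 * √z.1.2) ^ 2)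
    (measurableSet_eq_fun (by fun_prop) (by fun_prop)) (by
      filter_upwards [M.error_eq] with x hx
      simp only [hx t])
  obtain ⟨x, hx, hpos⟩ := (h1.and (M.scale_pos hP)).exists
  refine not_ae_sq_eq_const (M.iid.measurable 0) hnd (ε t x ^ 2 / h t x) ?_
  filter_upwards [hx] with e he
  simp only [mul_pow, Real.sq_sqrt (hpos t).le] at he
  rw [eq_div_iff (hpos t).ne', he]

/-- `h` cannot follow a multiplicative random walk. Its reciprocal is bounded, so the moments of
`1 / h` are finite and positive, and they are invariant in time; hence the multiplier has all moments
equal to `1`, in particular variance `0`. -/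
theorem not_multiplicative [IsProbabilityMeasure μ] (M : ShiftModel μ T θ₀ η y ε h)
    (hP : θ₀.2.Positive) (hnd : ¬ IsDegenerate (fun x => η 0 x ^ 2) μ) {a b : ℝ} (ha : a ≠ 0)
    (hmul : ∀ᵐ x ∂μ, h 1 x = (a * η 0 x ^ 2 + b) * h 0 x) : False := by
  set ξ : S → ℝ := fun x => (a * η 0 x ^ 2 + b)⁻¹ with hξ
  have hξm : Measurable ξ := ((((M.iid.measurable 0).pow_const 2).const_mul a).add_const b).inv
  have hmom : ∀ n : ℕ, ∫ x, ξ x ^ n ∂μ = 1 := by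
    intro n
    have hind : IndepFun (fun x => (h 0 x)⁻¹ ^ n) (fun x => ξ x ^ n) μ :=
      ((M.past_scale (u := 0) (t := 0 - 1) (by omega)).indepFun M.iid).comp
        (φ := fun a => a⁻¹ ^ n) (ψ := fun e => (a * e ^ 2 + b)⁻¹ ^ n)
        (by fun_prop) (by fun_prop)
    have h1 : ∫ x, (h 1 x)⁻¹ ^ n ∂μ = (∫ x, (h 0 x)⁻¹ ^ n ∂μ) * ∫ x, ξ x ^ n ∂μ := by
      rw [← hind.integral_fun_mul_eq_mul_integral
        (((M.measurable_scale 0).inv.pow_const n).aestronglyMeasurable)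
        ((hξm.pow_const n).aestronglyMeasurable)]
      refine integral_congr_ae ?_
      filter_upwards [hmul] with x hx
      rw [hx, mul_inv, mul_pow, mul_comm]
    have h2 : ∫ x, (h 1 x)⁻¹ ^ n ∂μ = ∫ x, (h 0 x)⁻¹ ^ n ∂μ := by
      have h3 := integral_map (μ := μ) (M.shift 1).measurable.aemeasurable
        (f := fun x => (h 0 x)⁻¹ ^ n) ((M.measurable_scale 0).inv.pow_const n).aestronglyMeasurable
      rw [(M.shift 1).map_eq] at h3
      rw [h3]
      simp only [M.shift_scale, zero_add]
    have h4 : 0 < ∫ x, (h 0 x)⁻¹ ^ n ∂μ := by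
      have hbd : ∀ᵐ x ∂μ, ‖(h 0 x)⁻¹ ^ n‖ ≤ θ₀.2.const⁻¹ ^ n := by
        filter_upwards [M.const_le_scale hP, M.scale_pos hP] with x hx hx0
        have := hx0 0
        rw [Real.norm_of_nonneg (by positivity)]
        exact pow_le_pow_left₀ (by positivity) (inv_anti₀ hP.const_pos (hx 0)) n
      have hint : Integrable (fun x => (h 0 x)⁻¹ ^ n) μ :=
        Integrable.of_bound ((M.measurable_scale 0).inv.pow_const n).aestronglyMeasurable _ hbd
      have hpos : ∀ᵐ x ∂μ, 0 < (h 0 x)⁻¹ ^ n := by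
        filter_upwards [M.scale_pos hP] with x hx
        have := hx 0
        positivity
      refine lt_of_le_of_ne (integral_nonneg_of_ae (hpos.mono fun x hx => hx.le)) fun h0 => ?_
      have h5 := (integral_eq_zero_iff_of_nonneg_ae (hpos.mono fun x hx => hx.le) hint).1 h0.symm
      obtain ⟨x, hx, hx'⟩ := (hpos.and h5).exists
      exact hx.ne' hx'
    rw [h2] at h1
    exact mul_left_cancel₀ h4.ne' (by rw [← h1, mul_one])
  have hint : ∀ n, Integrable (fun x => ξ x ^ n) μ := by
    intro n
    by_contra hni
    have := hmom n
    rw [integral_undef hni] at this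
    exact zero_ne_one this
  -- the variance of `ξ` vanishes
  have hvar : ∫ x, (ξ x - 1) ^ 2 ∂μ = 0 := by
    have e1 : ∀ x, (ξ x - 1) ^ 2 = ξ x ^ 2 - 2 * ξ x ^ 1 + 1 := fun x => by ring
    simp only [e1]
    rw [integral_add (f := fun x => ξ x ^ 2 - 2 * ξ x ^ 1) ((hint 2).sub ((hint 1).const_mul 2)) (integrable_const _),
      integral_sub (hint 2) ((hint 1).const_mul 2), integral_const_mul, hmom, hmom]
    simp
    norm_num
  have hi2 : Integrable (fun x => (ξ x - 1) ^ 2) μ := by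
    have e1 : ∀ x, (ξ x - 1) ^ 2 = ξ x ^ 2 - 2 * ξ x ^ 1 + 1 := fun x => by ring
    simp only [e1]
    exact ((hint 2).sub ((hint 1).const_mul 2)).add (integrable_const _)
  have h0 := (integral_eq_zero_iff_of_nonneg (fun x => sq_nonneg (ξ x - 1)) hi2).1 hvar
  refine hnd ⟨(1 - b) / a, ?_⟩
  filter_upwards [h0] with x hx
  have h1 : ξ x = 1 := by
    have : (ξ x - 1) ^ 2 = 0 := hx
    nlinarith [pow_eq_zero_iff (two_ne_zero) |>.1 this]
  have h2 : a * η 0 x ^ 2 + b = 1 := by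
    rw [hξ] at h1
    exact inv_eq_one.1 h1
  field_simp
  linarith

theorem past_obs_sub_error (M : ShiftModel μ T θ₀ η y ε h) (t : ℤ) :
    IsPastMeasurable η μ (t - 1) fun x => y t x - ε t x := by
  refine (((IsPastMeasurable.const _ θ₀.1.mu).add
    (IsPastMeasurable.finsetSum Finset.univ
      (U := fun (i : Fin p) x => θ₀.1.ar i * y (t - ((i : ℤ) + 1)) x) fun i _ =>
      (M.past_obs (by omega)).const_mul _)).add
    (IsPastMeasurable.finsetSum Finset.univ
      (U := fun (i : Fin q) x => θ₀.1.ma i * ε (t - ((i : ℤ) + 1)) x) fun i _ =>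
      (M.past_error (by omega)).const_mul _)).congr ?_
  filter_upwards [M.arma_eq] with x hx
  have := hx t
  linarith

/-- The difference between a residual and the true error, through the two ARMA recursions. -/
theorem residual_sub_error_eq (M : ShiftModel μ T θ₀ η y ε h) (H : InvertibleParams Θγ Θδ)
    {γ : ARMAParam p q} (hγ : γ ∈ Θγ) :
    ∀ᵐ x ∂μ, ∀ t, armaResidual γ (fun u => y u x) t - ε t x = (θ₀.1.mu - γ.mu)
      + ∑ i : Fin p, (θ₀.1.ar i - γ.ar i) * y (t - ((i : ℤ) + 1)) x
      + (∑ i : Fin q, θ₀.1.ma i * ε (t - ((i : ℤ) + 1)) x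
      + ∑ i : Fin q, -γ.ma i * armaResidual γ (fun u => y u x) (t - ((i : ℤ) + 1))) := by
  filter_upwards [M.arma_eq, M.tempered] with x hx hy t
  have h1 := hx t
  have h2 := H.residual_recursion hγ hy t
  simp only [sub_mul, Finset.sum_sub_distrib, neg_mul, Finset.sum_neg_distrib]
  linarith

theorem past_residual_sub_error (M : ShiftModel μ T θ₀ η y ε h) (H : InvertibleParams Θγ Θδ)
    {γ : ARMAParam p q} (hγ : γ ∈ Θγ) (t : ℤ) :
    IsPastMeasurable η μ (t - 1) fun x => armaResidual γ (fun u => y u x) t - ε t x := by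
  refine (((IsPastMeasurable.const _ (θ₀.1.mu - γ.mu)).add
    (IsPastMeasurable.finsetSum Finset.univ
      (U := fun (i : Fin p) x => (θ₀.1.ar i - γ.ar i) * y (t - ((i : ℤ) + 1)) x) fun i _ =>
      (M.past_obs (by omega)).const_mul _)).add
    ((IsPastMeasurable.finsetSum Finset.univ
      (U := fun (i : Fin q) x => θ₀.1.ma i * ε (t - ((i : ℤ) + 1)) x) fun i _ =>
      (M.past_error (by omega)).const_mul _).add
    (IsPastMeasurable.finsetSum Finset.univ
      (U := fun (i : Fin q) x => -γ.ma i * armaResidual γ (fun u => y u x) (t - ((i : ℤ) + 1)))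
      fun i _ => (M.past_residual γ (by omega)).const_mul _))).congr ?_
  filter_upwards [M.residual_sub_error_eq H hγ] with x hx using hx t

/-- `f` is an affine function of `ε_t`, with slope `b` and a predictable intercept. -/
def AffineInError (η : ℤ → S → ℝ) (μ : Measure S) (ε : ℤ → S → ℝ) (t : ℤ) (f : S → ℝ) (b : ℝ) :
    Prop :=
  IsPastMeasurable η μ (t - 1) fun x => f x - b * ε t x

theorem AffineInError.add {t : ℤ} {f g : S → ℝ} {b c : ℝ} (hf : AffineInError η μ ε t f b)
    (hg : AffineInError η μ ε t g c) : AffineInError η μ ε t (fun x => f x + g x) (b + c) :=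
  (IsPastMeasurable.add hf hg).congr (ae_of_all _ fun x => by ring)

theorem AffineInError.const_mul {t : ℤ} {f : S → ℝ} {b : ℝ} (a : ℝ)
    (hf : AffineInError η μ ε t f b) : AffineInError η μ ε t (fun x => a * f x) (a * b) :=
  (IsPastMeasurable.const_mul a hf).congr (ae_of_all _ fun x => by ring)

theorem AffineInError.of_past {t : ℤ} {f : S → ℝ} (hf : IsPastMeasurable η μ (t - 1) f) :
    AffineInError η μ ε t f 0 :=
  hf.congr (ae_of_all _ fun x => by ring)

theorem AffineInError.exists_sum {n : ℕ} {t : ℤ} {f : Fin n → S → ℝ} (a : Fin n → ℝ)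
    (hf : ∀ i, ∃ b, AffineInError η μ ε t (f i) b) :
    ∃ b, AffineInError η μ ε t (fun x => ∑ i, a i * f i x) b := by
  choose b hb using hf
  refine ⟨∑ i, a i * b i, (IsPastMeasurable.finsetSum Finset.univ fun i _ =>
    ((hb i).const_mul (a i))).congr (ae_of_all _ fun x => ?_)⟩
  simp only [Finset.sum_sub_distrib, Finset.sum_mul]

/-- One step ahead, the difference between residual and error is affine in the present error: the two
ARMA recursions involve it linearly. -/
theorem exists_affine_residual_sub_error (M : ShiftModel μ T θ₀ η y ε h)
    (H : InvertibleParams Θγ Θδ) {γ : ARMAParam p q} (hγ : γ ∈ Θγ) (t : ℤ) :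
    ∃ b, AffineInError η μ ε t
      (fun x => armaResidual γ (fun u => y u x) (t + 1) - ε (t + 1) x) b := by
  have hidx : ∀ i : ℕ, i ≠ 0 → t + 1 - ((i : ℤ) + 1) ≤ t - 1 := fun i hi => by omega
  have hidx0 : ∀ i : ℕ, i = 0 → t + 1 - ((i : ℤ) + 1) = t := fun i hi => by omega
  have hε : ∀ i : ℕ, ∃ b, AffineInError η μ ε t (ε (t + 1 - ((i : ℤ) + 1))) b := by
    intro i
    by_cases hi : i = 0
    · rw [hidx0 i hi]
      exact ⟨1, (IsPastMeasurable.const _ 0).congr (ae_of_all _ fun x => by ring)⟩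
    · exact ⟨0, AffineInError.of_past (M.past_error (hidx i hi))⟩
  have hy : ∀ i : ℕ, ∃ b, AffineInError η μ ε t (y (t + 1 - ((i : ℤ) + 1))) b := by
    intro i
    by_cases hi : i = 0
    · rw [hidx0 i hi]
      exact ⟨1, (M.past_obs_sub_error t).congr (ae_of_all _ fun x => by ring)⟩
    · exact ⟨0, AffineInError.of_past (M.past_obs (hidx i hi))⟩
  have hres : ∀ i : ℕ, ∃ b, AffineInError η μ ε t
      (fun x => armaResidual γ (fun u => y u x) (t + 1 - ((i : ℤ) + 1))) b := by
    intro i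
    by_cases hi : i = 0
    · rw [hidx0 i hi]
      exact ⟨1, (M.past_residual_sub_error H hγ t).congr (ae_of_all _ fun x => by ring)⟩
    · exact ⟨0, AffineInError.of_past (M.past_residual γ (hidx i hi))⟩
  obtain ⟨b1, h1⟩ := AffineInError.exists_sum (fun i : Fin p => θ₀.1.ar i - γ.ar i)
    (fun i : Fin p => hy i)
  obtain ⟨b2, h2⟩ := AffineInError.exists_sum θ₀.1.ma (fun i : Fin q => hε i)
  obtain ⟨b3, h3⟩ := AffineInError.exists_sum (fun i => -γ.ma i) (fun i : Fin q => hres i)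
  have h4 : AffineInError η μ ε t (fun _ => θ₀.1.mu - γ.mu) 0 :=
    AffineInError.of_past (IsPastMeasurable.const _ _)
  refine ⟨0 + b1 + (b2 + b3), IsPastMeasurable.congr ((h4.add h1).add (h2.add h3)) ?_⟩
  filter_upwards [M.residual_sub_error_eq H hγ] with x hx
  simp only [hx (t + 1)]

/-- Removing the contribution of the latest squared error from a conditional scale leaves a
predictable remainder. -/
theorem past_condScale_sub (M : ShiftModel μ T θ₀ η y ε h) (H : InvertibleParams Θγ Θδ)
    (hθ : θ ∈ Θγ ×ˢ Θδ) (hr : 0 < r) (t : ℤ) :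
    IsPastMeasurable η μ (t - 1) fun x => condScale θ (fun u => y u x) (t + 1)
      - θ.2.arch ⟨0, hr⟩ * armaResidual θ.1 (fun u => y u x) t ^ 2 := by
  refine (((IsPastMeasurable.const _ θ.2.const).add
    (IsPastMeasurable.finsetSum (Finset.univ.erase ⟨0, hr⟩)
      (U := fun (i : Fin r) x => θ.2.arch i *
        armaResidual θ.1 (fun u => y u x) (t + 1 - ((i : ℤ) + 1)) ^ 2) fun i hi =>
      (IsPastMeasurable.comp (M.past_residual θ.1 ?_) (measurable_id.pow_const 2)).const_mul _)).add
    (IsPastMeasurable.finsetSum Finset.univ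
      (U := fun (i : Fin s) x => θ.2.garch i * condScale θ (fun u => y u x) (t + 1 - ((i : ℤ) + 1)))
      fun i _ => (M.past_condScale θ (by omega)).const_mul _)).congr ?_
  · have : (i : ℕ) ≠ 0 := fun h0 => (Finset.mem_erase.1 hi).1 (Fin.ext h0)
    omega
  · filter_upwards [M.tempered] with x hy
    rw [H.scale_recursion hθ hy (t + 1), ← Finset.add_sum_erase _ _ (Finset.mem_univ ⟨0, hr⟩)]
    simp only [Nat.cast_zero, zero_add, add_sub_cancel_right]
    ring

/-- If a parameter reproduces the true scales, then it reproduces the true errors. Given the past,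
equality of the scales is a quadratic equation for the latest innovation. Either its leading terms
agree, and then the residuals are the errors; or the innovation takes only two values and the
difference between residual and error is a fixed multiple of `√h`, which would turn `h` into a
multiplicative random walk. -/
theorem residual_eq_error_of_scale_eq [IsProbabilityMeasure μ] (M : ShiftModel μ T θ₀ η y ε h)
    (H : InvertibleParams Θγ Θδ) (hθ₀ : θ₀ ∈ Θγ ×ˢ Θδ) (hθ : θ ∈ Θγ ×ˢ Θδ) (hr : 0 < r)
    (harch : 0 < θ₀.2.arch ⟨0, hr⟩) (hnd : ¬ IsDegenerate (fun x => η 0 x ^ 2) μ)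
    (hscale : ∀ᵐ x ∂μ, ∀ t, condScale θ (fun u => y u x) t = h t x) :
    ∀ᵐ x ∂μ, ∀ t, armaResidual θ.1 (fun u => y u x) t = ε t x := by
  have hP := H.positive θ₀.2 hθ₀.2
  set D : ℤ → S → ℝ := fun t x => armaResidual θ.1 (fun u => y u x) t - ε t x with hD
  have hDshift : ∀ k t x, D t (T k x) = D (t + k) x := fun k t x => by
    simp only [hD, M.shift_error, M.path_shift, armaResidual_shift θ.1 (fun u => y u x)]
  set α₀ := θ₀.2.arch ⟨0, hr⟩ with hα₀
  set α := θ.2.arch ⟨0, hr⟩ with hα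
  set c : S → ℝ := fun x => h 1 x - α₀ * ε 0 x ^ 2 with hc
  set c' : S → ℝ := fun x => h 1 x - α * (ε 0 x + D 0 x) ^ 2 with hc'
  have hcpast : IsPastMeasurable η μ (0 - 1) c := by
    refine (M.past_condScale_sub H hθ₀ hr 0).congr ?_
    filter_upwards [M.scale_eq_condScale H hθ₀, M.error_eq_residual H hθ₀] with x h1 h2
    simp only [hc, h1, h2, zero_add, hα₀]
  have hc'past : IsPastMeasurable η μ (0 - 1) c' := by
    refine (M.past_condScale_sub H hθ hr 0).congr ?_
    filter_upwards [hscale] with x h1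
    simp only [hc', hD, h1, zero_add, hα, add_sub_cancel]
  have hDpast : IsPastMeasurable η μ (0 - 1) (D 0) := M.past_residual_sub_error H hθ.1 0
  have hhpast : IsPastMeasurable η μ (0 - 1) (h 0) := M.past_scale (by omega)
  have hquad : ∀ᵐ x ∂μ, ∀ᵐ e ∂(μ.map (η 0)),
      α * (e * √(h 0 x) + D 0 x) ^ 2 + c' x = α₀ * (e * √(h 0 x)) ^ 2 + c x := by
    refine IsPastMeasurable.ae_ae M.iid ((hDpast.prodMk hhpast).prodMk (hcpast.prodMk hc'past))
      (R := fun z : ((ℝ × ℝ) × ℝ × ℝ) × ℝ => α * (z.2 * √z.1.1.2 + z.1.1.1) ^ 2 + z.1.2.2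
        = α₀ * (z.2 * √z.1.1.2) ^ 2 + z.1.2.1)
      (measurableSet_eq_fun (by fun_prop) (by fun_prop)) ?_
    filter_upwards [M.error_eq] with x hx
    simp only [hc, hc', hx 0]
    ring
  have hlin : ∀ {a b : ℝ}, (∀ᵐ e ∂(μ.map (η 0)), a * e + b = 0) → a = 0 ∧ b = 0 := fun hab =>
    affine_eq_zero_of_ae (M.iid.measurable 0) hnd hab
  by_cases hαα : α = α₀
  · have hD0 : ∀ᵐ x ∂μ, D 0 x = 0 := by
      filter_upwards [hquad, M.scale_pos hP] with x hx hpos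
      have hσ := Real.sqrt_pos.2 (hpos 0)
      have h1 := (hlin (a := 2 * α₀ * √(h 0 x) * D 0 x) (b := α₀ * D 0 x ^ 2 + c' x - c x) (by
        filter_upwards [hx] with e he
        rw [hαα] at he
        linarith)).1
      exact (mul_eq_zero.1 h1).resolve_left (by positivity)
    filter_upwards [ae_all_of_shift M.shift hDshift (R := fun a => a = 0) hD0] with x hx t
    exact sub_eq_zero.1 (hx t)
  exfalso
  have ha : α - α₀ ≠ 0 := sub_ne_zero.2 hαα
  set a := α - α₀ with hadef
  -- the innovation solves a fixed quadratic equation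
  obtain ⟨κ₀, g, hquad₀⟩ : ∃ κ₀ g : ℝ, ∀ᵐ e ∂(μ.map (η 0)), e ^ 2 + 2 * κ₀ * e + g = 0 := by
    obtain ⟨x, hx, hpos⟩ := (hquad.and (M.scale_pos hP)).exists
    have hσ := Real.sqrt_pos.2 (hpos 0)
    refine ⟨α * D 0 x / (a * √(h 0 x)), (α * D 0 x ^ 2 + c' x - c x) / (a * √(h 0 x) ^ 2), ?_⟩
    filter_upwards [hx] with e he
    have h1 : a * √(h 0 x) ^ 2 * e ^ 2 + 2 * α * √(h 0 x) * D 0 x * e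
        + (α * D 0 x ^ 2 + c' x - c x) = 0 := by
      rw [hadef]; linarith
    field_simp
    linarith
  have hκ₀ : κ₀ ≠ 0 := by
    rintro rfl
    refine not_ae_sq_eq_const (M.iid.measurable 0) hnd (-g) ?_
    filter_upwards [hquad₀] with e he
    linarith
  have hDσ : ∀ᵐ x ∂μ, α * D 0 x = a * κ₀ * √(h 0 x) := by
    filter_upwards [hquad, M.scale_pos hP] with x hx hpos
    have hσ := Real.sqrt_pos.2 (hpos 0)
    have h1 := (hlin (a := 2 * √(h 0 x) * (α * D 0 x - a * κ₀ * √(h 0 x)))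
      (b := α * D 0 x ^ 2 + c' x - c x - a * √(h 0 x) ^ 2 * g) (by
        filter_upwards [hx, hquad₀] with e he he2
        rw [hadef]
        linear_combination he - (α - α₀) * √(h 0 x) ^ 2 * he2)).1
    have := (mul_eq_zero.1 h1).resolve_left (by positivity)
    linarith
  have hα0 : α ≠ 0 := by
    intro h0
    obtain ⟨x, hx, hpos⟩ := (hDσ.and (M.scale_pos hP)).exists
    have hσ := Real.sqrt_pos.2 (hpos 0)
    rw [h0, zero_mul] at hx
    exact mul_ne_zero (mul_ne_zero ha hκ₀) hσ.ne' hx.symm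
  set κ := a * κ₀ / α with hκ
  have hκ0 : κ ≠ 0 := div_ne_zero (mul_ne_zero ha hκ₀) hα0
  have hDall : ∀ᵐ x ∂μ, ∀ t, D t x = κ * √(h t x) := by
    refine ae_all_of_shift M.shift (e := fun t x => (D t x, h t x))
      (fun k t x => by rw [hDshift, M.shift_scale]) (R := fun z => z.1 = κ * √z.2) (t₀ := 0) ?_
    filter_upwards [hDσ] with x hx
    simp only [hκ]
    field_simp
    linarith
  -- one step later, `D` is affine in the error while `h` is quadratic
  obtain ⟨b, hb⟩ := M.exists_affine_residual_sub_error H hθ.1 0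
  set G : S → ℝ := fun x => D 1 x - b * ε 0 x with hG
  have hGpast : IsPastMeasurable η μ (0 - 1) G := by
    refine IsPastMeasurable.congr hb (ae_of_all _ fun x => ?_)
    simp only [hG, hD, zero_add]
  have hquad1 : ∀ᵐ x ∂μ, ∀ᵐ e ∂(μ.map (η 0)),
      κ ^ 2 * (α₀ * (e * √(h 0 x)) ^ 2 + c x) = (b * (e * √(h 0 x)) + G x) ^ 2 := by
    refine IsPastMeasurable.ae_ae M.iid ((hGpast.prodMk hhpast).prodMk hcpast)
      (R := fun z : ((ℝ × ℝ) × ℝ) × ℝ => κ ^ 2 * (α₀ * (z.2 * √z.1.1.2) ^ 2 + z.1.2)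
        = (b * (z.2 * √z.1.1.2) + z.1.1.1) ^ 2)
      (measurableSet_eq_fun (by fun_prop) (by fun_prop)) ?_
    filter_upwards [M.error_eq, hDall, M.scale_pos hP] with x hx hx1 hpos
    have e1 : κ ^ 2 * h 1 x = D 1 x ^ 2 := by
      rw [hx1 1, mul_pow, Real.sq_sqrt (hpos 1).le]
    simp only [hc, hG, ← hx 0]
    linear_combination e1
  set m := κ ^ 2 * α₀ - b ^ 2 with hm
  have hcoef : ∀ᵐ x ∂μ, b * G x = -κ₀ * m * √(h 0 x) ∧
      κ ^ 2 * c x = G x ^ 2 + g * m * h 0 x := by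
    filter_upwards [hquad1, M.scale_pos hP] with x hx hpos
    have hσ := Real.sqrt_pos.2 (hpos 0)
    have hσ2 := Real.sq_sqrt (hpos 0).le
    have h1 := hlin (a := -2 * √(h 0 x) * (κ₀ * m * √(h 0 x) + b * G x))
      (b := κ ^ 2 * c x - G x ^ 2 - g * m * h 0 x) (by
        filter_upwards [hx, hquad₀] with e he he2
        rw [hm]
        linear_combination he - (κ ^ 2 * α₀ - b ^ 2) * √(h 0 x) ^ 2 * he2
          + g * (κ ^ 2 * α₀ - b ^ 2) * hσ2)
    refine ⟨?_, by linarith [h1.2]⟩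
    have := (mul_eq_zero.1 h1.1).resolve_left (by nlinarith)
    linarith
  have hb0 : b ≠ 0 := by
    rintro rfl
    obtain ⟨x, hx, hpos⟩ := (hcoef.and (M.scale_pos hP)).exists
    have hσ := Real.sqrt_pos.2 (hpos 0)
    have hm0 : m ≠ 0 := by
      rw [hm]
      have : 0 < κ ^ 2 * α₀ := by positivity
      simpa using this.ne'
    have h1 := hx.1
    rw [zero_mul] at h1
    exact mul_ne_zero (mul_ne_zero (neg_ne_zero.2 hκ₀) hm0) hσ.ne' h1.symm
  refine M.not_multiplicative hP hnd (a := α₀) (b := ((κ₀ * m / b) ^ 2 + g * m) / κ ^ 2)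
    harch.ne' ?_
  filter_upwards [hcoef, M.error_eq, M.scale_pos hP] with x hx hε hpos
  have hσ2 := Real.sq_sqrt (hpos 0).le
  have hG2 : G x ^ 2 = (κ₀ * m / b) ^ 2 * h 0 x := by
    have : G x = -(κ₀ * m / b) * √(h 0 x) := by
      field_simp
      linarith [hx.1]
    rw [this, mul_pow, neg_sq, hσ2]
  have hcx : c x = ((κ₀ * m / b) ^ 2 + g * m) / κ ^ 2 * h 0 x := by
    rw [div_mul_eq_mul_div, eq_div_iff (by positivity)]
    linarith [hx.2]
  have hh : h 1 x = α₀ * ε 0 x ^ 2 + c x := by simp only [hc]; ring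
  rw [hh, hcx, hε 0, mul_pow, hσ2]
  ring

/-- The parameter is determined by the conditional scales. -/
theorem eq_of_scale_eq [IsProbabilityMeasure μ] (M : ShiftModel μ T θ₀ η y ε h)
    (H : InvertibleParams Θγ Θδ) (hθ₀ : θ₀ ∈ Θγ ×ˢ Θδ) (hθ : θ ∈ Θγ ×ˢ Θδ) (hr : 0 < r)
    (harch : 0 < θ₀.2.arch ⟨0, hr⟩) (hnd : ¬ IsDegenerate (fun x => η 0 x ^ 2) μ)
    (hγ : ∀ γ ∈ Θγ, NoCommonRoot γ.arPoly γ.maPoly)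
    (hδ : ∀ δ ∈ Θδ, NoCommonRoot δ.archPoly δ.garchPoly)
    (hscale : ∀ᵐ x ∂μ, ∀ t, condScale θ (fun u => y u x) t = h t x) : θ = θ₀ := by
  have hP := H.positive θ₀.2 hθ₀.2
  have hres := M.residual_eq_error_of_scale_eq H hθ₀ hθ hr harch hnd hscale
  have hres₀ := M.error_eq_residual H hθ₀
  have harma : ∀ γ ∈ Θγ, (∀ᵐ x ∂μ, ∀ t, armaResidual γ (fun u => y u x) t = ε t x) →
      ∀ᵐ x ∂μ, Polynomial.aeval backshift γ.arPoly (fun u => y u x)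
        = (fun _ => γ.mu) + Polynomial.aeval backshift γ.maPoly (fun u => ε u x) := by
    intro γ hγ' he
    filter_upwards [he, M.tempered] with x hx hy
    funext t
    have h1 := H.residual_recursion hγ' hy t
    simp only [hx] at h1
    simp only [ARMAParam.arPoly, ARMAParam.maPoly, map_sub, map_add, map_one, LinearMap.sub_apply,
      LinearMap.add_apply, Module.End.one_apply, Pi.add_apply, Pi.sub_apply,
      aeval_backshift_lagPoly]
    linarith
  have hgarch : ∀ θ' ∈ Θγ ×ˢ Θδ, (∀ᵐ x ∂μ, ∀ t, armaResidual θ'.1 (fun u => y u x) t = ε t x) →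
      (∀ᵐ x ∂μ, ∀ t, condScale θ' (fun u => y u x) t = h t x) →
      ∀ᵐ x ∂μ, Polynomial.aeval backshift θ'.2.garchPoly (fun u => h u x)
        = (fun _ => θ'.2.const)
          + Polynomial.aeval backshift θ'.2.archPoly (fun u => ε u x ^ 2) := by
    intro θ' hθ' he hs
    filter_upwards [he, hs, M.tempered] with x hx hx' hy
    funext t
    have h1 := H.scale_recursion hθ' hy t
    simp only [hx, hx'] at h1
    simp only [GARCHParam.archPoly, GARCHParam.garchPoly, map_sub, map_one, LinearMap.sub_apply,
      Module.End.one_apply, Pi.add_apply, Pi.sub_apply, aeval_backshift_lagPoly]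
    linarith
  have hres₀' : ∀ᵐ x ∂μ, ∀ t, armaResidual θ₀.1 (fun u => y u x) t = ε t x := by
    filter_upwards [hres₀] with x hx t using (hx t).symm
  have hscale₀ : ∀ᵐ x ∂μ, ∀ t, condScale θ₀ (fun u => y u x) t = h t x := by
    filter_upwards [M.scale_eq_condScale H hθ₀] with x hx t using (hx t).symm
  have har0 : ∀ γ : ARMAParam p q, γ.arPoly.coeff 0 = 1 := fun γ => by
    simp [ARMAParam.arPoly, coeff_zero_lagPoly]
  have hga0 : ∀ δ : GARCHParam r s, δ.garchPoly.coeff 0 = 1 := fun δ => by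
    simp [GARCHParam.garchPoly, coeff_zero_lagPoly]
  obtain ⟨h1, h2⟩ := lag_polynomials_unique (fun t => M.past_error le_rfl)
    (M.not_past_error hP hnd) (hγ _ hθ₀.1).isCoprime (hγ _ hθ.1).isCoprime (har0 _) (har0 _)
    (harma _ hθ₀.1 hres₀') (harma _ hθ.1 hres)
  obtain ⟨h3, h4⟩ := lag_polynomials_unique (v := fun t x => ε t x ^ 2)
    (fun t => (M.past_error le_rfl).comp (measurable_id.pow_const 2))
    (M.not_past_error_sq hP hnd) (hδ _ hθ₀.2).isCoprime.symm (hδ _ hθ.2).isCoprime.symm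
    (hga0 _) (hga0 _) (hgarch _ hθ₀ hres₀' hscale₀) (hgarch _ hθ hres hscale)
  have har : θ.1.ar = θ₀.1.ar := lagPoly_injective (sub_right_injective h1)
  have hma : θ.1.ma = θ₀.1.ma := lagPoly_injective (add_right_injective _ h2)
  have hga : θ.2.garch = θ₀.2.garch := lagPoly_injective (sub_right_injective h3)
  have hal : θ.2.arch = θ₀.2.arch := lagPoly_injective h4
  have hmu : θ.1.mu = θ₀.1.mu := by
    obtain ⟨x, e1, e2⟩ := ((harma _ hθ₀.1 hres₀').and (harma _ hθ.1 hres)).exists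
    rw [h1, h2, e1] at e2
    exact (congrFun (add_right_cancel e2) 0).symm
  have hco : θ.2.const = θ₀.2.const := by
    obtain ⟨x, e1, e2⟩ := ((hgarch _ hθ₀ hres₀' hscale₀).and (hgarch _ hθ hres hscale)).exists
    rw [h3, h4, e1] at e2
    exact (congrFun (add_right_cancel e2) 0).symm
  exact Prod.ext (Prod.ext hmu (Prod.ext har hma)) (Prod.ext hco (Prod.ext hal hga))

end ShiftModel

/-! ### The limit criterion -/

/-- A median minimises the mean absolute deviation. -/
theorem integral_abs_le_integral_abs_add {ν : Measure ℝ} [IsProbabilityMeasure ν]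
    (hint : Integrable (fun e => |e|) ν) (hle : 1 / 2 ≤ ν.real {e | e ≤ 0})
    (hge : 1 / 2 ≤ ν.real {e | 0 ≤ e}) (d : ℝ) : ∫ e, |e| ∂ν ≤ ∫ e, |e + d| ∂ν := by
  have hid : Integrable (fun e : ℝ => e) ν :=
    (integrable_norm_iff aestronglyMeasurable_id).1 hint
  have hint' : Integrable (fun e => |e + d|) ν := (hid.add (integrable_const d)).abs
  -- it suffices to find a half line of mass at least `1/2` on which `|e|` increases at full speed
  have key : ∀ A : Set ℝ, MeasurableSet A → 1 / 2 ≤ ν.real A →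
      (∀ e ∈ A, |e| + |d| ≤ |e + d|) → ∫ e, |e| ∂ν ≤ ∫ e, |e + d| ∂ν := by
    intro A hA hhalf hd
    have h1 : ∀ e, |e| + (A.indicator (fun _ => 2 * |d|) e - |d|) ≤ |e + d| := by
      intro e
      by_cases he : e ∈ A
      · rw [Set.indicator_of_mem he]; linarith [hd e he]
      · rw [Set.indicator_of_notMem he]
        have := abs_sub_abs_le_abs_sub e (-d)
        rw [abs_neg, sub_neg_eq_add] at this
        linarith
    have hiA : Integrable (A.indicator fun _ => 2 * |d|) ν := (integrable_const _).indicator hA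
    have h2 := integral_mono (hint.add (hiA.sub (integrable_const _))) hint' h1
    simp only [Pi.add_apply, Pi.sub_apply] at h2
    rw [integral_add (g := fun e => A.indicator (fun _ => 2 * |d|) e - |d|) hint
      (hiA.sub (integrable_const |d|)), integral_sub hiA (integrable_const |d|), integral_indicator hA, setIntegral_const] at h2
    simp only [integral_const, probReal_univ, smul_eq_mul, one_mul] at h2
    nlinarith [abs_nonneg d]
  rcases le_total 0 d with hd | hd
  · refine key {e | 0 ≤ e} measurableSet_Ici hge fun e he => ?_
    have he' : 0 ≤ e := he
    rw [abs_of_nonneg he', abs_of_nonneg hd, abs_of_nonneg (by linarith)]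
  · refine key {e | e ≤ 0} measurableSet_Iic hle fun e he => ?_
    have he' : e ≤ 0 := he
    rw [abs_of_nonpos he', abs_of_nonpos hd, abs_of_nonpos (by linarith)]
    linarith

/-- The Laplace criterion is minimal at the true scale. -/
theorem log_add_one_le {σ τ J : ℝ} (hσ : 0 < σ) (hτ : 0 < τ) (hJ : σ ≤ J) :
    Real.log σ + 1 ≤ Real.log τ + J / τ := by
  have h1 := Real.log_le_sub_one_of_pos (div_pos hσ hτ)
  rw [Real.log_div hσ.ne' hτ.ne'] at h1
  have h2 : σ / τ ≤ J / τ := by gcongr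
  linarith

theorem eq_of_log_add_one_eq {σ τ J : ℝ} (hσ : 0 < σ) (hτ : 0 < τ) (hJ : σ ≤ J)
    (h : Real.log σ + 1 = Real.log τ + J / τ) : σ = τ := by
  by_contra hne
  have h1 := Real.log_lt_sub_one_of_pos (div_pos hσ hτ) (by rwa [ne_eq, div_eq_one_iff_eq hτ.ne'])
  rw [Real.log_div hσ.ne' hτ.ne'] at h1
  have h2 : σ / τ ≤ J / τ := by gcongr
  linarith

theorem InvertibleParams.exists_const_lower_bound {p q r s : ℕ} {Θγ : Set (ARMAParam p q)}
    {Θδ : Set (GARCHParam r s)} (H : InvertibleParams Θγ Θδ) :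
    ∃ a : ℝ, 0 < a ∧ ∀ δ ∈ Θδ, a ≤ δ.const := by
  by_cases hne : Θδ.Nonempty
  · obtain ⟨δ, hδ, hmin⟩ := H.compact_garch.exists_isMinOn hne
      (f := fun δ : GARCHParam r s => δ.const) (by fun_prop)
    exact ⟨δ.const, (H.positive δ hδ).const_pos, fun δ' hδ' => hmin hδ'⟩
  · exact ⟨1, one_pos, fun δ hδ => absurd ⟨δ, hδ⟩ hne⟩

/-- The weighted loss is bounded below on the parameter set, because the weights are bounded above
and the scales are bounded away from zero. -/
theorem InvertibleParams.exists_loss_lower_bound {p q r s : ℕ} {Θγ : Set (ARMAParam p q)}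
    {Θδ : Set (GARCHParam r s)} (H : InvertibleParams Θγ Θδ) {w : (ℕ → ℝ) → ℝ}
    (hw_pos : ∀ x, 0 < w x) (hw_bdd : ∃ M : ℝ, ∀ x, w x ≤ M) :
    ∃ a K : ℝ, 0 < a ∧ (∀ δ ∈ Θδ, a ≤ δ.const) ∧
      ∀ H' J : ℝ, a ≤ H' → 0 ≤ J → ∀ v, 0 ≤ w v * (Real.log √H' + J / √H') + K := by
  obtain ⟨a, ha, hle⟩ := H.exists_const_lower_bound
  obtain ⟨B, hB⟩ := hw_bdd
  refine ⟨a, B * |Real.log √a|, ha, hle, fun H' J hH' hJ v => ?_⟩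
  have hsa : 0 < √a := Real.sqrt_pos.2 ha
  have h1 : Real.log √a ≤ Real.log √H' := Real.log_le_log hsa (Real.sqrt_le_sqrt hH')
  have h2 : 0 ≤ J / √H' := by positivity
  have h3 : -|Real.log √a| ≤ Real.log √H' + J / √H' := by linarith [neg_abs_le (Real.log √a)]
  have h4 : w v * |Real.log √a| ≤ B * |Real.log √a| :=
    mul_le_mul_of_nonneg_right (hB v) (abs_nonneg _)
  have h5 := mul_le_mul_of_nonneg_left h3 (hw_pos v).le
  linarith

namespace ShiftModel

variable {S : Type*} [MeasurableSpace S] {μ : Measure S} {T : ℤ → S → S} {p q r s : ℕ}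
  {θ₀ θ : ARMAGARCHParam p q r s} {η y ε h : ℤ → S → ℝ} {Θγ : Set (ARMAParam p q)}
  {Θδ : Set (GARCHParam r s)}

/-- Integrating the present innovation out of the expected loss: what remains is the loss with the
absolute residual replaced by its conditional mean `∫ |e √h + D| dν(e)`. -/
theorem lintegral_loss_eq [IsProbabilityMeasure μ] (M : ShiftModel μ T θ₀ η y ε h)
    (H : InvertibleParams Θγ Θδ) (hθ : θ ∈ Θγ ×ˢ Θδ) {w : (ℕ → ℝ) → ℝ} (hw : Measurable w)
    {a K : ℝ} (ha : ∀ δ ∈ Θδ, a ≤ δ.const)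
    (hK : ∀ H' J : ℝ, a ≤ H' → 0 ≤ J → ∀ v, 0 ≤ w v * (Real.log √H' + J / √H') + K)
    (hint : Integrable (fun e : ℝ => |e|) (μ.map (η 0))) (t : ℤ) :
    ∫⁻ x, ENNReal.ofReal (weightAt w (fun u => y u x) t * laplaceLoss θ (fun u => y u x) t + K) ∂μ
      = ∫⁻ x, ENNReal.ofReal (weightAt w (fun u => y u x) t *
        (Real.log √(condScale θ (fun u => y u x) t)
          + (∫ e, |e * √(h t x) + (armaResidual θ.1 (fun u => y u x) t - ε t x)| ∂(μ.map (η 0)))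
            / √(condScale θ (fun u => y u x) t)) + K) ∂μ := by
  have : IsProbabilityMeasure (μ.map (η 0)) :=
    Measure.isProbabilityMeasure_map (M.iid.measurable 0).aemeasurable
  have hU : IsPastMeasurable η μ (t - 1) fun x => ((weightAt w (fun u => y u x) t,
      condScale θ (fun u => y u x) t), (h t x, armaResidual θ.1 (fun u => y u x) t - ε t x)) :=
    ((M.past_weight hw (by omega)).prodMk (M.past_condScale θ (by omega))).prodMk
      ((M.past_scale (by omega)).prodMk (M.past_residual_sub_error H hθ.1 t))
  set f : ((ℝ × ℝ) × ℝ × ℝ) × ℝ → ENNReal := fun z => ENNReal.ofReal (z.1.1.1 *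
    (Real.log √z.1.1.2 + |z.2 * √z.1.2.1 + z.1.2.2| / √z.1.1.2) + K) with hf
  have hfm : Measurable f := by
    rw [hf]; fun_prop
  have h1 := IsPastMeasurable.lintegral_eq M.iid hU hfm
  have h2 : ∫⁻ x, ENNReal.ofReal
      (weightAt w (fun u => y u x) t * laplaceLoss θ (fun u => y u x) t + K) ∂μ
      = ∫⁻ x, f (((weightAt w (fun u => y u x) t, condScale θ (fun u => y u x) t),
        (h t x, armaResidual θ.1 (fun u => y u x) t - ε t x)), η t x) ∂μ := by
    refine lintegral_congr_ae ?_
    filter_upwards [M.error_eq] with x hx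
    simp only [hf, laplaceLoss, ← hx t, add_sub_cancel]
  rw [h2, h1]
  refine lintegral_congr_ae ?_
  filter_upwards [M.tempered] with x hy
  have hlow : a ≤ condScale θ (fun u => y u x) t :=
    (ha _ hθ.2).trans (H.const_le_condScale hθ hy t)
  set σ := √(h t x)
  set D := armaResidual θ.1 (fun u => y u x) t - ε t x
  set C := condScale θ (fun u => y u x) t
  have hid : Integrable (fun e : ℝ => e) (μ.map (η 0)) :=
    (integrable_norm_iff aestronglyMeasurable_id).1 hint
  have hJ : Integrable (fun e => |e * σ + D|) (μ.map (η 0)) :=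
    ((hid.mul_const σ).add (integrable_const D)).abs
  have hI : Integrable (fun e => weightAt w (fun u => y u x) t *
      (Real.log √C + |e * σ + D| / √C) + K) (μ.map (η 0)) :=
    (((integrable_const _).add (hJ.div_const _)).const_mul _).add (integrable_const _)
  simp only [hf]
  rw [← ofReal_integral_eq_lintegral_ofReal hI
    (ae_of_all _ fun e => hK C _ hlow (abs_nonneg _) _)]
  congr 1
  rw [integral_add (f := fun e => weightAt w (fun u => y u x) t *
      (Real.log √C + |e * σ + D| / √C)) (((integrable_const _).add (hJ.div_const _)).const_mul _)
      (integrable_const _), integral_const_mul,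
    integral_add (f := fun _ => Real.log √C) (integrable_const _) (hJ.div_const _), integral_div]
  simp

theorem le_integral_abs [IsProbabilityMeasure μ] (M : ShiftModel μ T θ₀ η y ε h)
    (hmedian : HasMedianZero (η 0) μ) (hint : Integrable (fun e : ℝ => |e|) (μ.map (η 0)))
    (habs : ∫ e, |e| ∂(μ.map (η 0)) = 1) {σ : ℝ} (hσ : 0 < σ) (D : ℝ) :
    σ ≤ ∫ e, |e * σ + D| ∂(μ.map (η 0)) := by
  have hm := M.iid.measurable 0
  have : IsProbabilityMeasure (μ.map (η 0)) := Measure.isProbabilityMeasure_map hm.aemeasurable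
  have h1 := integral_abs_le_integral_abs_add hint
    (hmedian.1.trans_eq (map_measureReal_apply hm measurableSet_Iic).symm)
    (hmedian.2.trans_eq (map_measureReal_apply hm measurableSet_Ici).symm) (D / σ)
  have h2 : ∀ e : ℝ, |e * σ + D| = σ * |e + D / σ| := fun e => by
    rw [← abs_of_pos hσ, ← abs_mul, abs_of_pos hσ]
    congr 1
    field_simp
  simp only [h2, integral_const_mul]
  rw [habs] at h1
  exact le_mul_of_one_le_right hσ.le h1

theorem lintegral_true_loss_eq [IsProbabilityMeasure μ] (M : ShiftModel μ T θ₀ η y ε h)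
    (H : InvertibleParams Θγ Θδ) (hθ₀ : θ₀ ∈ Θγ ×ˢ Θδ) {w : (ℕ → ℝ) → ℝ} (hw : Measurable w)
    {a K : ℝ} (ha : ∀ δ ∈ Θδ, a ≤ δ.const)
    (hK : ∀ H' J : ℝ, a ≤ H' → 0 ≤ J → ∀ v, 0 ≤ w v * (Real.log √H' + J / √H') + K)
    (hint : Integrable (fun e : ℝ => |e|) (μ.map (η 0)))
    (habs : ∫ e, |e| ∂(μ.map (η 0)) = 1) (t : ℤ) :
    ∫⁻ x, ENNReal.ofReal (weightAt w (fun u => y u x) t * laplaceLoss θ₀ (fun u => y u x) t + K) ∂μ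
      = ∫⁻ x, ENNReal.ofReal (weightAt w (fun u => y u x) t * (Real.log √(h t x) + 1) + K) ∂μ := by
  rw [M.lintegral_loss_eq H hθ₀ hw ha hK hint t]
  refine lintegral_congr_ae ?_
  filter_upwards [M.error_eq_residual H hθ₀, M.scale_eq_condScale H hθ₀,
    M.scale_pos (H.positive _ hθ₀.2)] with x h1 h2 h3
  have hσ := Real.sqrt_pos.2 (h3 t)
  have h4 : ∀ e : ℝ, |e * √(h t x)| = √(h t x) * |e| := fun e => by
    rw [abs_mul, abs_of_pos hσ, mul_comm]
  rw [← h1 t, ← h2 t]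
  simp only [sub_self, add_zero, h4, integral_const_mul, habs, mul_one, div_self hσ.ne']

/-- Finiteness of the expected loss at the true parameter. -/
theorem lintegral_true_loss_lt_top [IsProbabilityMeasure μ] (M : ShiftModel μ T θ₀ η y ε h)
    (H : InvertibleParams Θγ Θδ) (hθ₀ : θ₀ ∈ Θγ ×ˢ Θδ) {w : (ℕ → ℝ) → ℝ} (hw : Measurable w)
    (hw_pos : ∀ x, 0 < w x) (hw_bdd : ∃ M : ℝ, ∀ x, w x ≤ M)
    {a K : ℝ} (ha : ∀ δ ∈ Θδ, a ≤ δ.const)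
    (hK : ∀ H' J : ℝ, a ≤ H' → 0 ≤ J → ∀ v, 0 ≤ w v * (Real.log √H' + J / √H') + K)
    (hint : Integrable (fun e : ℝ => |e|) (μ.map (η 0)))
    (habs : ∫ e, |e| ∂(μ.map (η 0)) = 1) (t : ℤ)
    (hweight : ∀ ρ : ℝ, 0 < ρ → ρ < 1 → ∫⁻ x, ENNReal.ofReal
      (weightAt w (fun u => y u x) t * envelope ρ (fun u => y u x) (t - 1)) ∂μ < ⊤) :
    ∫⁻ x, ENNReal.ofReal
      (weightAt w (fun u => y u x) t * laplaceLoss θ₀ (fun u => y u x) t + K) ∂μ < ⊤ := by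
  rw [M.lintegral_true_loss_eq H hθ₀ hw ha hK hint habs t]
  obtain ⟨ρ, C, h0, h1, hC, -, -, hsc⟩ := H.exists_scale_bound
  obtain ⟨B, hB⟩ := hw_bdd
  have hle : ∀ᵐ x ∂μ, ENNReal.ofReal (weightAt w (fun u => y u x) t * (Real.log √(h t x) + 1) + K)
      ≤ ENNReal.ofReal √C * ENNReal.ofReal
        (weightAt w (fun u => y u x) t * envelope ρ (fun u => y u x) (t - 1))
        + ENNReal.ofReal (B + |K|) := by
    filter_upwards [M.scale_eq_condScale H hθ₀, M.tempered, M.scale_pos (H.positive _ hθ₀.2)]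
      with x hx hy hpos
    have hE := one_le_envelope h0.le (fun u => y u x) (t - 1)
    set E := envelope ρ (fun u => y u x) (t - 1)
    set W := weightAt w (fun u => y u x) t
    have hW : 0 < W := hw_pos _
    have hWB : W ≤ B := hB _
    rw [← ENNReal.ofReal_mul (Real.sqrt_nonneg _), ← ENNReal.ofReal_add (by positivity)
      (by have := abs_nonneg K; linarith)]
    refine ENNReal.ofReal_le_ofReal ?_
    have hσ := Real.sqrt_pos.2 (hpos t)
    have h2 : √(h t x) ≤ √C * E := by
      rw [← Real.sqrt_sq (show 0 ≤ E by linarith), ← Real.sqrt_mul hC.le]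
      refine Real.sqrt_le_sqrt ?_
      rw [hx t]
      exact (le_abs_self _).trans (hsc θ₀.1 hθ₀.1 θ₀.2 hθ₀.2 _ hy t)
    have h3 := Real.log_le_sub_one_of_pos hσ
    have h4 : W * Real.log √(h t x) ≤ W * (√C * E) := mul_le_mul_of_nonneg_left (by linarith) hW.le
    have h5 := le_abs_self K
    linarith
  refine (lintegral_mono_ae hle).trans_lt ?_
  rw [lintegral_add_right _ measurable_const, lintegral_const_mul' _ _ ENNReal.ofReal_ne_top]
  refine ENNReal.add_lt_top.2 ⟨ENNReal.mul_lt_top ENNReal.ofReal_lt_top (hweight ρ h0 h1), ?_⟩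
  rw [lintegral_const, measure_univ, mul_one]
  exact ENNReal.ofReal_lt_top

/-- The expected loss has a strict minimum at the true parameter. -/
theorem lintegral_loss_lt [IsProbabilityMeasure μ] (M : ShiftModel μ T θ₀ η y ε h)
    (H : InvertibleParams Θγ Θδ) (hθ₀ : θ₀ ∈ Θγ ×ˢ Θδ) (hθ : θ ∈ Θγ ×ˢ Θδ) (hne : θ ≠ θ₀)
    (hr : 0 < r) (harch : 0 < θ₀.2.arch ⟨0, hr⟩)
    (hnd : ¬ IsDegenerate (fun x => η 0 x ^ 2) μ)
    (hγ : ∀ γ ∈ Θγ, NoCommonRoot γ.arPoly γ.maPoly)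
    (hδ : ∀ δ ∈ Θδ, NoCommonRoot δ.archPoly δ.garchPoly)
    {w : (ℕ → ℝ) → ℝ} (hw : Measurable w) (hw_pos : ∀ x, 0 < w x)
    {a K : ℝ} (ha0 : 0 < a) (ha : ∀ δ ∈ Θδ, a ≤ δ.const)
    (hK : ∀ H' J : ℝ, a ≤ H' → 0 ≤ J → ∀ v, 0 ≤ w v * (Real.log √H' + J / √H') + K)
    (hmedian : HasMedianZero (η 0) μ)
    (hint : Integrable (fun e : ℝ => |e|) (μ.map (η 0)))
    (habs : ∫ e, |e| ∂(μ.map (η 0)) = 1) (t : ℤ)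
    (hfin : ∫⁻ x, ENNReal.ofReal
      (weightAt w (fun u => y u x) t * laplaceLoss θ₀ (fun u => y u x) t + K) ∂μ < ⊤) :
    ∫⁻ x, ENNReal.ofReal
      (weightAt w (fun u => y u x) t * laplaceLoss θ₀ (fun u => y u x) t + K) ∂μ
    < ∫⁻ x, ENNReal.ofReal
      (weightAt w (fun u => y u x) t * laplaceLoss θ (fun u => y u x) t + K) ∂μ := by
  by_contra! hcon
  have hP := H.positive _ hθ₀.2
  rw [M.lintegral_true_loss_eq H hθ₀ hw ha hK hint habs t] at hfin hcon
  rw [M.lintegral_loss_eq H hθ hw ha hK hint t] at hcon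
  have hJ : ∀ᵐ x ∂μ, √(h t x) ≤ ∫ e, |e * √(h t x)
      + (armaResidual θ.1 (fun u => y u x) t - ε t x)| ∂(μ.map (η 0)) := by
    filter_upwards [M.scale_pos hP] with x hx
    exact M.le_integral_abs hmedian hint habs (Real.sqrt_pos.2 (hx t)) _
  have hpos : ∀ᵐ x ∂μ, a ≤ condScale θ (fun u => y u x) t := by
    filter_upwards [M.tempered] with x hy
    exact (ha _ hθ.2).trans (H.const_le_condScale hθ hy t)
  have hmeas : Measurable fun x => ∫ e, |e * √(h t x)
      + (armaResidual θ.1 (fun u => y u x) t - ε t x)| ∂(μ.map (η 0)) := by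
    have : IsProbabilityMeasure (μ.map (η 0)) :=
      Measure.isProbabilityMeasure_map (M.iid.measurable 0).aemeasurable
    refine (StronglyMeasurable.integral_prod_right' (f := fun z : S × ℝ => |z.2 * √(h t z.1)
      + (armaResidual θ.1 (fun u => y u z.1) t - ε t z.1)|) ?_).measurable
    refine Measurable.stronglyMeasurable ?_
    have hfst : Measurable (Prod.fst : S × ℝ → S) := measurable_fst
    have h1 := (M.measurable_scale t).comp hfst
    have h2 := ((measurable_armaResidual θ.1 t).comp M.measurable_path).comp hfst
    have h3 := (M.measurable_error t).comp hfst
    exact ((measurable_snd.mul h1.sqrt).add (h2.sub h3)).abs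
  have hcm := (measurable_condScale θ t).comp M.measurable_path
  have hwm := (measurable_weightAt hw t).comp M.measurable_path
  have heq := ae_eq_of_ae_le_of_lintegral_le ?_ hfin.ne ?_ hcon
  · refine hne (M.eq_of_scale_eq H hθ₀ hθ hr harch hnd hγ hδ ?_)
    refine ae_all_of_shift M.shift
      (e := fun t x => (condScale θ (fun u => y u x) t, h t x)) (fun k t x => by
        rw [M.shift_scale, M.path_shift, condScale_shift θ (fun u => y u x)])
      (R := fun z => z.1 = z.2) (t₀ := t) ?_
    filter_upwards [heq, hJ, hpos, M.const_le_scale hP, M.scale_pos hP]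
      with x hx hJx hposx hc hsp
    have hτ : 0 < √(condScale θ (fun u => y u x) t) := Real.sqrt_pos.2 (ha0.trans_le hposx)
    have hσ := Real.sqrt_pos.2 (hsp t)
    have hsplit : Real.log √(h t x) + 1 = Real.log √(h t x) + √(h t x) / √(h t x) := by
      rw [div_self hσ.ne']
    have hn₀ := hK _ _ ((ha _ hθ₀.2).trans (hc t)) hσ.le fun i : ℕ => y (t - 1 - i) x
    rw [← hsplit] at hn₀
    have hn := hK _ _ hposx (hσ.le.trans hJx) fun i : ℕ => y (t - 1 - i) x
    have hx := (ENNReal.ofReal_eq_ofReal_iff hn₀ hn).1 hx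
    have h1 := eq_of_log_add_one_eq hσ hτ hJx
      (mul_left_cancel₀ (hw_pos _).ne' (add_right_cancel hx))
    exact ((Real.sqrt_inj (hsp t).le (ha0.trans_le hposx).le).1 h1).symm
  · filter_upwards [hJ, hpos, M.scale_pos hP] with x hJx hposx hsp
    refine ENNReal.ofReal_le_ofReal ?_
    have := mul_le_mul_of_nonneg_left (log_add_one_le (Real.sqrt_pos.2 (hsp t))
      (Real.sqrt_pos.2 (ha0.trans_le hposx)) hJx) (hw_pos fun i : ℕ => y (t - 1 - i) x).le
    exact add_le_add this le_rfl
  · exact ((hwm.mul (hcm.sqrt.log.add (hmeas.div hcm.sqrt))).add_const K).ennreal_ofReal.aemeasurable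

end ShiftModel

/-! ### Consistency of minimisers -/

section Argmin

variable {S : Type*} [MeasurableSpace S] {μ : Measure S} {T : S → S}
  {X : Type*} [MetricSpace X] {Θ : Set X} {θ₀ : X} {g : X → S → ℝ}

/-- Around a parameter with larger expected loss, the losses are bounded below by a single bounded
function whose mean still exceeds the expected loss at `θ₀`: the infimum over a small ball,
truncated. -/
theorem exists_local_lower_bound [IsProbabilityMeasure μ] (hΘ : IsCompact Θ)
    (hg : ∀ θ, Measurable (g θ)) (hcont : ∀ᵐ x ∂μ, ContinuousOn (fun θ => g θ x) Θ)
    {c : ENNReal} {θ : X} (hθ : θ ∈ Θ) (hc : c < ∫⁻ x, ENNReal.ofReal (g θ x) ∂μ) :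
    ∃ (V : Set X) (f : S → ℝ), IsOpen V ∧ θ ∈ V ∧ Measurable f ∧ Integrable f μ ∧ (∀ x, 0 ≤ f x) ∧
      c < ENNReal.ofReal (∫ x, f x ∂μ) ∧
      ∀ᵐ x ∂μ, ∀ θ' ∈ V ∩ Θ, ENNReal.ofReal (f x) ≤ ENNReal.ofReal (g θ' x) := by
  obtain ⟨D, hDΘ, hDc, hDd⟩ := hΘ.isSeparable.exists_countable_dense_subset
  have : Countable D := hDc.to_subtype
  set G : ℕ → S → ENNReal := fun k x => min (k : ENNReal)
    (⨅ d : {d : D // (d : X) ∈ Metric.ball θ (1 / ((k : ℝ) + 1))}, ENNReal.ofReal (g d.1 x)) with hG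
  have hGm : ∀ k, Measurable (G k) := fun k =>
    measurable_const.min (Measurable.iInf fun d => (hg _).ennreal_ofReal)
  have hGmono : Monotone G := by
    intro k l hkl x
    refine min_le_min (by exact_mod_cast hkl) ?_
    refine le_iInf fun d => iInf_le_of_le ⟨d.1, Metric.ball_subset_ball ?_ d.2⟩ le_rfl
    exact one_div_le_one_div_of_le (by positivity) (by gcongr)
  have hsup : ∀ᵐ x ∂μ, ENNReal.ofReal (g θ x) ≤ ⨆ k, G k x := by
    filter_upwards [hcont] with x hx
    refine le_of_forall_lt fun b hb => ?_
    obtain ⟨b', hbb', hb'⟩ := exists_between hb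
    have hcw : ContinuousWithinAt (fun θ => ENNReal.ofReal (g θ x)) Θ θ :=
      (ENNReal.continuous_ofReal.continuousAt.comp_continuousWithinAt (hx θ hθ))
    obtain ⟨e, he, hball⟩ := Metric.mem_nhdsWithin_iff.1
      (hcw.eventually (lt_mem_nhds hb'))
    obtain ⟨k₁, hk₁⟩ := exists_nat_one_div_lt he
    obtain ⟨k₂, hk₂⟩ := ENNReal.exists_nat_gt (ne_top_of_lt hb')
    refine hbb'.trans_le (le_iSup_of_le (max k₁ k₂) (le_min ?_ (le_iInf fun d => ?_)))
    · exact hk₂.le.trans (by exact_mod_cast le_max_right k₁ k₂)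
    · refine (hball ⟨?_, hDΘ d.1.2⟩).le
      refine Metric.ball_subset_ball ?_ d.2
      refine le_trans ?_ hk₁.le
      refine one_div_le_one_div_of_le (by positivity) ?_
      have : (k₁ : ℝ) ≤ (max k₁ k₂ : ℕ) := by exact_mod_cast le_max_left k₁ k₂
      linarith
  have hlim : c < ⨆ k, ∫⁻ x, G k x ∂μ := by
    rw [← lintegral_iSup hGm hGmono]
    exact hc.trans_le (lintegral_mono_ae hsup)
  obtain ⟨k, hk⟩ := lt_iSup_iff.1 hlim
  have hGlt : ∀ x, G k x ≠ ⊤ := fun x =>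
    ne_top_of_le_ne_top (ENNReal.natCast_ne_top k) (min_le_left _ _)
  have hfm : Measurable fun x => (G k x).toReal := (hGm k).ennreal_toReal
  have hfi : Integrable (fun x => (G k x).toReal) μ := by
    refine Integrable.of_bound hfm.aestronglyMeasurable (k : ℝ) (ae_of_all _ fun x => ?_)
    rw [Real.norm_of_nonneg ENNReal.toReal_nonneg]
    exact ENNReal.toReal_le_of_le_ofReal (by positivity)
      ((min_le_left _ _).trans_eq (ENNReal.ofReal_natCast k).symm)
  refine ⟨Metric.ball θ (1 / ((k : ℝ) + 1)), fun x => (G k x).toReal, Metric.isOpen_ball,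
    Metric.mem_ball_self (by positivity), hfm, hfi, fun x => ENNReal.toReal_nonneg, ?_, ?_⟩
  · rw [ofReal_integral_eq_lintegral_ofReal hfi (ae_of_all _ fun x => ENNReal.toReal_nonneg)]
    simpa only [ENNReal.ofReal_toReal (hGlt _)] using hk
  · filter_upwards [hcont] with x hx θ' hθ'
    rw [ENNReal.ofReal_toReal (hGlt x)]
    have hcw : ContinuousWithinAt (fun θ => ENNReal.ofReal (g θ x)) Θ θ' :=
      (ENNReal.continuous_ofReal.continuousAt.comp_continuousWithinAt (hx θ' hθ'.2))
    -- `θ'` is a limit of points of the countable set inside the ball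
    have hcl : θ' ∈ closure (D ∩ Metric.ball θ (1 / ((k : ℝ) + 1))) := by
      rw [Set.inter_comm]
      exact Metric.isOpen_ball.inter_closure ⟨hθ'.1, hDd hθ'.2⟩
    have hne : (𝓝[D ∩ Metric.ball θ (1 / ((k : ℝ) + 1))] θ').NeBot :=
      mem_closure_iff_nhdsWithin_neBot.1 hcl
    refine ge_of_tendsto (Tendsto.mono_left hcw
      (nhdsWithin_mono θ' (s := D ∩ Metric.ball θ (1 / ((k : ℝ) + 1)))
        (Set.inter_subset_left.trans hDΘ))) ?_
    filter_upwards [self_mem_nhdsWithin] with d hd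
    exact (min_le_right _ _).trans (iInf_le _ (⟨⟨d, hd.1⟩, hd.2⟩ :
      {d : D // (d : X) ∈ Metric.ball θ (1 / ((k : ℝ) + 1))}))

/-- Wald's consistency theorem for minimisers of ergodic averages of a continuous loss that is
bounded below. -/
theorem tendsto_argmin [IsProbabilityMeasure μ] (hT : Measure.QuasiMeasurePreserving T μ μ)
    (hslln : ∀ f : S → ℝ, Measurable f → Integrable f μ →
      ∀ᵐ x ∂μ, Tendsto (fun n : ℕ => birkhoffSum T f n x / n) atTop (𝓝 (∫ x, f x ∂μ)))
    (hΘ : IsCompact Θ) (hg : ∀ θ, Measurable (g θ))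
    (hcont : ∀ᵐ x ∂μ, ContinuousOn (fun θ => g θ x) Θ)
    (hnn : ∀ᵐ x ∂μ, ∀ θ ∈ Θ, 0 ≤ g θ x) (hθ₀ : θ₀ ∈ Θ)
    (hfin : ∫⁻ x, ENNReal.ofReal (g θ₀ x) ∂μ < ⊤)
    (hmin : ∀ θ ∈ Θ, θ ≠ θ₀ →
      ∫⁻ x, ENNReal.ofReal (g θ₀ x) ∂μ < ∫⁻ x, ENNReal.ofReal (g θ x) ∂μ) :
    ∀ᵐ x ∂μ, ∀ θs : ℕ → X, (∀ n : ℕ, 1 ≤ n → θs n ∈ Θ ∧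
      ∀ θ ∈ Θ, birkhoffSum T (g (θs n)) n x ≤ birkhoffSum T (g θ) n x) →
      Tendsto θs atTop (𝓝 θ₀) := by
  have hall : ∀ {R : S → Prop}, (∀ᵐ x ∂μ, R x) → ∀ᵐ x ∂μ, ∀ k : ℕ, R (T^[k] x) := by
    intro R hR
    rw [ae_all_iff]
    exact fun k => (hT.iterate k).tendsto_ae.eventually hR
  have hnn₀ : ∀ᵐ x ∂μ, 0 ≤ g θ₀ x := hnn.mono fun x hx => hx θ₀ hθ₀
  have hint₀ : Integrable (g θ₀) μ := by
    refine ⟨(hg θ₀).aestronglyMeasurable, ?_⟩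
    rw [hasFiniteIntegral_iff_norm]
    refine lt_of_le_of_lt (lintegral_mono_ae ?_) hfin
    filter_upwards [hnn₀] with x hx
    rw [Real.norm_of_nonneg hx]
  have hball : ∀ m : ℕ, ∀ᵐ x ∂μ, ∀ θs : ℕ → X, (∀ n : ℕ, 1 ≤ n → θs n ∈ Θ ∧
      ∀ θ ∈ Θ, birkhoffSum T (g (θs n)) n x ≤ birkhoffSum T (g θ) n x) →
      ∀ᶠ n in atTop, dist (θs n) θ₀ < 1 / ((m : ℝ) + 1) := by
    intro m
    set K := Θ \ Metric.ball θ₀ (1 / ((m : ℝ) + 1)) with hK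
    have hKc : IsCompact K := hΘ.diff Metric.isOpen_ball
    have hloc : ∀ θ : X, ∃ (V : Set X) (f : S → ℝ), θ ∈ K → IsOpen V ∧ θ ∈ V ∧ Measurable f ∧
        Integrable f μ ∧ (∀ x, 0 ≤ f x) ∧
        ∫⁻ x, ENNReal.ofReal (g θ₀ x) ∂μ < ENNReal.ofReal (∫ x, f x ∂μ) ∧
        ∀ᵐ x ∂μ, ∀ θ' ∈ V ∩ Θ, ENNReal.ofReal (f x) ≤ ENNReal.ofReal (g θ' x) := by
      intro θ
      by_cases hθ : θ ∈ K
      · have hne : θ ≠ θ₀ := by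
          rintro rfl
          exact hθ.2 (Metric.mem_ball_self (by positivity))
        obtain ⟨V, f, h⟩ := exists_local_lower_bound hΘ hg hcont hθ.1 (hmin θ hθ.1 hne)
        exact ⟨V, f, fun _ => h⟩
      · exact ⟨∅, 0, fun h => absurd h hθ⟩
    choose V f hVf using hloc
    obtain ⟨I, hIK, hcover⟩ := hKc.elim_nhds_subcover V fun θ hθ =>
      (hVf θ hθ).1.mem_nhds (hVf θ hθ).2.1
    have hIae : ∀ θ ∈ I, ∀ᵐ x ∂μ, ∀ᶠ n : ℕ in atTop, 1 ≤ n →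
        ∀ θ' ∈ V θ ∩ Θ, birkhoffSum T (g θ₀) n x < birkhoffSum T (g θ') n x := by
      intro θ hθI
      obtain ⟨-, -, hfm, hfi, hf0, hlt, hle⟩ := hVf θ (hIK θ hθI)
      have hlt' : ∫ x, g θ₀ x ∂μ < ∫ x, f θ x ∂μ := by
        rw [← ofReal_integral_eq_lintegral_ofReal hint₀ hnn₀] at hlt
        exact (ENNReal.ofReal_lt_ofReal_iff_of_nonneg (integral_nonneg_of_ae hnn₀)).1 hlt
      filter_upwards [hslln _ (hg θ₀) hint₀, hslln _ hfm hfi, hall hle, hall hnn]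
        with x h1 h2 h3 h4
      filter_upwards [h1.eventually_lt h2 hlt'] with n hn hn1 θ' hθ'
      have hnpos : (0 : ℝ) < n := by exact_mod_cast hn1
      refine ((div_lt_div_iff_of_pos_right hnpos).1 hn).trans_le ?_
      exact Finset.sum_le_sum fun k _ =>
        (ENNReal.ofReal_le_ofReal_iff (h4 k θ' hθ'.2)).1 (h3 k θ' hθ')
    have hIall : ∀ᵐ x ∂μ, ∀ θ ∈ I, ∀ᶠ n : ℕ in atTop, 1 ≤ n →
        ∀ θ' ∈ V θ ∩ Θ, birkhoffSum T (g θ₀) n x < birkhoffSum T (g θ') n x :=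
      (Finset.eventually_all I).2 hIae
    filter_upwards [hIall] with x hx θs hθs
    filter_upwards [(Finset.eventually_all I).2 hx, eventually_ge_atTop 1] with n hn hn1
    by_contra! hfar
    obtain ⟨hmem, hle⟩ := hθs n hn1
    have hKmem : θs n ∈ K := ⟨hmem, fun hb => absurd (Metric.mem_ball.1 hb) (not_lt.2 hfar)⟩
    obtain ⟨θ, hθI, hθV⟩ := Set.mem_iUnion₂.1 (hcover hKmem)
    exact absurd (hle θ₀ hθ₀) (not_le.2 (hn θ hθI hn1 _ ⟨hθV, hmem⟩))
  filter_upwards [ae_all_iff.2 hball] with x hx θs hθs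
  rw [Metric.tendsto_nhds]
  intro e he
  obtain ⟨m, hm⟩ := exists_nat_one_div_lt he
  filter_upwards [hx m θs hθs] with n hn using hn.trans hm

end Argmin

/-! ### Consistency in the shift model -/

/-- Countably many rates suffice to test temperedness; this makes it a measurable property. -/
theorem tempered_iff_tsum_ne_top (y : ℤ → ℝ) : Tempered y ↔
    ∀ (m : ℕ) (t : ℤ), ∑' i : ℕ, ENNReal.ofReal ((1 - 1 / ((m : ℝ) + 2)) ^ i * |y (t - i)|) ≠ ⊤ := by
  have hm0 : ∀ m : ℕ, (0 : ℝ) < 1 - 1 / ((m : ℝ) + 2) := fun m => by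
    rw [sub_pos, div_lt_one (by positivity)]
    have : (0 : ℝ) ≤ m := m.cast_nonneg
    linarith
  have hm1 : ∀ m : ℕ, 1 - 1 / ((m : ℝ) + 2) < 1 := fun m => sub_lt_self _ (by positivity)
  refine ⟨fun h m t => (h _ (hm0 m) (hm1 m) t).tsum_ofReal_ne_top, fun h ρ h0 h1 t => ?_⟩
  obtain ⟨m, hm⟩ := exists_nat_one_div_lt (sub_pos.2 h1)
  have hρ : ρ ≤ 1 - 1 / ((m : ℝ) + 2) := by
    have : 1 / ((m : ℝ) + 2) ≤ 1 / ((m : ℝ) + 1) :=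
      one_div_le_one_div_of_le (by positivity) (by linarith)
    linarith
  refine Summable.of_nonneg_of_le (fun i => by positivity) (fun i =>
    mul_le_mul_of_nonneg_right (pow_le_pow_left₀ h0.le hρ i) (abs_nonneg _)) ?_
  refine (ENNReal.summable_toReal (h m t)).congr fun i => ?_
  exact ENNReal.toReal_ofReal (mul_nonneg (pow_nonneg (hm0 m).le _) (abs_nonneg _))

theorem measurableSet_tempered : MeasurableSet {y : ℤ → ℝ | Tempered y} := by
  have : {y : ℤ → ℝ | Tempered y} = ⋂ (m : ℕ) (t : ℤ), {y : ℤ → ℝ |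
      ∑' i : ℕ, ENNReal.ofReal ((1 - 1 / ((m : ℝ) + 2)) ^ i * |y (t - i)|) = ⊤}ᶜ := by
    ext y
    simp [tempered_iff_tsum_ne_top]
  rw [this]
  refine MeasurableSet.iInter fun m => MeasurableSet.iInter fun t => ?_
  refine MeasurableSet.compl (measurableSet_eq_fun (Measurable.tsum fun i => ?_) measurable_const)
  exact (((measurable_pi_apply _).abs).const_mul _).ennreal_ofReal

/-- The shift of a sequence by one step. -/
def seqShift (u : ℤ → ℝ) : ℤ → ℝ := fun t => u (t + 1)

theorem seqShift_iterate (n : ℕ) (u : ℤ → ℝ) (t : ℤ) : seqShift^[n] u t = u (t + n) := by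
  induction n generalizing u with
  | zero => simp
  | succ n ih =>
    rw [Function.iterate_succ_apply, ih, seqShift]
    congr 1; push_cast; ring

theorem measurable_seqShift : Measurable seqShift :=
  measurable_pi_lambda _ fun _ => measurable_pi_apply _

namespace ShiftModel

variable {S : Type*} [MeasurableSpace S] {μ : Measure S} {T : ℤ → S → S} {p q r s : ℕ}
  {θ₀ θ : ARMAGARCHParam p q r s} {η y ε h : ℤ → S → ℝ} {Θγ : Set (ARMAParam p q)}
  {Θδ : Set (GARCHParam r s)}

theorem path_shift_one (M : ShiftModel μ T θ₀ η y ε h) (x : S) :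
    (fun u => y u (T 1 x)) = seqShift fun u => y u x :=
  funext fun u => M.shift_obs 1 u x

theorem measurePreserving_seqShift (M : ShiftModel μ T θ₀ η y ε h) :
    MeasurePreserving seqShift (μ.map fun x u => y u x) (μ.map fun x u => y u x) := by
  refine ⟨measurable_seqShift, ?_⟩
  rw [Measure.map_map measurable_seqShift M.measurable_path]
  have : (seqShift ∘ fun x u => y u x) = (fun x u => y u x) ∘ T 1 :=
    funext fun x => (M.path_shift_one x).symm
  rw [this, ← Measure.map_map M.measurable_path (M.shift 1).measurable, (M.shift 1).map_eq]

/-- The strong law for functionals of the observed path. -/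
theorem tendsto_birkhoffSum_path [IsProbabilityMeasure μ] (M : ShiftModel μ T θ₀ η y ε h)
    (f : (ℤ → ℝ) → ℝ) (hf : Measurable f) (hfi : Integrable f (μ.map fun x u => y u x)) :
    ∀ᵐ u ∂(μ.map fun x u => y u x),
      Tendsto (fun n : ℕ => birkhoffSum seqShift f n u / n) atTop
        (𝓝 (∫ u, f u ∂(μ.map fun x u => y u x))) := by
  have hm := M.measurable_path
  have hpast : AEStronglyMeasurable[windowSigma η Set.univ] (fun x => f fun u => y u x) μ := by
    choose y' hy' he using fun t => M.causal_obs t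
    have hy'' : ∀ t, Measurable[windowSigma η Set.univ] (y' t) := fun t =>
      (hy' t).mono (windowSigma_mono η (Set.subset_univ {k | k ≤ t})) le_rfl
    refine ⟨fun x => f fun u => y' u x, ?_, ?_⟩
    · exact (hf.comp (@measurable_pi_lambda _ _ _ (windowSigma η Set.univ) _ _ hy'')).stronglyMeasurable
    · filter_upwards [ae_all_iff.2 he] with x hx
      congr 1
      exact funext hx
  have key := tendsto_birkhoffSum_of_iid (M.shift 1) M.iid.measurable M.iid.indep
    (fun k x => M.shift_innov 1 k x) (hf.comp hm) (hfi.comp_measurable hm) hpast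
  have hiter : ∀ (n : ℕ) x, (fun u => y u ((T 1)^[n] x)) = seqShift^[n] fun u => y u x := by
    intro n
    induction n with
    | zero => intro x; rfl
    | succ n ih =>
      intro x
      rw [Function.iterate_succ_apply, ih, M.path_shift_one, Function.iterate_succ_apply]
  have hsum : ∀ n x, birkhoffSum (T 1) (f ∘ fun x u => y u x) n x
      = birkhoffSum seqShift f n fun u => y u x := by
    intro n x
    exact Finset.sum_congr rfl fun k _ => congrArg f (hiter k x)
  rw [ae_map_iff hm.aemeasurable]
  · filter_upwards [key] with x hx
    simp only [hsum] at hx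
    rw [integral_map hm.aemeasurable hf.aestronglyMeasurable]
    exact hx
  · refine measurableSet_tendsto (𝓝 _) fun n => ?_
    refine Measurable.div_const (Finset.measurable_fun_sum _ fun k _ => ?_) _
    exact hf.comp (measurable_seqShift.iterate k)

theorem birkhoffSum_loss (w : (ℕ → ℝ) → ℝ) (θ : ARMAGARCHParam p q r s) (K : ℝ) {n : ℕ}
    (hn : 1 ≤ n) (u : ℤ → ℝ) :
    birkhoffSum seqShift (fun u => weightAt w u 1 * laplaceLoss θ u 1 + K) n u
      = n * quasiLik w n u θ + n * K := by
  have hn' : (n : ℝ) ≠ 0 := by positivity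
  have h1 : ∀ k : ℕ, seqShift^[k] u = fun t => u (t + k) := fun k =>
    funext fun t => seqShift_iterate k u t
  have h2 : ∑ t ∈ Finset.Icc 1 n, weightAt w u t * laplaceLoss θ u t
      = ∑ k ∈ Finset.range n, weightAt w u (1 + k) * laplaceLoss θ u (1 + k) := by
    rw [← Finset.Ico_add_one_right_eq_Icc, Finset.sum_Ico_eq_sum_range, Nat.add_sub_cancel]
    simp only [Nat.cast_add, Nat.cast_one]
  rw [quasiLik, h2, ← mul_assoc, mul_one_div_cancel hn', one_mul]
  simp only [birkhoffSum, h1, weightAt_shift, laplaceLoss_shift, Finset.sum_add_distrib,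
    Finset.sum_const, Finset.card_range, nsmul_eq_mul]

/-- Strong consistency for minimisers of the quasi-likelihood, stated for almost every path. -/
theorem consistent [IsProbabilityMeasure μ] (M : ShiftModel μ T θ₀ η y ε h)
    (H : InvertibleParams Θγ Θδ) (hθ₀ : θ₀ ∈ Θγ ×ˢ Θδ)
    (hr : 0 < r) (harch : 0 < θ₀.2.arch ⟨0, hr⟩)
    (hnd : ¬ IsDegenerate (fun x => η 0 x ^ 2) μ)
    (hγ : ∀ γ ∈ Θγ, NoCommonRoot γ.arPoly γ.maPoly)
    (hδ : ∀ δ ∈ Θδ, NoCommonRoot δ.archPoly δ.garchPoly)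
    {w : (ℕ → ℝ) → ℝ} (hw : Measurable w) (hw_pos : ∀ x, 0 < w x) (hw_bdd : ∃ M : ℝ, ∀ x, w x ≤ M)
    (hmedian : HasMedianZero (η 0) μ)
    (hint : Integrable (fun e : ℝ => |e|) (μ.map (η 0)))
    (habs : ∫ e, |e| ∂(μ.map (η 0)) = 1)
    (hweight : ∀ ρ : ℝ, 0 < ρ → ρ < 1 → ∫⁻ x, ENNReal.ofReal
      (weightAt w (fun u => y u x) 1 * envelope ρ (fun u => y u x) 0) ∂μ < ⊤) :
    ∀ᵐ u ∂(μ.map fun x u => y u x), ∀ θs : ℕ → ARMAGARCHParam p q r s,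
      (∀ n : ℕ, 1 ≤ n → IsQMELE w n u (Θγ ×ˢ Θδ) (θs n)) → Tendsto θs atTop (𝓝 θ₀) := by
  have hm := M.measurable_path
  have : IsProbabilityMeasure (μ.map fun x u => y u x) :=
    Measure.isProbabilityMeasure_map hm.aemeasurable
  obtain ⟨a, K, ha0, ha, hK⟩ := H.exists_loss_lower_bound hw_pos hw_bdd
  have htemp : ∀ᵐ u ∂(μ.map fun x u => y u x), Tempered u :=
    (ae_map_iff hm.aemeasurable measurableSet_tempered).2 M.tempered
  have hg : ∀ θ : ARMAGARCHParam p q r s,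
      Measurable fun u => weightAt w u 1 * laplaceLoss θ u 1 + K := fun θ =>
    ((measurable_weightAt hw 1).mul (measurable_laplaceLoss θ 1)).add_const K
  have hmap : ∀ θ : ARMAGARCHParam p q r s,
      ∫⁻ u, ENNReal.ofReal (weightAt w u 1 * laplaceLoss θ u 1 + K) ∂(μ.map fun x u => y u x)
        = ∫⁻ x, ENNReal.ofReal
          (weightAt w (fun u => y u x) 1 * laplaceLoss θ (fun u => y u x) 1 + K) ∂μ := fun θ =>
    lintegral_map (hg θ).ennreal_ofReal hm
  have hfin := M.lintegral_true_loss_lt_top H hθ₀ hw hw_pos hw_bdd ha hK hint habs 1 hweight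
  have key := tendsto_argmin (g := fun (θ : ARMAGARCHParam p q r s) u =>
      weightAt w u 1 * laplaceLoss θ u 1 + K)
    M.measurePreserving_seqShift.quasiMeasurePreserving M.tendsto_birkhoffSum_path
    (H.compact_arma.prod H.compact_garch) hg
    (htemp.mono fun u hu => ((H.continuousOn_laplaceLoss hu 1).const_mul _).add continuousOn_const)
    (htemp.mono fun u hu θ hθ => hK _ _
      ((ha _ hθ.2).trans (H.const_le_condScale hθ hu 1)) (abs_nonneg _) _)
    hθ₀ (by rw [hmap]; exact hfin)
    (fun θ hθ hne => by
      rw [hmap, hmap]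
      exact M.lintegral_loss_lt H hθ₀ hθ hne hr harch hnd hγ hδ hw hw_pos ha0 ha hK hmedian
        hint habs 1 hfin)
  filter_upwards [key] with u hu θs hθs
  refine hu θs fun n hn => ⟨(hθs n hn).1, fun θ hθ => ?_⟩
  rw [birkhoffSum_loss w _ K hn, birkhoffSum_loss w _ K hn]
  have := mul_le_mul_of_nonneg_left ((hθs n hn).2 θ hθ) (Nat.cast_nonneg (α := ℝ) n)
  linarith

end ShiftModel

/-- Minimisers exist for every tempered path, by compactness and continuity. -/
theorem InvertibleParams.exists_isQMELE {p q r s : ℕ} {Θγ : Set (ARMAParam p q)}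
    {Θδ : Set (GARCHParam r s)} (H : InvertibleParams Θγ Θδ) (hne : (Θγ ×ˢ Θδ).Nonempty)
    (w : (ℕ → ℝ) → ℝ) {y : ℤ → ℝ} (hy : Tempered y) (n : ℕ) :
    ∃ θ, IsQMELE w n y (Θγ ×ˢ Θδ) θ := by
  obtain ⟨θ, hθ, hmin⟩ := (H.compact_arma.prod H.compact_garch).exists_isMinOn hne
    (f := quasiLik w n y) (by
      refine ContinuousOn.const_mul (continuousOn_finsetSum _ fun t _ => ?_) _
      exact (H.continuousOn_laplaceLoss hy t).const_mul _)
  exact ⟨θ, hθ, fun θ' hθ' => hmin hθ'⟩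

/-! ### Transfer to the canonical path space -/

/-- A function measurable with respect to the innovations up to time `t` is a measurable function of
them. -/
theorem exists_eq_comp_of_measurable_pastSigma {Ω : Type*} [MeasurableSpace Ω] {η : ℤ → Ω → ℝ}
    {t : ℤ} {U : Ω → ℝ} (hU : Measurable[pastSigma η t] U) :
    ∃ G : (Set.Iic t → ℝ) → ℝ, Measurable G ∧ ∀ ω, U ω = G fun k => η k ω := by
  have hσ : pastSigma η t
      = MeasurableSpace.comap (fun ω (k : Set.Iic t) => η k ω) MeasurableSpace.pi := by
    simp only [MeasurableSpace.pi, MeasurableSpace.comap_iSup, MeasurableSpace.comap_comp]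
    exact iSup_subtype'
  rw [hσ] at hU
  obtain ⟨G, hG, he⟩ := hU.exists_eq_measurable_comp
  exact ⟨G, hG, fun ω => congrFun he ω⟩

/-- The space of paths of `(y_t, ε_t, h_t)`. -/
abbrev PathSpace : Type := ℤ → ℝ × ℝ × ℝ

namespace PathSpace

/-- The observation at time `t`. -/
abbrev obs (t : ℤ) (z : PathSpace) : ℝ := (z t).1

/-- The error at time `t`. -/
abbrev error (t : ℤ) (z : PathSpace) : ℝ := (z t).2.1

/-- The scale at time `t`. -/
abbrev scale (t : ℤ) (z : PathSpace) : ℝ := (z t).2.2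

/-- The innovation at time `t`, recovered as `ε_t / √h_t`. -/
noncomputable def innov (t : ℤ) (z : PathSpace) : ℝ := error t z / √(scale t z)

/-- The time shift by `k`. -/
def shift (k : ℤ) (z : PathSpace) : PathSpace := fun t => z (t + k)

theorem measurable_obs (t : ℤ) : Measurable (obs t) := (measurable_pi_apply t).fst

theorem measurable_error (t : ℤ) : Measurable (error t) := (measurable_pi_apply t).snd.fst

theorem measurable_scale (t : ℤ) : Measurable (scale t) := (measurable_pi_apply t).snd.snd

theorem measurable_innov (t : ℤ) : Measurable (innov t) :=
  (measurable_error t).div (measurable_scale t).sqrt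

theorem measurable_shift (k : ℤ) : Measurable (shift k) :=
  measurable_pi_lambda _ fun _ => measurable_pi_apply _

end PathSpace

namespace IsARMAGARCH

variable {Ω : Type*} [MeasurableSpace Ω] {P : Measure Ω} {p q r s : ℕ}
  {θ₀ : ARMAGARCHParam p q r s} {η y ε h : ℤ → Ω → ℝ}

theorem ae_scale_pos (hM : IsARMAGARCH θ₀ η y ε h P) (hpos : θ₀.2.Positive) :
    ∀ᵐ ω ∂P, ∀ t, 0 < h t ω := by
  filter_upwards [ae_all_iff.2 hM.scale_eq, ae_all_iff.2 hM.scale_nonneg] with ω h1 h2 t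
  rw [h1 t]
  have h3 : 0 ≤ ∑ i : Fin r, θ₀.2.arch i * ε (t - ((i : ℤ) + 1)) ω ^ 2 :=
    Finset.sum_nonneg fun i _ => mul_nonneg (hpos.arch_nonneg i) (sq_nonneg _)
  have h4 : 0 ≤ ∑ i : Fin s, θ₀.2.garch i * h (t - ((i : ℤ) + 1)) ω :=
    Finset.sum_nonneg fun i _ => mul_nonneg (hpos.garch_nonneg i) (h2 _)
  linarith [hpos.const_pos]

theorem aemeasurable_path (hM : IsARMAGARCH θ₀ η y ε h P) :
    AEMeasurable (fun ω t => ((y t ω, ε t ω, h t ω) : ℝ × ℝ × ℝ)) P :=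
  (hM.stationary 0).aemeasurable_snd

theorem ae_innov_eq (hM : IsARMAGARCH θ₀ η y ε h P) (hpos : θ₀.2.Positive) :
    ∀ᵐ ω ∂P, ∀ t, PathSpace.innov t (fun t => (y t ω, ε t ω, h t ω)) = η t ω := by
  filter_upwards [hM.ae_scale_pos hpos, ae_all_iff.2 hM.error_eq] with ω h1 h2 t
  rw [PathSpace.innov, PathSpace.error, PathSpace.scale, h2 t,
    mul_div_cancel_right₀ _ (Real.sqrt_pos.2 (h1 t)).ne']

theorem map_innov (hM : IsARMAGARCH θ₀ η y ε h P) (hpos : θ₀.2.Positive) (t : ℤ) :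
    (P.map fun ω t => ((y t ω, ε t ω, h t ω) : ℝ × ℝ × ℝ)).map (PathSpace.innov t)
      = P.map (η t) := by
  rw [AEMeasurable.map_map_of_aemeasurable (PathSpace.measurable_innov t).aemeasurable
    hM.aemeasurable_path]
  exact Measure.map_congr ((hM.ae_innov_eq hpos).mono fun ω h => h t)

/-- The innovations recovered on the path space are again i.i.d. -/
theorem isIIDSequence_innov [IsProbabilityMeasure P] (hη : IsIIDSequence η P)
    (hM : IsARMAGARCH θ₀ η y ε h P) (hpos : θ₀.2.Positive) :
    IsIIDSequence PathSpace.innov (P.map fun ω t => ((y t ω, ε t ω, h t ω) : ℝ × ℝ × ℝ)) where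
  measurable := PathSpace.measurable_innov
  indep := by
    have : IsProbabilityMeasure (P.map fun ω t => ((y t ω, ε t ω, h t ω) : ℝ × ℝ × ℝ)) :=
      Measure.isProbabilityMeasure_map hM.aemeasurable_path
    rw [iIndepFun_iff_map_fun_eq_infinitePi_map PathSpace.measurable_innov]
    simp only [hM.map_innov hpos]
    rw [← (iIndepFun_iff_map_fun_eq_infinitePi_map hη.measurable).1 hη.indep,
      AEMeasurable.map_map_of_aemeasurable
        (measurable_pi_lambda _ PathSpace.measurable_innov).aemeasurable hM.aemeasurable_path]
    exact Measure.map_congr ((hM.ae_innov_eq hpos).mono fun ω h => funext h)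
  identDistrib := fun t =>
    ⟨(PathSpace.measurable_innov t).aemeasurable, (PathSpace.measurable_innov 0).aemeasurable, by
      rw [hM.map_innov hpos, hM.map_innov hpos, (hη.identDistrib t).map_eq]⟩

/-- Causality passes to the path space. -/
theorem isPastMeasurable_innov (hM : IsARMAGARCH θ₀ η y ε h P) (hpos : θ₀.2.Positive) {t : ℤ}
    {U : PathSpace → ℝ} (hU : Measurable U)
    (hc : AEStronglyMeasurable[pastSigma η t] (fun ω => U fun t => (y t ω, ε t ω, h t ω)) P) :
    IsPastMeasurable PathSpace.innov (P.map fun ω t => ((y t ω, ε t ω, h t ω) : ℝ × ℝ × ℝ)) t U := by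
  obtain ⟨U', hU', he⟩ := IsPastMeasurable.of_aestronglyMeasurable hc
  obtain ⟨G, hG, hUG⟩ := exists_eq_comp_of_measurable_pastSigma hU'
  have hinn : Measurable fun (z : PathSpace) (k : Set.Iic t) => PathSpace.innov k z :=
    measurable_pi_lambda _ fun k => PathSpace.measurable_innov k
  refine ⟨fun z => G fun k => PathSpace.innov k z, hG.comp ?_, ?_⟩
  · refine @measurable_pi_lambda _ _ _ (pastSigma PathSpace.innov t) _ _ fun k => ?_
    exact measurable_iff_comap_le.2 (le_iSup₂_of_le k.1 k.2 le_rfl)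
  · refine (ae_map_iff hM.aemeasurable_path (measurableSet_eq_fun hU (hG.comp hinn))).2 ?_
    filter_upwards [he, hM.ae_innov_eq hpos] with ω h1 h2
    simp only [Function.comp_apply, h2]
    rw [h1, hUG]

/-- The coordinate processes on the path space form a shift model. -/
theorem shiftModel [IsProbabilityMeasure P] (hη : IsIIDSequence η P)
    (hM : IsARMAGARCH θ₀ η y ε h P) (hpos : θ₀.2.Positive)
    (htemp : ∀ᵐ ω ∂P, Tempered fun t => y t ω) :
    ShiftModel (P.map fun ω t => ((y t ω, ε t ω, h t ω) : ℝ × ℝ × ℝ)) PathSpace.shift θ₀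
      PathSpace.innov PathSpace.obs PathSpace.error PathSpace.scale := by
  have hZ := hM.aemeasurable_path
  have hmo := PathSpace.measurable_obs
  have hme := PathSpace.measurable_error
  have hms := PathSpace.measurable_scale
  have hmi := PathSpace.measurable_innov
  refine
  { shift := fun k => ⟨PathSpace.measurable_shift k, ?_⟩
    iid := hM.isIIDSequence_innov hη hpos
    measurable_obs := hmo
    measurable_error := hme
    measurable_scale := hms
    shift_innov := fun k t x => rfl
    shift_obs := fun k t x => rfl
    shift_error := fun k t x => rfl
    shift_scale := fun k t x => rfl
    arma_eq := ?_
    error_eq := ?_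
    scale_nonneg := ?_
    scale_eq := ?_
    causal_obs := fun t => hM.isPastMeasurable_innov hpos (hmo t) (hM.causal_obs t)
    causal_scale := fun t => hM.isPastMeasurable_innov hpos (hms t) (hM.causal_scale t)
    tempered := ?_ }
  · rw [AEMeasurable.map_map_of_aemeasurable (PathSpace.measurable_shift k).aemeasurable hZ]
    exact (hM.stationary k).map_eq
  · rw [ae_all_iff]
    intro t
    refine (ae_map_iff hZ (measurableSet_eq_fun (hmo t) ?_)).2 (hM.arma_eq t)
    fun_prop
  · rw [ae_all_iff]
    intro t
    refine (ae_map_iff hZ (measurableSet_eq_fun (hme t) ((hmi t).mul (hms t).sqrt))).2 ?_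
    filter_upwards [hM.ae_innov_eq hpos, hM.error_eq t] with ω h1 h2
    rw [Pi.mul_apply, h1 t, ← h2]
  · rw [ae_all_iff]
    intro t
    exact (ae_map_iff hZ (measurableSet_le measurable_const (hms t))).2 (hM.scale_nonneg t)
  · rw [ae_all_iff]
    intro t
    refine (ae_map_iff hZ (measurableSet_eq_fun (hms t) ?_)).2 (hM.scale_eq t)
    fun_prop
  · exact (ae_map_iff hZ (measurableSet_tempered.preimage (measurable_pi_lambda _ hmo))).2 htemp

end IsARMAGARCH

/-! ### Moment conditions on the weights -/

theorem one_le_xiEnvelope (ρ : ℝ) (y : ℤ → ℝ) (t : ℤ) : 1 ≤ xiEnvelope ρ y t :=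
  le_self_add

theorem ofReal_envelope_le {ρ : ℝ} (hρ : 0 ≤ ρ) (y : ℤ → ℝ) (t : ℤ) :
    ENNReal.ofReal (envelope ρ y t) ≤ xiEnvelope ρ y t := by
  have h0 : ∀ i : ℕ, 0 ≤ ρ ^ i * |y (t - i)| := fun i => by positivity
  rw [envelope, xiEnvelope, ENNReal.ofReal_add zero_le_one (tsum_nonneg h0), ENNReal.ofReal_one]
  gcongr
  by_cases hs : Summable fun i : ℕ => ρ ^ i * |y (t - i)|
  · exact (ENNReal.ofReal_tsum_of_nonneg h0 hs).le
  · simp [tsum_eq_zero_of_not_summable hs]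

theorem measurable_xiEnvelope (ρ : ℝ) (t : ℤ) : Measurable fun y : ℤ → ℝ => xiEnvelope ρ y t :=
  measurable_const.add (Measurable.tsum fun _ =>
    (((measurable_pi_apply _).abs).const_mul _).ennreal_ofReal)

theorem measurable_envelope (ρ : ℝ) (t : ℤ) : Measurable fun y : ℤ → ℝ => envelope ρ y t :=
  measurable_const.add (Measurable.tsum fun _ => ((measurable_pi_apply _).abs).const_mul _)

theorem ofReal_weight_mul_envelope_le {w : (ℕ → ℝ) → ℝ} (hw_pos : ∀ x, 0 < w x) {ρ : ℝ}
    (hρ : 0 ≤ ρ) (y : ℤ → ℝ) (t : ℤ) :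
    ENNReal.ofReal (weightAt w y t * envelope ρ y (t - 1))
      ≤ ENNReal.ofReal (weightAt w y t + weightAt w y t ^ 2) * xiEnvelope ρ y (t - 1) ^ 3 := by
  have hW : 0 < weightAt w y t := hw_pos _
  rw [ENNReal.ofReal_mul hW.le]
  refine mul_le_mul' (ENNReal.ofReal_le_ofReal (by nlinarith)) ?_
  exact (ofReal_envelope_le hρ _ _).trans
    (le_self_pow (one_le_xiEnvelope ρ y (t - 1)) (by norm_num))

/-- The moment condition forces almost every path to grow subexponentially into the past, since the
weights do not vanish. -/
theorem ae_tempered_of_lintegral_lt_top {Ω : Type*} [MeasurableSpace Ω] {P : Measure Ω}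
    {y : ℤ → Ω → ℝ} (hy : AEMeasurable (fun ω t => y t ω) P) {w : (ℕ → ℝ) → ℝ} (hw : Measurable w)
    (hw_pos : ∀ x, 0 < w x)
    (hweight : ∀ ρ : ℝ, 0 < ρ → ρ < 1 → ∀ t : ℤ,
      ∫⁻ ω, ENNReal.ofReal (weightAt w (fun k => y k ω) t + weightAt w (fun k => y k ω) t ^ 2)
        * xiEnvelope ρ (fun k => y k ω) (t - 1) ^ 3 ∂P < ⊤) :
    ∀ᵐ ω ∂P, Tempered fun t => y t ω := by
  simp only [tempered_iff_tsum_ne_top]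
  refine ae_all_iff.2 fun m => ae_all_iff.2 fun t => ?_
  have hm0 : (0 : ℝ) < 1 - 1 / ((m : ℝ) + 2) := by
    rw [sub_pos, div_lt_one (by positivity)]
    have : (0 : ℝ) ≤ m := m.cast_nonneg
    linarith
  set ρ : ℝ := 1 - 1 / ((m : ℝ) + 2) with hρ
  have hm1 : ρ < 1 := sub_lt_self _ (by positivity)
  have hmeas : Measurable fun u : ℤ → ℝ => ENNReal.ofReal (weightAt w u (t + 1)
      + weightAt w u (t + 1) ^ 2) * xiEnvelope ρ u (t + 1 - 1) ^ 3 :=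
    (((measurable_weightAt hw _).add ((measurable_weightAt hw _).pow_const 2)).ennreal_ofReal).mul
      ((measurable_xiEnvelope ρ _).pow_const 3)
  filter_upwards [ae_lt_top' (hmeas.comp_aemeasurable hy) (hweight ρ hm0 hm1 (t + 1)).ne] with ω hω htop
  have hW : 0 < weightAt w (fun k => y k ω) (t + 1) := hw_pos _
  refine hω.ne ?_
  have hxi : xiEnvelope ρ (fun k => y k ω) (t + 1 - 1) = ⊤ := by
    rw [add_sub_cancel_right, xiEnvelope, htop, add_top]
  simp only [Function.comp_apply, hxi]
  rw [ENNReal.top_pow (by norm_num), ENNReal.mul_top]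
  rw [Ne, ENNReal.ofReal_eq_zero, not_le]
  positivity

/-! ### Consequences of admissibility and interiority -/

/-- An admissible volatility equation has at least one ARCH lag: otherwise `α = 0` and the
nonconstant `β` has a complex root. -/
theorem GARCHParam.Admissible.arch_lag_pos {r s : ℕ} {δ : GARCHParam r s} (hδ : δ.Admissible) :
    0 < r := by
  rcases Nat.eq_zero_or_pos r with rfl | hr
  swap
  · exact hr
  exfalso
  have hlast := hδ.last_ne_zero
  have ha : δ.archPoly = 0 := by simp [GARCHParam.archPoly, lagPoly]
  cases s with
  | zero => simp [lastCoeff] at hlast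
  | succ s =>
    simp only [lastCoeff, zero_add] at hlast
    have hdeg : δ.garchPoly.degree ≠ 0 := by
      intro h
      have h1 := coeff_succ_lagPoly δ.garch (Fin.last s)
      have h2 : δ.garchPoly.coeff (s + 1) = -δ.garch (Fin.last s) := by
        rw [GARCHParam.garchPoly, Polynomial.coeff_sub, ← h1, Polynomial.coeff_one]
        simp
      rw [Polynomial.coeff_eq_zero_of_degree_lt (by rw [h]; exact_mod_cast Nat.succ_pos s)] at h2
      exact hlast (neg_eq_zero.1 h2.symm)
    obtain ⟨z, hz⟩ := IsAlgClosed.exists_aeval_eq_zero ℂ _ hdeg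
    exact hδ.noCommonRoot z ⟨by rw [ha, map_zero], hz⟩

/-- At an interior point of a set of nonnegative coefficients the ARCH coefficients are positive. -/
theorem arch_pos_of_mem_interior {r s : ℕ} {Θδ : Set (GARCHParam r s)}
    (hpos : ∀ δ ∈ Θδ, δ.Positive) {δ : GARCHParam r s} (hδ : δ ∈ interior Θδ) (i : Fin r) :
    0 < δ.arch i := by
  set F : ℝ → GARCHParam r s := fun c => (δ.1, Function.update δ.2.1 i (δ.2.1 i - c), δ.2.2) with hF
  have hcont : Continuous F := by
    refine continuous_const.prodMk (Continuous.prodMk ?_ continuous_const)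
    exact continuous_const.update i (continuous_const.sub continuous_id)
  have h0 : F 0 = δ := by simp [hF]
  have hev : ∀ᶠ c in 𝓝 (0 : ℝ), F c ∈ Θδ :=
    hcont.continuousAt.eventually (by rw [h0]; exact mem_interior_iff_mem_nhds.1 hδ)
  obtain ⟨c, hc, hc0⟩ := ((hev.filter_mono (nhdsWithin_le_nhds (s := Set.Ioi 0))).and
    self_mem_nhdsWithin).exists
  have h1 := (hpos _ hc).arch_nonneg i
  have hc0' : 0 < c := hc0
  have h2 : (F c).arch i = δ.arch i - c := by simp [hF, GARCHParam.arch]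
  linarith

/-! ### Strong consistency -/

theorem theorem2p1 {Ω : Type*} [MeasurableSpace Ω] (P : Measure Ω) [IsProbabilityMeasure P]
    {p q r s : ℕ}
    -- the parameter space and the true parameter
    (Θγ : Set (ARMAParam p q)) (Θδ : Set (GARCHParam r s))
    (hΘγ : IsCompact Θγ) (hΘδ : IsCompact Θδ)
    (hpos : ∀ δ ∈ Θδ, δ.Positive)
    (θ₀ : ARMAGARCHParam p q r s) (hθ₀ : θ₀ ∈ interior (Θγ ×ˢ Θδ))
    -- the data-generating process
    (η y ε h : ℤ → Ω → ℝ) (hη : IsIIDSequence η P) (hmodel : IsARMAGARCH θ₀ η y ε h P)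
    -- the weight function
    (w : (ℕ → ℝ) → ℝ) (hw_meas : Measurable w) (hw_pos : ∀ x, 0 < w x)
    (hw_bdd : ∃ M : ℝ, ∀ x, w x ≤ M)
    -- median and scale of the innovations
    (hmedian : HasMedianZero (η 0) P) (habs : ∫ ω, |η 0 ω| ∂P = 1)
    -- conditions on the parameter space
    (hARMA : ∀ γ ∈ Θγ, γ.Admissible)
    (hGARCH : ∀ δ ∈ Θδ, δ.Admissible)
    -- squared innovations: non-degenerate with finite mean
    (hnondeg : ¬ IsDegenerate (fun ω => η 0 ω ^ 2) P)
    (hsq : Integrable (fun ω => η 0 ω ^ 2) P)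
    -- moment condition on the weights
    (hweight : ∀ ρ : ℝ, 0 < ρ → ρ < 1 → ∀ t : ℤ,
      ∫⁻ ω, ENNReal.ofReal (weightAt w (fun k => y k ω) t + weightAt w (fun k => y k ω) t ^ 2)
        * xiEnvelope ρ (fun k => y k ω) (t - 1) ^ 3 ∂P < ⊤)
    -- fractional moment of the errors
    (hmoment : ∃ ι : ℝ, 0 < ι ∧ ∀ t : ℤ, Integrable (fun ω => |ε t ω| ^ (2 * ι)) P) :
    -- almost surely a minimiser exists for every sample size, and every choice of minimisers
    -- is strongly consistent
    (∀ᵐ ω ∂P, ∀ n : ℕ, ∃ θ, IsQMELE w n (fun k => y k ω) (Θγ ×ˢ Θδ) θ) ∧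
    ∀ θhat : ℕ → Ω → ARMAGARCHParam p q r s,
      (∀ n : ℕ, 1 ≤ n → ∀ᵐ ω ∂P, IsQMELE w n (fun k => y k ω) (Θγ ×ˢ Θδ) (θhat n ω)) →
      ∀ᵐ ω ∂P, Tendsto (fun n => θhat n ω) atTop (𝓝 θ₀) := by
  have hθ₀' : θ₀ ∈ Θγ ×ˢ Θδ := interior_subset hθ₀
  have hP := hpos _ hθ₀'.2
  have H : InvertibleParams Θγ Θδ :=
    { compact_arma := hΘγ
      compact_garch := hΘδ
      ma_ne_zero := fun γ hγ => (hARMA γ hγ).ma_ne_zero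
      positive := hpos
      garch_sum_lt_one := fun δ hδ => (hGARCH δ hδ).garch_sum_lt_one }
  have hZ := hmodel.aemeasurable_path
  have hobs : Measurable fun (z : PathSpace) t => PathSpace.obs t z :=
    measurable_pi_lambda _ PathSpace.measurable_obs
  have hy : AEMeasurable (fun ω t => y t ω) P := hobs.comp_aemeasurable hZ
  have htemp := ae_tempered_of_lintegral_lt_top hy hw_meas hw_pos hweight
  refine ⟨htemp.mono fun ω hω n => H.exists_isQMELE ⟨θ₀, hθ₀'⟩ w hω n, fun θhat hmin => ?_⟩
  have hr : 0 < r := (hGARCH _ hθ₀'.2).arch_lag_pos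
  have harch : 0 < θ₀.2.arch ⟨0, hr⟩ := by
    rw [interior_prod_eq] at hθ₀
    exact arch_pos_of_mem_interior hpos hθ₀.2 _
  have hM := hmodel.shiftModel hη hP htemp
  have hprob : IsProbabilityMeasure (P.map fun ω t => ((y t ω, ε t ω, h t ω) : ℝ × ℝ × ℝ)) :=
    Measure.isProbabilityMeasure_map hZ
  have hlaw := hmodel.map_innov hP 0
  have hinn := PathSpace.measurable_innov 0
  have hη0 := (hη.measurable 0).aemeasurable (μ := P)
  have hnd' : ¬ IsDegenerate (fun z => PathSpace.innov 0 z ^ 2)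
      (P.map fun ω t => ((y t ω, ε t ω, h t ω) : ℝ × ℝ × ℝ)) := by
    rintro ⟨c, hc⟩
    refine hnondeg ⟨c, ?_⟩
    filter_upwards [ae_of_ae_map hZ hc, hmodel.ae_innov_eq hP] with ω h1 h2
    rw [← h1, h2]
  have hmedian' : HasMedianZero (PathSpace.innov 0)
      (P.map fun ω t => ((y t ω, ε t ω, h t ω) : ℝ × ℝ × ℝ)) := by
    have hset : ∀ A : Set ℝ, MeasurableSet A →
        (P.map fun ω t => ((y t ω, ε t ω, h t ω) : ℝ × ℝ × ℝ)).real (PathSpace.innov 0 ⁻¹' A)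
          = P.real (η 0 ⁻¹' A) := by
      intro A hA
      rw [← map_measureReal_apply hinn hA, hlaw, map_measureReal_apply (hη.measurable 0) hA]
    exact ⟨hmedian.1.trans_eq (hset _ measurableSet_Iic).symm,
      hmedian.2.trans_eq (hset _ measurableSet_Ici).symm⟩
  have hint : Integrable (fun ω => |η 0 ω|) P :=
    Integrable.of_integral_ne_zero (by rw [habs]; exact one_ne_zero)
  have hint' : Integrable (fun e : ℝ => |e|) (P.map (η 0)) :=
    (integrable_map_measure (by fun_prop) hη0).2 hint
  have habs' : ∫ e, |e| ∂(P.map (η 0)) = 1 := by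
    rw [integral_map hη0 (by fun_prop)]
    exact habs
  have hweight' : ∀ ρ : ℝ, 0 < ρ → ρ < 1 → ∫⁻ z, ENNReal.ofReal
      (weightAt w (fun u => PathSpace.obs u z) 1 * envelope ρ (fun u => PathSpace.obs u z) 0)
      ∂(P.map fun ω t => ((y t ω, ε t ω, h t ω) : ℝ × ℝ × ℝ)) < ⊤ := by
    intro ρ h0 h1
    have hmeas : Measurable fun z : PathSpace => ENNReal.ofReal
        (weightAt w (fun u => PathSpace.obs u z) 1 * envelope ρ (fun u => PathSpace.obs u z) 0) :=
      (((measurable_weightAt hw_meas 1).mul (measurable_envelope ρ 0)).comp hobs).ennreal_ofReal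
    rw [lintegral_map' hmeas.aemeasurable hZ]
    exact (lintegral_mono fun ω => ofReal_weight_mul_envelope_le hw_pos h0.le _ 1).trans_lt
      (hweight ρ h0 h1 1)
  have key := hM.consistent H hθ₀' hr harch hnd' (fun γ hγ => (hARMA γ hγ).noCommonRoot)
    (fun δ hδ => (hGARCH δ hδ).noCommonRoot) hw_meas hw_pos hw_bdd hmedian'
    (by rw [hlaw]; exact hint') (by rw [hlaw]; exact habs') hweight'
  have hmin' : ∀ᵐ ω ∂P, ∀ n : ℕ, 1 ≤ n →
      IsQMELE w n (fun k => y k ω) (Θγ ×ˢ Θδ) (θhat n ω) :=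
    ae_all_iff.2 fun n => ae_all_iff.2 (hmin n)
  filter_upwards [ae_of_ae_map hZ (ae_of_ae_map hobs.aemeasurable key), hmin'] with ω h1 h2
  exact h1 (fun n => θhat n ω) h2
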